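/- **Setting.** Let $G$ be a network on $n\ge 2$ users and let $\pi$ be an asynchronous noise-free protocol on $G$ all of whose messages are single bits: each user $u$ has an I/O automaton $\pi_u$ with an initial state, a set of termination states, and transitions labelled by sending a bit to a neighbour or receiving a bit from a neighbour (receiving is possible in every state). Assume that $\pi$ terminates: no user can send forever without receiving, there is no infinite run in which every message is eventually delivered to a user who has not terminated, and a run that cannot be continued has all users in termination states. Let $\delta\in(0,1)$ be the error tolerance. Between neighbours there is, for each of the two users, a two-way channel on which this user initiates exchanges; it carries one bit per time step. An adversary fixes in advance a finite set of $T$ (time, channel) pairs at which the bit on the channel is flipped. On a silent channel the first bit received is fixed in advance by the adversary for free, and the received bit then stays the same except at flips. All random bits of the users are private, independent and uniform. A string of length $\ell$ is *silence* if it has fewer than $\ell/3$ bit alternations. **The protocol $\pi'$.** Round $r\ge 1$ consists of four words of $w_r=K\lceil\log_2(nr/\delta)\rceil$ bits, for an absolute constant $K$. The word $\mathcal E(x,k)$ encodes $(x,k)$ by an AMD code of strength $\delta/(2n^2\pi^2r^2)$ (here $\pi=3.14\ldots$) and then by a binary linear code of constant rate that corrects a constant fraction of flips, followed by uniformly random padding.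 Keys are random strings of $2\lceil\log_2(4n\pi r/\sqrt\delta)\rceil$ bits (again $\pi=3.14\ldots$). The messages from $u$ (Alice) to $v$ (Bob) are sent one after the other. In a round in which Alice has a current message $m$: 1. she sends $\mathcal E(\mathtt{KEY?},k_A)$ with a fresh key $k_A$; 2. if Bob has not terminated, he stays silent until the end of the round when he hears silence, answers a valid request with $\mathcal E(k_B,k_A)$ for a fresh key $k_B$, and otherwise sends noise (random bits) in this word and is then silent; 3. if Alice hears silence she is done with $m$; if she decodes a pair $(k_B,k_A)$ with her own key $k_A$, she sends $\mathcal E((m,b),k_B)$, where $b$ is her parity bit; otherwise she retries $m$ in the next round; 4. if Bob has sent a key, he sends noise unless he decodes a message with his key $k_B$; if he does, he stays silent, and he records the message if its parity bit differs from his own parity bit, which he then sets to the received one. If Alice has sent $\mathcal E((m,b),k_B)$ and now hears silence, she flips $b$ and is done with $m$; otherwise she retries. The two parity bits of a channel start out different. At the start, and after each round, each user who has not terminated lets $\pi_u$ receive the recorded bits, and then makes the sending transitions of $\pi_u$ as long as possible until a termination state is reached, scheduling the messages. A user who has terminated no longer listens, and stops when his scheduled messages are done. **Failure.** $\pi'$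 *fails* if in some round on some channel one of the following happens: (AMD failure) flips turn the AMD codeword of a sent word into a different AMD codeword; (conversion to silence) a word or noise that was sent is received as silence; (key guessing) Alice, having sent $k_A$, receives a word authenticated by $k_A$ although Bob did not send a key, or Bob, having sent $k_B$, receives a word authenticated by $k_B$ although Alice was silent. **Theorem.** There are AMD codes, error-correcting codes, a constant $K$ as above and an absolute constant $C$ such that for all $n\ge2$, $G$, $\pi$, $\delta$, every way of resolving the nondeterminism of $\pi$, and every adversary as above: * $\pi'$ fails with probability at most $\delta$. * Whenever $\pi'$ does not fail, all users stop after finitely many time steps, and there is an asynchronous run of $\pi$ (with FIFO delivery), in which all users terminate, such that each user holds his own share of the transcript of this run and his final state in it. If $L$ is the number of bits sent in this run, then the number of bits sent by $\pi'$ is at most $$C\left(L\log\frac{nL}{\delta}+T\right)$$ (the first term being $0$ if $L=0$), and the number of time steps until all users have stopped is at most $$C\max_p\left\{\Lambda_p\log\frac{n(L+T)}{\delta}+T_p\right\}.$$ Here $p$ ranges over the communication paths of the run, that is, the (possibly empty) sequences of messages in which each message is either the next one after its predecessor on the same channel, or is sent by the recipient of its predecessor after the predecessor has been received; $\Lambda_p$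 is the latency of $p$, that is, its number of (one-bit) messages; and $T_p$ is the number of flips on the channels used by $p$. -/

import Mathlib

open MeasureTheory

noncomputable section

namespace RobustSim

/-- Bits; flipping a bit is adding `1`, and `⊕` on strings is pointwise addition. -/
abbrev Bit := ZMod 2

/-! ### Codes -/

/-- Algebraic manipulation detection codes, for every strength `η` and every message length `x`.
Encoding is randomized: `enc η x ρ m` encodes `m` using the uniformly random string `ρ`. -/
structure AMDCode where
  /-- number of random bits used by the encoder -/
  rlen : ℝ → ℕ → ℕ
  /-- length of the codewords -/
  len : ℝ → ℕ → ℕ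
  enc : ∀ (η : ℝ) (x : ℕ), (Fin (rlen η x) → Bit) → (Fin x → Bit) → (Fin (len η x) → Bit)
  dec : ∀ (η : ℝ) (x : ℕ), (Fin (len η x) → Bit) → (Fin x → Bit)
  /-- constant in the length bound -/
  c : ℝ
  len_le : ∀ (η : ℝ) (x : ℕ), 0 < η → η ≤ 1 / 2 → (len η x : ℝ) ≤ c * (x + Real.log (1 / η))
  dec_enc : ∀ (η : ℝ) (x : ℕ) (ρ : Fin (rlen η x) → Bit) (m : Fin x → Bit),
    0 < η → η ≤ 1 / 2 → dec η x (enc η x ρ m) = m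
  /-- a fixed nonzero offset turns the encoding of `m` into some codeword with
  probability at most `η` -/
  detect : ∀ (η : ℝ) (x : ℕ) (m : Fin x → Bit) (s : Fin (len η x) → Bit),
    0 < η → η ≤ 1 / 2 → s ≠ 0 →
    (Nat.card {ρ : Fin (rlen η x) → Bit // ∃ ρ' m', enc η x ρ' m' = enc η x ρ m + s} : ℝ)
      ≤ η * 2 ^ rlen η x

def AMDCode.IsCodeword (A : AMDCode) (η : ℝ) (x : ℕ) (z : Fin (A.len η x) → Bit) : Prop :=
  ∃ ρ m, A.enc η x ρ m = z

/-- Binary linear codes of constant rate, one for every message length, correcting a constant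
fraction of flipped bits; the decoder rounds the noise to a codeword, so that it commutes with
adding codewords. -/
structure LinearECC where
  len : ℕ → ℕ
  enc : ∀ k, (Fin k → Bit) →ₗ[Bit] (Fin (len k) → Bit)
  dec : ∀ k, (Fin (len k) → Bit) → (Fin k → Bit)
  /-- constant in the length bound -/
  c : ℝ
  len_le : ∀ k, (len k : ℝ) ≤ c * k
  /-- the fraction of flipped bits that is corrected -/
  frac : ℝ
  frac_pos : 0 < frac
  dec_add : ∀ k (m : Fin k → Bit) (e : Fin (len k) → Bit), dec k (enc k m + e) = m + dec k e
  dec_small : ∀ k (e : Fin (len k) → Bit), (hammingNorm e : ℝ) ≤ frac * len k → dec k e = 0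

/-- The codes, the constant in the word length, and the tolerance `δ` used by the users. -/
structure Scheme where
  amd : AMDCode
  ecc : LinearECC
  K : ℕ
  δ : ℝ

/-! ### Contents of words -/

/-- First component of the content of a word: the keyword `KEY?`, a key, or a one-bit message
together with its parity bit. -/
inductive Payload (κ : ℕ) where
  | keyReq : Payload κ
  | key (k : Fin κ → Bit) : Payload κ
  | msg (m b : Bit) : Payload κ

/-- The bit string representing a pair (payload, key). -/
def contentBits {κ : ℕ} : Payload κ × (Fin κ → Bit) → (Fin (4 + κ + κ) → Bit)
  | (.keyReq, k) => Fin.append (Fin.append ![0, 0, 0, 0] 0) k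
  | (.key x, k) => Fin.append (Fin.append ![1, 0, 0, 0] x) k
  | (.msg m b, k) => Fin.append (Fin.append ![0, 1, m, b] 0) k

namespace Scheme

variable (Sc : Scheme) (n r : ℕ)

/-- Length `w_r` of the words of round `r ≥ 1`. -/
def wordLen : ℕ := Sc.K * ⌈Real.logb 2 (n * r / Sc.δ)⌉₊

/-- Length of the keys of round `r`. -/
def keyLen : ℕ := 2 * ⌈Real.logb 2 (4 * n * Real.pi * r / Real.sqrt Sc.δ)⌉₊

/-- AMD strength in round `r`. -/
def strength : ℝ := Sc.δ / (2 * n ^ 2 * Real.pi ^ 2 * r ^ 2)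

abbrev Word := Fin (Sc.wordLen n r) → Bit
abbrev Key := Fin (Sc.keyLen n r) → Bit
abbrev Pay := Payload (Sc.keyLen n r)

/-- Length of the string that is AMD encoded. -/
abbrev contentLen : ℕ := 4 + Sc.keyLen n r + Sc.keyLen n r

abbrev amdLen : ℕ := Sc.amd.len (Sc.strength n r) (Sc.contentLen n r)
abbrev codeLen : ℕ := Sc.ecc.len (Sc.amdLen n r)

/-- AMD encoding of a content with random bits `ρ 0, ρ 1, …`. -/
def amdEncode (x : Sc.Pay n r) (k : Sc.Key n r) (ρ : ℕ → Bit) : Fin (Sc.amdLen n r) → Bit :=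
  Sc.amd.enc (Sc.strength n r) (Sc.contentLen n r) (fun i => ρ i) (contentBits (x, k))

open Classical in
/-- The word encoding `(x, k)`: AMD code, then error-correcting code, then random padding
(bits `pad i`) up to the word length. -/
def encodeWord (x : Sc.Pay n r) (k : Sc.Key n r) (ρ pad : ℕ → Bit) : Sc.Word n r :=
  fun i => if h : (i : ℕ) < Sc.codeLen n r then
      Sc.ecc.enc (Sc.amdLen n r) (Sc.amdEncode n r x k ρ) ⟨i, h⟩
    else pad i

/-- Strip the padding and decode the error-correcting code. -/
def eccDecode (y : Sc.Word n r) : Fin (Sc.amdLen n r) → Bit :=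
  Sc.ecc.dec (Sc.amdLen n r) fun i =>
    if h : (i : ℕ) < Sc.wordLen n r then y ⟨i, h⟩ else 0

def IsAMDWord (z : Fin (Sc.amdLen n r) → Bit) : Prop :=
  Sc.amd.IsCodeword (Sc.strength n r) (Sc.contentLen n r) z

open Classical in
/-- Decoding of a received word; `none` is `(⊥, ⊥)`. -/
def decodeWord (y : Sc.Word n r) : Option (Sc.Pay n r × Sc.Key n r) :=
  if Sc.IsAMDWord n r (Sc.eccDecode n r y) then
    Function.partialInv contentBits
      (Sc.amd.dec (Sc.strength n r) (Sc.contentLen n r) (Sc.eccDecode n r y))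
  else none

/-- Time step at which round `R + 1` begins (time starts at `1`, a round has four words). -/
def roundStart (R : ℕ) : ℕ := 1 + ∑ i ∈ Finset.range R, 4 * Sc.wordLen n (i + 1)

end Scheme

/-- Number of bit alternations of a string. -/
def alternations {w : ℕ} (s : Fin w → Bit) : ℕ :=
  Nat.card {i : Fin w // ∃ h : (i : ℕ) + 1 < w, s ⟨i + 1, h⟩ ≠ s i}

/-- A string is silence if it has fewer than a third of its length many alternations. -/
def IsSilence {w : ℕ} (s : Fin w → Bit) : Prop := 3 * alternations s < w

/-! ### Channels, adversary, private coins -/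

/-- The channel `(u, v)` is the two-way channel on which `u` initiates exchanges with `v`. -/
abbrev Channel (n : ℕ) := Fin n × Fin n

/-- An adversary fixes in advance the finite set of (time, channel) pairs at which a bit is flipped,
and the bits that are received (for free) in the first step of a sequence of silent steps. -/
structure Adversary (n : ℕ) where
  flips : Finset (ℕ × Channel n)
  free : ℕ → Channel n → Bit

open Classical in
def Adversary.flip {n : ℕ} (a : Adversary n) (c : Channel n) (t : ℕ) : Bit :=
  if (t, c) ∈ a.flips then 1 else 0

/-- Bit received in step `t₀ + i` of a silent channel that is silent from step `t₀` to `t₀ + i`.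
`carry` is the bit received in step `t₀ - 1` if that step was silent as well, and `none` if the
sequence of silent steps begins at `t₀`. -/
def silentBit {n : ℕ} (a : Adversary n) (c : Channel n) (carry : Option Bit) (t₀ : ℕ) : ℕ → Bit
  | 0 => match carry with
    | none => a.free t₀ c
    | some b => b + a.flip c t₀
  | i + 1 => silentBit a c carry t₀ i + a.flip c (t₀ + (i + 1))

/-- What is received when `sent` is transmitted from time `t₀` on (`none`: nobody sends). -/
def received {n w : ℕ} (a : Adversary n) (c : Channel n) (carry : Option Bit) (t₀ : ℕ)
    (sent : Option (Fin w → Bit)) : Fin w → Bit :=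
  match sent with
  | some W => fun i => W i + a.flip c (t₀ + i)
  | none => fun i => silentBit a c carry t₀ i

/-- The new value of `carry` after a word of length `w`. -/
def nextCarry {n w : ℕ} (a : Adversary n) (c : Channel n) (carry : Option Bit) (t₀ : ℕ)
    (sent : Option (Fin w → Bit)) : Option Bit :=
  match sent with
  | some _ => none
  | none => some (silentBit a c carry t₀ (w - 1))

/-- The purposes of private random bits in a round on one channel; the index is the word. -/
inductive Purpose where
  | keyA : Purpose
  | keyB : Purpose
  | amd (j : Fin 4) : Purpose
  | pad (j : Fin 4) : Purpose
  | noise (j : Fin 4) : Purpose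

/-- All random bits: indexed by round, channel, purpose and position. -/
abbrev Coins (n : ℕ) := ℕ × Channel n × Purpose × ℕ → Bit

/-- Independent fair coins. -/
def coinMeasure (n : ℕ) : Measure (Coins n) :=
  Measure.infinitePi fun _ => (PMF.uniformOfFintype Bit).toMeasure

/-! ### One round on one channel -/

/-- What a user does during one word. -/
inductive Signal (κ : ℕ) where
  | silent : Signal κ
  | noise : Signal κ
  | word (x : Payload κ) (k : Fin κ → Bit) : Signal κ

def Signal.IsWord {κ : ℕ} : Signal κ → Prop
  | .word _ _ => True
  | _ => False

section Round

variable (Sc : Scheme) {n : ℕ} (adv : Adversary n) (ω : Coins n)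
  (R : ℕ) (c : Channel n)

/-- The keys that Alice and Bob generate in round `R + 1`. -/
def keyA : Sc.Key n (R + 1) := fun i => ω (R + 1, c, .keyA, i)
def keyB : Sc.Key n (R + 1) := fun i => ω (R + 1, c, .keyB, i)

/-- The bits put on the channel in the `j`-th word. -/
def transmit (j : Fin 4) : Signal (Sc.keyLen n (R + 1)) → Option (Sc.Word n (R + 1))
  | .silent => none
  | .noise => some fun i => ω (R + 1, c, .noise j, i)
  | .word x k => some (Sc.encodeWord n (R + 1) x k
      (fun i => ω (R + 1, c, .amd j, i)) (fun i => ω (R + 1, c, .pad j, i)))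

/-- Time step at which the `j`-th word (`j < 4`) of round `R + 1` begins. -/
def wordStart (n : ℕ) (R : ℕ) (j : Fin 4) : ℕ := Sc.roundStart n R + j * Sc.wordLen n (R + 1)

/-- Word 1: Alice requests a key if she has a message. -/
def signal0 (alice : Option (Bit × Bit)) : Signal (Sc.keyLen n (R + 1)) :=
  match alice with
  | none => .silent
  | some _ => .word .keyReq (keyA Sc ω R c)

open Classical in
/-- Word 2: the reaction of Bob to the first received word. `bobOn` says that he is running
`Receive-Message` on this channel. -/
def signal1 (bobOn : Prop) (got0 : Sc.Word n (R + 1)) : Signal (Sc.keyLen n (R + 1)) :=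
  if ¬ bobOn ∨ IsSilence got0 then .silent
  else match Sc.decodeWord n (R + 1) got0 with
    | some (.keyReq, k) => .word (.key (keyB Sc ω R c)) k
    | _ => .noise

open Classical in
/-- Word 3: Alice sends the message with its parity bit if she received an authenticated key. -/
def signal2 (alice : Option (Bit × Bit)) (got1 : Sc.Word n (R + 1)) :
    Signal (Sc.keyLen n (R + 1)) :=
  match alice with
  | none => .silent
  | some (m, b) =>
    if IsSilence got1 then .silent
    else match Sc.decodeWord n (R + 1) got1 with
      | some (.key k', k) => if k = keyA Sc ω R c then .word (.msg m b) k' else .silent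
      | _ => .silent

open Classical in
/-- The message and parity bit that Bob, having sent his key, accepts after word 3, if any. -/
def acceptMsg (sig1 : Signal (Sc.keyLen n (R + 1))) (got2 : Sc.Word n (R + 1)) :
    Option (Bit × Bit) :=
  match sig1 with
  | .word _ _ =>
    match Sc.decodeWord n (R + 1) got2 with
    | some (.msg m b, k) => if k = keyB Sc ω R c then some (m, b) else none
    | _ => none
  | _ => none

/-- Word 4: if Bob has sent his key but has not accepted a message, he sends noise. -/
def signal3 (sig1 : Signal (Sc.keyLen n (R + 1))) (accepted : Option (Bit × Bit)) :
    Signal (Sc.keyLen n (R + 1)) :=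
  match sig1, accepted with
  | .word _ _, none => .noise
  | _, _ => .silent

/-- Everything that happens on a channel in round `R + 1`. -/
structure Exchange (Sc : Scheme) (n R : ℕ) where
  /-- what is done in each of the four words -/
  sig : Fin 4 → Signal (Sc.keyLen n (R + 1))
  /-- the four received words -/
  got : Fin 4 → Sc.Word n (R + 1)
  /-- message and parity bit accepted by Bob -/
  accepted : Option (Bit × Bit)
  /-- memory of the channel after the round -/
  carry : Option Bit

/-- The exchange of round `R + 1` on channel `c`. `alice` is the message being sent and its parity
bit, if `Send-Message` is running. -/
def exchange (alice : Option (Bit × Bit)) (bobOn : Prop) (carry : Option Bit) :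
    Exchange Sc n R :=
  let s0 := signal0 Sc ω R c alice
  let x0 := transmit Sc ω R c 0 s0
  let g0 := received adv c carry (wordStart Sc n R 0) x0
  let c1 := nextCarry adv c carry (wordStart Sc n R 0) x0
  let s1 := signal1 Sc ω R c bobOn g0
  let x1 := transmit Sc ω R c 1 s1
  let g1 := received adv c c1 (wordStart Sc n R 1) x1
  let c2 := nextCarry adv c c1 (wordStart Sc n R 1) x1
  let s2 := signal2 Sc ω R c alice g1
  let x2 := transmit Sc ω R c 2 s2
  let g2 := received adv c c2 (wordStart Sc n R 2) x2
  let c3 := nextCarry adv c c2 (wordStart Sc n R 2) x2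
  let acc := acceptMsg Sc ω R c s1 g2
  let s3 := signal3 Sc R s1 acc
  let x3 := transmit Sc ω R c 3 s3
  let g3 := received adv c c3 (wordStart Sc n R 3) x3
  let c4 := nextCarry adv c c3 (wordStart Sc n R 3) x3
  { sig := ![s0, s1, s2, s3], got := ![g0, g1, g2, g3], accepted := acc, carry := c4 }

end Round

namespace Exchange

variable {Sc : Scheme} {n R : ℕ} (X : Exchange Sc n R)

/-- `Send-Message` returns because Bob was silent when asked for a key. -/
def ReturnsEarly : Prop := (X.sig 0).IsWord ∧ IsSilence (X.got 1)

/-- `Send-Message` returns because Bob was silent after the message was sent. -/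
def ReturnsFinally : Prop := (X.sig 2).IsWord ∧ IsSilence (X.got 3)

/-- Number of bits sent by the two users. -/
def bitsSent : ℕ := Nat.card {j : Fin 4 // X.sig j ≠ .silent} * Sc.wordLen n (R + 1)

/-- The flipped bits turn the AMD codeword of some word into a different AMD codeword. -/
def AMDFailure (ω : Coins n) (c : Channel n) : Prop :=
  ∃ j x k, X.sig j = .word x k ∧
    Sc.IsAMDWord n (R + 1) (Sc.eccDecode n (R + 1) (X.got j)) ∧
    Sc.eccDecode n (R + 1) (X.got j) ≠
      Sc.amdEncode n (R + 1) x k (fun i => ω (R + 1, c, .amd j, i))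

/-- A word or noise that was sent is received as silence. -/
def ConversionToSilence : Prop := ∃ j, X.sig j ≠ .silent ∧ IsSilence (X.got j)

/-- Although Bob did not send a key, Alice receives a word with her key (that she sent in a key
request); or, although Alice was silent, Bob receives a word with his key (that he sent to her). -/
def KeyInstallation (ω : Coins n) (c : Channel n) : Prop :=
  ((X.sig 0).IsWord ∧ ¬ (X.sig 1).IsWord ∧
    ∃ x, Sc.decodeWord n (R + 1) (X.got 1) = some (x, keyA Sc ω R c)) ∨
  ((X.sig 1).IsWord ∧ X.sig 2 = .silent ∧
    ∃ x, Sc.decodeWord n (R + 1) (X.got 2) = some (x, keyB Sc ω R c))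

end Exchange

/-! ### Asynchronous protocols with one-bit messages -/

/-- Labels of the transitions of a user's automaton. -/
inductive Action (n : ℕ) where
  | send (v : Fin n) (m : Bit) : Action n
  | recv (u : Fin n) (m : Bit) : Action n

/-- An asynchronous protocol: an I/O automaton for each user, on the network `G`. What a user
outputs is a function of his termination state. -/
structure Protocol {n : ℕ} (G : SimpleGraph (Fin n)) (S : Fin n → Type*) where
  init : ∀ u, S u
  term : ∀ u, Set (S u)
  step : ∀ u, S u → Action n → S u → Prop
  send_adj : ∀ u s v m s', step u s (.send v m) s' → G.Adj u v
  recv_enabled : ∀ u s v m, G.Adj v u → ∃ s', step u s (.recv v m) s'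

/-- `send u v m`: user `u` sends `m` to `v`. `recv u v m`: user `v` receives `m` from `u`. -/
inductive Event (n : ℕ) where
  | send (u v : Fin n) (m : Bit) : Event n
  | recv (u v : Fin n) (m : Bit) : Event n

def Event.actor {n : ℕ} : Event n → Fin n
  | .send u _ _ => u
  | .recv _ v _ => v

def Event.IsSend {n : ℕ} : Event n → Prop
  | .send _ _ _ => True
  | .recv _ _ _ => False

def Event.IsSendOn {n : ℕ} (u v : Fin n) : Event n → Prop
  | .send u' v' _ => u' = u ∧ v' = v
  | .recv _ _ _ => False

def Event.IsRecvOn {n : ℕ} (u v : Fin n) : Event n → Prop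
  | .recv u' v' _ => u' = u ∧ v' = v
  | .send _ _ _ => False

/-- Global configuration of an asynchronous run: states of the users, and for each ordered pair
the FIFO queue of messages in transit. -/
structure Config {n : ℕ} (S : Fin n → Type*) where
  st : ∀ u, S u
  chan : Fin n → Fin n → List Bit

namespace Protocol

variable {n : ℕ} {G : SimpleGraph (Fin n)} {S : Fin n → Type*} (P : Protocol G S)

def initConfig : Config S := ⟨P.init, fun _ _ => []⟩

/-- One step of an asynchronous run. A user in a termination state no longer sends. -/
inductive Step : Config S → Event n → Config S → Prop
  | send (c : Config S) (u v : Fin n) (m : Bit) (s' : S u) :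
      c.st u ∉ P.term u → P.step u (c.st u) (.send v m) s' →
      Step c (.send u v m) ⟨Function.update c.st u s',
        Function.update c.chan u (Function.update (c.chan u) v (c.chan u v ++ [m]))⟩
  | recv (c : Config S) (u v : Fin n) (m : Bit) (q : List Bit) (s' : S v) :
      c.chan u v = m :: q → P.step v (c.st v) (.recv u m) s' →
      Step c (.recv u v m) ⟨Function.update c.st v s',
        Function.update c.chan u (Function.update (c.chan u) v q)⟩

/-- Finite asynchronous runs. -/
inductive Run : Config S → List (Event n) → Config S → Prop
  | nil (c : Config S) : Run c [] c
  | cons (c c' c'' : Config S) (e : Event n) (tr : List (Event n)) :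
      P.Step c e c' → Run c' tr c'' → Run c (e :: tr) c''

def SendEnabled (c : Config S) (u : Fin n) : Prop :=
  c.st u ∉ P.term u ∧ ∃ v m s', P.step u (c.st u) (.send v m) s'

/-- An infinite asynchronous run, given as a succession of finite runs with infinitely many events
altogether. It is fair if no user remains forever able to send without sending, and messages are
eventually delivered unless the recipient remains in termination states. -/
structure IsInfiniteFairRun (c : ℕ → Config S) (tr : ℕ → List (Event n)) : Prop where
  start : c 0 = P.initConfig
  run : ∀ i, P.Run (c i) (tr i) (c (i + 1))
  infinite : ∀ i, ∃ j ≥ i, tr j ≠ []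
  send_fair : ∀ i u, ∃ j ≥ i,
    (∃ e ∈ tr j, e.IsSend ∧ e.actor = u) ∨ ¬ P.SendEnabled (c j) u
  recv_fair : ∀ i u v, ∃ j ≥ i,
    (∃ e ∈ tr j, e.IsRecvOn u v) ∨ (c j).chan u v = [] ∨
      ∀ k ≥ j, (c k).st v ∈ P.term v

/-- The protocol terminates, whatever the delays of the messages: no user ever sends infinitely
many messages in a row, there is no infinite fair run, and a run that cannot be continued by
sending, nor by delivering to a user who has not terminated, has all users terminated. -/
structure Terminates : Prop where
  no_burst : ∀ tr c u, P.Run P.initConfig tr c → ¬ ∃ s : ℕ → S u, s 0 = c.st u ∧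
    ∀ i, s i ∉ P.term u ∧ ∃ v m, P.step u (s i) (.send v m) (s (i + 1))
  no_infinite : ∀ c tr, ¬ P.IsInfiniteFairRun c tr
  no_deadlock : ∀ tr c, P.Run P.initConfig tr c →
    (∀ u, ¬ P.SendEnabled c u) →
    (∀ u v, c.st v ∉ P.term v → c.chan u v = []) →
    ∀ u, c.st u ∈ P.term u

/-- A way for the users to resolve the nondeterminism of the automata when running them. -/
structure Resolver where
  pick : ∀ u, S u → Option (Fin n × Bit × S u)
  pick_some : ∀ u s v m s', pick u s = some (v, m, s') → P.step u s (.send v m) s'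
  pick_none : ∀ u s, pick u s = none → ∀ v m s', ¬ P.step u s (.send v m) s'
  next : ∀ u, S u → Fin n → Bit → S u
  next_step : ∀ u s v m, G.Adj v u → P.step u s (.recv v m) (next u s v m)

end Protocol

/-! ### The protocol `π'` -/

section Compiled

variable {n : ℕ} {G : SimpleGraph (Fin n)} {S : Fin n → Type*} {P : Protocol G S}

/-- No more sending is to be done in state `s`. -/
def Settled (Rv : P.Resolver) (u : Fin n) (s : S u) : Prop :=
  s ∈ P.term u ∨ Rv.pick u s = none

open Classical in
/-- At most `k` iterations of taking an output transition while not in a termination state: the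
scheduled messages with their recipients, and the state that is reached. -/
def burst (Rv : P.Resolver) (u : Fin n) : ℕ → S u → List (Fin n × Bit) × S u
  | 0, s => ([], s)
  | k + 1, s =>
    if s ∈ P.term u then ([], s)
    else match Rv.pick u s with
      | none => ([], s)
      | some (v, m, s') => ((v, m) :: (burst Rv u k s').1, (burst Rv u k s').2)

open Classical in
/-- Take output transitions until the state is settled (the default value is only for automata that
may send forever). -/
def drain (Rv : P.Resolver) (u : Fin n) (s : S u) : List (Fin n × Bit) × S u :=
  if h : ∃ k, Settled Rv u (burst Rv u k s).2 then burst Rv u (Nat.find h) s else ([], s)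

open Classical in
/-- The scheduled messages with recipient `v`. -/
def toUser (v : Fin n) (l : List (Fin n × Bit)) : List Bit :=
  l.filterMap fun p => if p.1 = v then some p.2 else none

/-- State of the whole system between two rounds. -/
structure Global (P : Protocol G S) where
  /-- state of the automaton simulated by each user -/
  st : ∀ u, S u
  /-- transcript of each user: messages scheduled and messages recorded, in order -/
  hist : Fin n → List (Event n)
  /-- `queue u v`: messages for which `Send-Message` by `u` on the channel to `v` is running
  (the first one) or scheduled (the others) -/
  queue : Fin n → Fin n → List Bit
  /-- parity bit `b` of the sender on channel `(u, v)` -/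
  par : Fin n → Fin n → Bit
  /-- parity bit of the receiver on channel `(u, v)` -/
  parHat : Fin n → Fin n → Bit
  /-- last bit received on channel `(u, v)`, if the channel was silent then -/
  carry : Fin n → Fin n → Option Bit
  /-- number of bits sent so far -/
  bits : ℕ

/-- The system before round 1. The two parity bits of a channel start out different, so that the
first message is recorded. -/
def Global.start (Rv : P.Resolver) : Global P where
  st u := (drain Rv u (P.init u)).2
  hist u := (drain Rv u (P.init u)).1.map fun p => .send u p.1 p.2
  queue u v := toUser v (drain Rv u (P.init u)).1
  par _ _ := 0
  parHat _ _ := 1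
  carry _ _ := none
  bits := 0

variable (Sc : Scheme) (adv : Adversary n) (ω : Coins n)

/-- The exchange of round `R + 1` on the channel `(u, v)`. Receivers that have not terminated listen
to all their neighbours. -/
def Global.exch (g : Global P) (R : ℕ) (u v : Fin n) : Exchange Sc n R :=
  exchange Sc adv ω R (u, v)
    ((g.queue u v).head?.map fun m => (m, g.par u v))
    (G.Adj u v ∧ g.st v ∉ P.term v)
    (g.carry u v)

open Classical in
/-- The message recorded by `v` on channel `(u, v)` in round `R + 1`. -/
def Global.recorded (g : Global P) (R : ℕ) (u v : Fin n) : Option Bit :=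
  (g.exch Sc adv ω R u v).accepted.bind fun p => if p.2 ≠ g.parHat u v then some p.1 else none

/-- The messages recorded by `v` in round `R + 1`, with their senders. -/
def Global.received (g : Global P) (R : ℕ) (v : Fin n) : List (Fin n × Bit) :=
  (List.finRange n).filterMap fun u => (g.recorded Sc adv ω R u v).map fun m => (u, m)

/-- What user `v` schedules for sending, and his state, after round `R + 1`. -/
def Global.react (Rv : P.Resolver) (g : Global P) (R : ℕ) (v : Fin n) :
    List (Fin n × Bit) × S v :=
  drain Rv v ((g.received Sc adv ω R v).foldl (fun s p => Rv.next v s p.1 p.2) (g.st v))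

open Classical in
/-- Round `R + 1` of `π'`. -/
def Global.round (Rv : P.Resolver) (g : Global P) (R : ℕ) : Global P where
  st v := (g.react Sc adv ω Rv R v).2
  hist v := g.hist v ++ ((g.received Sc adv ω R v).map fun p => .recv p.1 v p.2) ++
    ((g.react Sc adv ω Rv R v).1.map fun p => .send v p.1 p.2)
  queue u v :=
    (if (g.exch Sc adv ω R u v).ReturnsEarly ∨ (g.exch Sc adv ω R u v).ReturnsFinally
      then (g.queue u v).tail else g.queue u v) ++
    toUser v (g.react Sc adv ω Rv R u).1
  par u v := if (g.exch Sc adv ω R u v).ReturnsFinally then g.par u v + 1 else g.par u v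
  parHat u v := match (g.exch Sc adv ω R u v).accepted with
    | some p => p.2
    | none => g.parHat u v
  carry u v := (g.exch Sc adv ω R u v).carry
  bits := g.bits + ∑ u, ∑ v, (g.exch Sc adv ω R u v).bitsSent

/-- The system after `R` rounds of `π'`. -/
def execution (Rv : P.Resolver) : ℕ → Global P
  | 0 => Global.start Rv
  | R + 1 => (execution Rv R).round Sc adv ω Rv R

/-- All users have stopped: they are in termination states and have no pending messages. -/
def Global.Stopped (g : Global P) : Prop :=
  ∀ u, g.st u ∈ P.term u ∧ ∀ v, g.queue u v = []

/-- A failure event happens in some round on some channel. -/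
def Fails (Rv : P.Resolver) : Prop :=
  ∃ (R : ℕ) (u v : Fin n),
    ((execution Sc adv ω Rv R).exch Sc adv ω R u v).AMDFailure ω (u, v) ∨
    ((execution Sc adv ω Rv R).exch Sc adv ω R u v).ConversionToSilence ∨
    ((execution Sc adv ω Rv R).exch Sc adv ω R u v).KeyInstallation ω (u, v)

open Classical in
/-- `tr` is an asynchronous run of `π` in which every user terminates, and every user ends up
with his own share of it as transcript, and with his final state in it. -/
def Global.Simulates (g : Global P) (tr : List (Event n)) : Prop :=
  ∃ c : Config S, P.Run P.initConfig tr c ∧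
    (∀ u, g.hist u = tr.filter fun e => e.actor = u) ∧
    ∀ u, g.st u = c.st u ∧ c.st u ∈ P.term u

end Compiled

/-! ### Costs -/

section Costs

variable {n : ℕ}

open Classical in
/-- Total number of bits sent in a run with one-bit messages. -/
def totalBits (tr : List (Event n)) : ℕ := tr.countP fun e => e.IsSend

open Classical in
def sendCount (tr : List (Event n)) (u v : Fin n) : ℕ := tr.countP fun e => e.IsSendOn u v

open Classical in
def recvCount (tr : List (Event n)) (u v : Fin n) : ℕ := tr.countP fun e => e.IsRecvOn u v

/-- `(c, i)` stands for the message number `i` (from `0` on) on the channel `c`. -/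
abbrev MsgId (n : ℕ) := Channel n × ℕ

/-- Message `b` follows message `a`: it is the next one on the same channel, or it is sent by the
recipient of `a` after `a` has been received. -/
def Follows (tr : List (Event n)) (a b : MsgId n) : Prop :=
  (a.1 = b.1 ∧ b.2 = a.2 + 1) ∨
  (a.1.2 = b.1.1 ∧ ∃ t₁ t₂, tr = t₁ ++ t₂ ∧
    a.2 < recvCount t₁ a.1.1 a.1.2 ∧ sendCount t₁ b.1.1 b.1.2 ≤ b.2)

/-- A communication path: messages of the run, each following the previous one. As messages are
single bits, its latency is its length. -/
def IsCommPath (tr : List (Event n)) (p : List (MsgId n)) : Prop :=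
  p.IsChain (Follows tr) ∧ ∀ a ∈ p, a.2 < sendCount tr a.1.1 a.1.2

/-- Number of bits flipped on the channels of a path. -/
def flipsOnPath (adv : Adversary n) (p : List (MsgId n)) : ℕ :=
  Set.ncard {x : ℕ × Channel n | x ∈ adv.flips ∧ ∃ a ∈ p, a.1 = x.2}

/-- Number of time steps taken by the first `R` rounds. -/
def elapsed (Sc : Scheme) (n R : ℕ) : ℕ := Sc.roundStart n R - 1

end Costs

end RobustSim

end

/-! Failures. The flips are fixed in advance, and the decoder of the linear code commutes with
adding codewords. So flips act on a sent word by adding a fixed offset to its AMD codeword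
(`eccDecode_encodeWord_add`). The offset is zero unless a constant fraction of the codeword is
flipped, and a nonzero offset hits another AMD codeword with probability at most the strength
(`measure_amd_le`). Random padding or noise, shifted by fixed flips, rarely has few enough
alternations to pass for silence (`measure_isSilence_le`). A received word that does not depend on
the coins of a key can name only one candidate for that key (`measure_key_le`). For round `r` and
one channel these probabilities add up to at most `δ / (2 n² r²)`, and a union bound over channels
and rounds gives `δ` (`measure_fails_le`).

Simulation. Without failures the analysis is deterministic. All the adversary can do in an exchange
is waste it, and for this a constant fraction of a word must be flipped (`exchange_idle`,
`exchange_unanswered`, `exchange_answered`). Bob accepts nothing but Alice's current message, and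
Alice never believes that a listening Bob has a message that he has not accepted. What remains is
that Bob accepts but his acknowledging silence is spoiled, so that Alice repeats the message; the
parity bits handle this as in the alternating bit protocol. Thus the messages in transit in the
simulated run are those in Alice's queue, without the head if the parities agree. A round becomes a
piece of an asynchronous run by letting the users, one after the other, receive what they recorded
and then send (`inv_round`). If the users never stopped, these pieces would form an infinite fair
run of `π` (`exists_stopped`).

Costs. A channel with a nonempty queue completes a message in a round or absorbs flips proportional
to the word length. Charging rounds and bits to messages or flips bounds the number of rounds by `L
+ T` (`rounds_le`), hence word lengths by a logarithm, and bounds the bits sent (`bits_le`). For the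
time, a chain of causes is traced back from a pending message: each round either extends the
communication path by one message or is paid for by flips on its last channel (`exists_path`). -/

noncomputable section

namespace RobustSim

/-! ### An algebraic manipulation detection code -/

/-- Coordinates on the field with `2 ^ (q + 1)` elements. -/
def fieldEquiv (q : ℕ) : GaloisField 2 (q + 1) ≃ₗ[ZMod 2] (Fin (q + 1) → Bit) :=
  (Module.finBasisOfFinrankEq _ _ (GaloisField.finrank 2 (Nat.succ_ne_zero q))).equivFun

/-- Extend a string by zeros. -/
def zeroPad {x : ℕ} (q : ℕ) (m : Fin x → Bit) : Fin q → Bit :=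
  fun i => if h : (i : ℕ) < x then m ⟨i, h⟩ else 0

theorem zeroPad_add {x : ℕ} (q : ℕ) (m m' : Fin x → Bit) :
    zeroPad q (m + m') = zeroPad q m + zeroPad q m' := by
  ext i
  by_cases h : (i : ℕ) < x <;> simp [zeroPad, h]

theorem zeroPad_eq_zero {x q : ℕ} (h : x ≤ q) {m : Fin x → Bit} (hm : zeroPad q m = 0) :
    m = 0 := by
  ext i
  simpa [zeroPad] using congrFun hm ⟨i, i.2.trans_le h⟩

/-- The authentication tag `ρ³ + mρ`. -/
def cubicTag (q : ℕ) (m ρ : Fin (q + 1) → Bit) : Fin (q + 1) → Bit :=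
  fieldEquiv q ((fieldEquiv q).symm ρ ^ 3 + (fieldEquiv q).symm m * (fieldEquiv q).symm ρ)

theorem card_le_two_of_isRoot (q : ℕ) (p : Polynomial (GaloisField 2 (q + 1)))
    (hp : p ≠ 0) (hd : p.natDegree ≤ 2) (Q : (Fin (q + 1) → Bit) → Prop)
    (h : ∀ ρ, Q ρ → p.IsRoot ((fieldEquiv q).symm ρ)) : Nat.card {ρ // Q ρ} ≤ 2 := by
  classical
  have hsub : {ρ | Q ρ} ⊆ ((p.roots.toFinset.image (fieldEquiv q) : Finset _) : Set _) := by
    intro ρ hρ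
    simp only [Finset.coe_image, Set.mem_image, Finset.mem_coe, Multiset.mem_toFinset]
    exact ⟨(fieldEquiv q).symm ρ, (Polynomial.mem_roots hp).2 (h ρ hρ), by simp⟩
  calc Nat.card {ρ // Q ρ} = Set.ncard {ρ | Q ρ} := rfl
    _ ≤ Set.ncard ((p.roots.toFinset.image (fieldEquiv q) : Finset _) : Set _) :=
        Set.ncard_le_ncard hsub (Finset.finite_toSet _)
    _ = (p.roots.toFinset.image (fieldEquiv q)).card := Set.ncard_coe_finset _
    _ ≤ p.roots.toFinset.card := Finset.card_image_le
    _ ≤ Multiset.card p.roots := Multiset.toFinset_card_le _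
    _ ≤ p.natDegree := p.card_roots'
    _ ≤ 2 := hd

/-- In characteristic two the cubic terms of the two tags cancel and what remains is `Δρ² + (Δ² +
D)ρ + c = 0`, which vanishes identically only if all three offsets are zero. The exponent must not
be `2`: then `D = 0` and `Δ ≠ 0` would leave a constant, which a suitable tag offset makes zero for
every `ρ`. -/
theorem cubicTag_offset_card (q : ℕ) (m d s t : Fin (q + 1) → Bit)
    (h0 : d ≠ 0 ∨ s ≠ 0 ∨ t ≠ 0) :
    Nat.card {ρ // cubicTag q (m + d) (ρ + s) = cubicTag q m ρ + t} ≤ 2 := by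
  classical
  set F := GaloisField 2 (q + 1)
  set φ := fieldEquiv q
  set M := φ.symm m
  set D := φ.symm d
  set Δ := φ.symm s
  set τ := φ.symm t
  have h2 : (2 : F) = 0 := CharTwo.two_eq_zero
  set c : F := Δ ^ 3 + M * Δ + D * Δ - τ
  have key : ∀ ρ, cubicTag q (m + d) (ρ + s) = cubicTag q m ρ + t →
      Δ * (φ.symm ρ) ^ 2 + (Δ ^ 2 + D) * φ.symm ρ + c = 0 := by
    intro ρ h
    have h' := congrArg φ.symm h
    simp only [cubicTag, map_add] at h'
    simp only [show fieldEquiv q = φ from rfl, LinearEquiv.symm_apply_apply] at h'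
    change (φ.symm ρ + Δ) ^ 3 + (M + D) * (φ.symm ρ + Δ) = (φ.symm ρ) ^ 3 + M * φ.symm ρ + τ at h'
    simp only [c]
    linear_combination h' - ((φ.symm ρ) ^ 2 * Δ + φ.symm ρ * Δ ^ 2) * h2
  set p : Polynomial F := .C Δ * .X ^ 2 + .C (Δ ^ 2 + D) * .X + .C c
  have hp : p ≠ 0 := by
    intro hp
    have e2 : p.coeff 2 = Δ := by
      simp [p, -map_add, -map_pow]
    have e1 : p.coeff 1 = Δ ^ 2 + D := by
      simp [p, Polynomial.coeff_C, -map_add, -map_pow]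
    have e0 : p.coeff 0 = c := by simp [p]
    rw [hp] at e2 e1 e0
    simp only [Polynomial.coeff_zero] at e2 e1 e0
    have hΔ : Δ = 0 := e2.symm
    have hD : D = 0 := by simpa [hΔ] using e1.symm
    have hτ : τ = 0 := by simpa [c, hΔ, hD] using e0.symm
    rcases h0 with h | h | h
    · exact h (by simpa [D] using hD)
    · exact h (by simpa [Δ] using hΔ)
    · exact h (by simpa [τ] using hτ)
  refine card_le_two_of_isRoot q p hp Polynomial.natDegree_quadratic_le _ fun ρ h => ?_
  simpa [p, Polynomial.IsRoot] using key ρ h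

/-- The code is systematic: the first two blocks of the offset determine the message and the
randomness of the other codeword, and the third block then is a condition on the tags. -/
theorem cubicTag_detect {x q : ℕ} (hx : x ≤ q + 1) (m : Fin x → Bit)
    (s : Fin (x + (q + 1) + (q + 1)) → Bit) (hs : s ≠ 0) :
    Nat.card {ρ // ∃ ρ' m', Fin.append (Fin.append m' ρ') (cubicTag q (zeroPad _ m') ρ') =
      Fin.append (Fin.append m ρ) (cubicTag q (zeroPad _ m) ρ) + s} ≤ 2 := by
  set d : Fin x → Bit := fun i => s (Fin.castAdd _ (Fin.castAdd _ i)) with hd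
  set e : Fin (q + 1) → Bit := fun i => s (Fin.castAdd _ (Fin.natAdd _ i)) with he
  set t : Fin (q + 1) → Bit := fun i => s (Fin.natAdd _ i) with ht
  have h0 : zeroPad (q + 1) d ≠ 0 ∨ e ≠ 0 ∨ t ≠ 0 := by
    by_contra! hc
    obtain ⟨h1, h2, h3⟩ := hc
    have h1 := zeroPad_eq_zero hx h1
    apply hs
    ext i
    induction i using Fin.addCases with
    | left i =>
      induction i using Fin.addCases with
      | left i => exact congrFun h1 i
      | right i => exact congrFun h2 i
    | right i => exact congrFun h3 i
  refine le_trans ?_ (cubicTag_offset_card q (zeroPad _ m) (zeroPad _ d) e t h0)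
  refine Nat.card_mono (Set.toFinite _) ?_
  rintro ρ ⟨ρ', m', H⟩
  have hm : m' = m + d := by
    ext i; simpa [hd] using congrFun H (Fin.castAdd _ (Fin.castAdd _ i))
  have hr : ρ' = ρ + e := by
    ext i; simpa [he, -Fin.natAdd_eq_addNat] using congrFun H (Fin.castAdd _ (Fin.natAdd _ i))
  have ht : cubicTag q (zeroPad _ m') ρ' = cubicTag q (zeroPad _ m) ρ + t := by
    ext i; simpa [ht, -Fin.natAdd_eq_addNat] using congrFun H (Fin.natAdd _ i)
  rw [hm, hr, zeroPad_add] at ht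
  exact ht

/-- Exponent of the field used for strength `η` and message length `x`. -/
def amdExp (η : ℝ) (x : ℕ) : ℕ := x + ⌈Real.logb 2 (2 / η)⌉₊

/-- The field is large enough for the at most two bad values of `ρ` to be a fraction of at most `η`.
-/
theorem two_le_amdExp {η : ℝ} (x : ℕ) (h : 0 < η) : 2 ≤ η * 2 ^ (amdExp η x + 1) := by
  have h1 : (2 / η : ℝ) ≤ 2 ^ (amdExp η x + 1) := by
    have := Nat.le_ceil (Real.logb 2 (2 / η))
    rw [Real.logb_le_iff_le_rpow (by norm_num) (by positivity), Real.rpow_natCast] at this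
    refine this.trans (pow_le_pow_right₀ (by norm_num) ?_)
    unfold amdExp; omega
  rw [div_le_iff₀ h] at h1
  linarith

/-- The code with codewords `(m, ρ, ρ³ + mρ)`. -/
def cubicAMD : AMDCode where
  rlen η x := amdExp η x + 1
  len η x := x + (amdExp η x + 1) + (amdExp η x + 1)
  enc η x ρ m := Fin.append (Fin.append m ρ) (cubicTag (amdExp η x) (zeroPad _ m) ρ)
  dec η x z := fun i => z (Fin.castAdd _ (Fin.castAdd _ i))
  -- The length is at most `3x + 6 + 2.9 log (1/η)`, and `log (1/η) ≥ log 2` absorbs the `6`.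
  c := 12
  len_le η x h h' := by
    have hl2 := Real.log_two_gt_d9
    have hlog : Real.log 2 ≤ Real.log (1 / η) := by
      apply Real.log_le_log (by norm_num)
      rw [le_div_iff₀ h]; linarith
    have hl : Real.logb 2 (2 / η) ≤ 1 + Real.log (1 / η) * 1.45 := by
      rw [show 2 / η = 2 * (1 / η) by ring, Real.logb, Real.log_mul (by norm_num) (by positivity),
        add_div, div_self (by linarith), div_eq_mul_inv]
      have : (Real.log 2)⁻¹ ≤ 1.45 := by
        rw [inv_le_comm₀ (by linarith) (by norm_num)]; norm_num; linarith
      have : Real.log (1 / η) * (Real.log 2)⁻¹ ≤ Real.log (1 / η) * 1.45 :=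
        mul_le_mul_of_nonneg_left this (by linarith)
      linarith
    have hc : (⌈Real.logb 2 (2 / η)⌉₊ : ℝ) < Real.logb 2 (2 / η) + 1 := by
      apply Nat.ceil_lt_add_one
      apply Real.logb_nonneg (by norm_num)
      rw [le_div_iff₀ h]; linarith
    have hx : (0 : ℝ) ≤ x := x.cast_nonneg
    unfold amdExp
    push_cast
    linarith
  dec_enc η x ρ m _ _ := by
    ext i
    simp
  detect η x m s h _ hs := by
    refine le_trans ?_ (two_le_amdExp x h)
    exact_mod_cast cubicTag_detect (by unfold amdExp; omega) m s hs

/-! ### A binary linear code -/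

/-- The weight enumerator of the full cube factors over the coordinates; it serves as the
exponential moment in a Chernoff bound. -/
theorem sum_pow_hammingNorm (N : ℕ) (a : ℝ) :
    ∑ e : Fin N → Bit, a ^ hammingNorm e = (1 + a) ^ N := by
  classical
  have h : ∀ e : Fin N → Bit, a ^ hammingNorm e = ∏ i, (if e i ≠ 0 then a else 1) := by
    intro e
    rw [hammingNorm, Finset.prod_ite, Finset.prod_const, Finset.prod_const_one, mul_one]
  simp_rw [h]
  have := Finset.prod_univ_sum (fun _ : Fin N => (Finset.univ : Finset Bit))
    (fun (_ : Fin N) (b : Bit) => if b ≠ 0 then a else 1)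
  rw [Fintype.piFinset_univ] at this
  rw [← this]
  have h2 : ∑ b : Bit, (if b ≠ 0 then a else 1) = 1 + a := by
    rw [show (Finset.univ : Finset Bit) = {0, 1} from by decide]
    rw [Finset.sum_insert (by decide), Finset.sum_singleton]
    simp
  rw [Finset.prod_congr rfl fun _ _ => h2]
  simp

/-- Chernoff bound with weight `1/4`: each point of the ball contributes at least `4 ^ (-k/8)` to a
total of `(5/4) ^ (2k)`, so the ball has at most about `(2 ^ (1/4) * 25/16) ^ k` points, and the
base is below `2`. -/
theorem card_hammingBall_lt (k : ℕ) (hk : k ≠ 0) :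
    Nat.card {e : Fin (k + k) → Bit // 8 * hammingNorm e ≤ k} < 2 ^ k := by
  classical
  by_contra! hc
  set B := Finset.univ.filter fun e : Fin (k + k) → Bit => 8 * hammingNorm e ≤ k
  have hB : Nat.card {e : Fin (k + k) → Bit // 8 * hammingNorm e ≤ k} = B.card := by
    rw [Nat.card_eq_fintype_card, Fintype.card_subtype]
  rw [hB] at hc
  have h1 : (B.card : ℝ) * (1 / 4) ^ (k / 8) ≤ (5 / 4) ^ (k + k) := by
    have := sum_pow_hammingNorm (k + k) (1 / 4)
    rw [show (1 : ℝ) + 1 / 4 = 5 / 4 by norm_num] at this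
    rw [← this, ← nsmul_eq_mul]
    calc _ ≤ ∑ e ∈ B, (1 / 4 : ℝ) ^ hammingNorm e := by
          apply Finset.card_nsmul_le_sum
          intro e he
          apply pow_le_pow_of_le_one (by norm_num) (by norm_num)
          have := (Finset.mem_filter.1 he).2
          omega
      _ ≤ _ := Finset.sum_le_univ_sum_of_nonneg fun _ => by positivity
  have h2 : (2 : ℝ) ^ k * (1 / 4) ^ (k / 8) ≤ (25 / 16) ^ k := by
    rw [show (25 / 16 : ℝ) ^ k = (5 / 4) ^ (k + k) by rw [← two_mul, pow_mul]; norm_num]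
    refine le_trans ?_ h1
    gcongr
    exact_mod_cast hc
  -- Fourth powers remove the root and the rounding in `k / 8`; the claim becomes `(25/16) ^ 4 < 8`.
  have h3 : (8 : ℝ) ^ k ≤ ((25 / 16) ^ 4) ^ k := by
    calc (8 : ℝ) ^ k = (2 ^ k) ^ 4 * (1 / 2) ^ k := by
          rw [← pow_mul, mul_comm k 4, pow_mul, ← mul_pow]; norm_num
      _ ≤ (2 ^ k) ^ 4 * ((1 / 2) ^ (8 * (k / 8))) := by
          gcongr ?_ * ?_
          exact pow_le_pow_of_le_one (by norm_num) (by norm_num) (by omega)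
      _ = (2 ^ k * (1 / 4) ^ (k / 8)) ^ 4 := by
          rw [mul_pow, pow_mul, ← pow_mul (1 / 4 : ℝ), mul_comm (k / 8) 4, pow_mul (1 / 4 : ℝ)]
          norm_num
      _ ≤ ((25 / 16) ^ k) ^ 4 := by gcongr
      _ = _ := by rw [← pow_mul, mul_comm, pow_mul]
  have h4 : ((25 / 16 : ℝ) ^ 4) ^ k < 8 ^ k := by
    gcongr
    norm_num
  linarith

/-- The encoding `m ↦ (m, α m)`. -/
def wozencraftEnc (q : ℕ) (α : GaloisField 2 (q + 1)) :
    (Fin (q + 1) → Bit) →ₗ[Bit] (Fin (q + 1 + (q + 1)) → Bit) where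
  toFun m := Fin.append m (fieldEquiv q (α * (fieldEquiv q).symm m))
  map_add' a b := by
    ext i
    refine Fin.addCases (fun i => ?_) (fun i => ?_) i <;> simp [mul_add, -Fin.natAdd_eq_addNat]
  map_smul' c a := by
    ext i
    refine Fin.addCases (fun i => ?_) (fun i => ?_) i <;> simp [-Fin.natAdd_eq_addNat]

/-- Wozencraft's ensemble: a nonzero codeword `(m, αm)` determines `α`, so each light word spoils at
most one `α`. There are `2 ^ k` choices of `α` and fewer light words. -/
theorem exists_good_linear_code (k : ℕ) : ∃ f : (Fin k → Bit) →ₗ[Bit] (Fin (k + k) → Bit),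
    ∀ m, 8 * hammingNorm (f m) ≤ k → m = 0 := by
  rcases k with _ | q
  · exact ⟨0, fun m _ => Subsingleton.elim _ _⟩
  by_contra! hc
  choose m hm hm0 using fun α => hc (wozencraftEnc q α)
  have hinj : Function.Injective fun α : GaloisField 2 (q + 1) =>
      (⟨wozencraftEnc q α (m α), hm α⟩ :
        {e : Fin (q + 1 + (q + 1)) → Bit // 8 * hammingNorm e ≤ q + 1}) := by
    intro α β h
    have h := congrArg Subtype.val h
    have h1 : m α = m β := by
      ext i; simpa [wozencraftEnc] using congrFun h (Fin.castAdd _ i)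
    have h2 : fieldEquiv q (α * (fieldEquiv q).symm (m α)) =
        fieldEquiv q (β * (fieldEquiv q).symm (m β)) := by
      ext i
      simpa [wozencraftEnc, -Fin.natAdd_eq_addNat] using congrFun h (Fin.natAdd _ i)
    rw [h1] at h2
    have h3 := (fieldEquiv q).injective h2
    exact mul_right_cancel₀ (by simpa using hm0 β) h3
  have := Nat.card_le_card_of_injective _ hinj
  rw [GaloisField.card 2 _ (Nat.succ_ne_zero q)] at this
  exact absurd (card_hammingBall_lt (q + 1) (Nat.succ_ne_zero q)) (not_lt.2 this)

/-- A linear code of rate `1 / 2` and positive relative distance. -/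
def goodEnc (k : ℕ) : (Fin k → Bit) →ₗ[Bit] (Fin (k + k) → Bit) :=
  (exists_good_linear_code k).choose

theorem goodEnc_spec (k : ℕ) (m : Fin k → Bit) (h : 8 * hammingNorm (goodEnc k m) ≤ k) : m = 0 :=
  (exists_good_linear_code k).choose_spec m h

theorem goodEnc_injective (k : ℕ) : Function.Injective (goodEnc k) := by
  rw [← LinearMap.ker_eq_bot, LinearMap.ker_eq_bot']
  intro m hm
  exact goodEnc_spec k m (by simp [hm])

open Classical in
/-- A representative of the coset of `y`, of low weight if there is one. -/
def cosetLeader (k : ℕ) (c : (Fin (k + k) → Bit) ⧸ LinearMap.range (goodEnc k)) :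
    Fin (k + k) → Bit :=
  if h : ∃ e, (LinearMap.range (goodEnc k)).mkQ e = c ∧ 16 * hammingNorm e ≤ k then h.choose
  else ((LinearMap.range (goodEnc k)).mkQ_surjective c).choose

theorem mkQ_cosetLeader (k : ℕ) (c) :
    (LinearMap.range (goodEnc k)).mkQ (cosetLeader k c) = c := by
  unfold cosetLeader
  split_ifs with h
  · exact h.choose_spec.1
  · exact ((LinearMap.range (goodEnc k)).mkQ_surjective c).choose_spec

/-- Two elements of a coset of weight at most `k / 16` differ by a codeword of weight at most `k /
8`, which is zero. -/
theorem cosetLeader_mkQ (k : ℕ) (e : Fin (k + k) → Bit) (he : 16 * hammingNorm e ≤ k) :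
    cosetLeader k ((LinearMap.range (goodEnc k)).mkQ e) = e := by
  have h : ∃ e', (LinearMap.range (goodEnc k)).mkQ e' = (LinearMap.range (goodEnc k)).mkQ e ∧
    16 * hammingNorm e' ≤ k := ⟨e, rfl, he⟩
  rw [cosetLeader, dif_pos h]
  obtain ⟨h1, h2⟩ := h.choose_spec
  have h1 := (Submodule.Quotient.eq _).1 h1
  obtain ⟨m, hm⟩ := h1
  have h3 : hammingNorm (goodEnc k m) ≤ hammingNorm h.choose + hammingNorm e := by
    rw [hm, sub_eq_neg_add, ← hammingDist_eq_hammingNorm, hammingDist_comm]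
    calc _ ≤ hammingDist h.choose 0 + hammingDist 0 e := hammingDist_triangle _ _ _
      _ = _ := by rw [hammingDist_zero_right, hammingDist_zero_left]
  have h4 := goodEnc_spec k m (by omega)
  rw [h4, map_zero] at hm
  exact (sub_eq_zero.1 hm.symm)

theorem exists_decode (k : ℕ) (y : Fin (k + k) → Bit) :
    ∃ m, goodEnc k m = y - cosetLeader k ((LinearMap.range (goodEnc k)).mkQ y) := by
  have h := mkQ_cosetLeader k ((LinearMap.range (goodEnc k)).mkQ y)
  rw [eq_comm, Submodule.mkQ_apply, Submodule.mkQ_apply, Submodule.Quotient.eq] at h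
  exact h

/-- The correction subtracted before decoding depends only on the coset of `y`. This is why decoding
commutes with adding codewords, even beyond the correctable radius. -/
def goodDec (k : ℕ) (y : Fin (k + k) → Bit) : Fin k → Bit := (exists_decode k y).choose

theorem goodEnc_goodDec (k : ℕ) (y : Fin (k + k) → Bit) :
    goodEnc k (goodDec k y) = y - cosetLeader k ((LinearMap.range (goodEnc k)).mkQ y) :=
  (exists_decode k y).choose_spec

/-- A binary linear code of rate `1 / 2`, correcting a fraction of `1 / 32` flipped bits. -/
def wozencraftECC : LinearECC where
  len k := k + k
  enc := goodEnc
  dec := goodDec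
  c := 2
  len_le k := by push_cast; linarith
  -- Errors of weight `k / 16` are corrected in words of length `2k`.
  frac := 1 / 32
  frac_pos := by norm_num
  dec_add k m e := by
    apply goodEnc_injective
    rw [map_add, goodEnc_goodDec, goodEnc_goodDec, map_add]
    have : (LinearMap.range (goodEnc k)).mkQ (goodEnc k m) = 0 := by
      rw [Submodule.mkQ_apply, Submodule.Quotient.mk_eq_zero]
      exact ⟨m, rfl⟩
    rw [this, zero_add, add_sub_assoc]
  dec_small k e he := by
    apply goodEnc_injective
    rw [goodEnc_goodDec, cosetLeader_mkQ, sub_self, map_zero]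
    push_cast at he
    have : (16 * hammingNorm e : ℝ) ≤ k := by linarith
    exact_mod_cast this

/-! ### The parameters of the scheme -/

/-- What the analysis of a round needs to know about the lengths of words and codes. -/
structure Scheme.Fits (Sc : Scheme) (n D : ℕ) : Prop where
  strength_pos : ∀ r, 1 ≤ r → 0 < Sc.strength n r
  strength_le : ∀ r, 1 ≤ r → Sc.strength n r ≤ 1 / 2
  codeLen_le : ∀ r, 1 ≤ r → Sc.codeLen n r ≤ Sc.wordLen n r
  wordLen_le : ∀ r, 1 ≤ r → (Sc.wordLen n r : ℝ) ≤ D * (Sc.ecc.frac * Sc.codeLen n r)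
  wordLen_pos : ∀ r, 1 ≤ r → 0 < Sc.wordLen n r
  wordLen_mono : ∀ r, 1 ≤ r → Sc.wordLen n r ≤ Sc.wordLen n (r + 1)
  three_le : 3 ≤ D

/-- The scheme with the codes constructed above. -/
def concreteScheme (δ : ℝ) : Scheme := ⟨cubicAMD, wozencraftECC, 2400, δ⟩

/-- The logarithm to which word lengths are proportional. -/
def logLen (n r : ℕ) (δ : ℝ) : ℕ := ⌈Real.logb 2 (n * r / δ)⌉₊

section

variable {n r : ℕ} {δ : ℝ}

theorem wordLen_concrete : (concreteScheme δ).wordLen n r = 2400 * logLen n r δ := rfl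

theorem ceil_logb_le {x : ℝ} {k : ℕ} (hx : 0 < x) (h : x ≤ 2 ^ k) : ⌈Real.logb 2 x⌉₊ ≤ k := by
  rw [Nat.ceil_le, Real.logb_le_iff_le_rpow (by norm_num) hx, Real.rpow_natCast]
  exact h

theorem le_two_pow_ceil_logb {x : ℝ} (hx : 0 < x) : x ≤ 2 ^ ⌈Real.logb 2 x⌉₊ := by
  have := Nat.le_ceil (Real.logb 2 x)
  rwa [Real.logb_le_iff_le_rpow (by norm_num) hx, Real.rpow_natCast] at this

variable (hn : 2 ≤ n) (hr : 1 ≤ r) (h0 : 0 < δ) (h1 : δ < 1)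
include hn hr h0 h1

theorem two_lt_ratio : 2 < (n * r / δ : ℝ) := by
  have hn' : (2 : ℝ) ≤ n := by exact_mod_cast hn
  have hr' : (1 : ℝ) ≤ r := by exact_mod_cast hr
  rw [lt_div_iff₀ h0]
  nlinarith

theorem ratio_le_two_pow : (n * r / δ : ℝ) ≤ 2 ^ logLen n r δ :=
  le_two_pow_ceil_logb (by linarith [two_lt_ratio hn hr h0 h1])

theorem two_le_logLen : 2 ≤ logLen n r δ := by
  by_contra! hc
  have := ratio_le_two_pow hn hr h0 h1
  have h2 : (2 : ℝ) ^ logLen n r δ ≤ 2 ^ 1 := pow_le_pow_right₀ (by norm_num) (by omega)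
  linarith [two_lt_ratio hn hr h0 h1]

omit h1 in
theorem key_ratio_pos : (0 : ℝ) < 4 * n * Real.pi * r / √δ := by
  have hn' : (2 : ℝ) ≤ n := by exact_mod_cast hn
  have hr' : (1 : ℝ) ≤ r := by exact_mod_cast hr
  have := Real.pi_pos
  positivity

theorem keyLen_le : (concreteScheme δ).keyLen n r ≤ 6 * logLen n r δ := by
  have h2 := two_le_logLen hn hr h0 h1
  -- Here `π ≤ 4` and `δ ≤ √δ`. Afterwards `2 (4 + l) ≤ 6 l` because `l ≥ 2`.
  have h3 : ⌈Real.logb 2 (4 * n * Real.pi * r / √δ)⌉₊ ≤ 4 + logLen n r δ := by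
    apply ceil_logb_le (key_ratio_pos hn hr h0)
    calc (4 * n * Real.pi * r / √δ : ℝ) ≤ 4 * n * 4 * r / δ := by
          gcongr
          · exact Real.pi_le_four
          · rw [Real.le_sqrt h0.le h0.le]; nlinarith
      _ = 2 ^ 4 * (n * r / δ) := by ring
      _ ≤ 2 ^ 4 * 2 ^ logLen n r δ := by
          gcongr; exact ratio_le_two_pow hn hr h0 h1
      _ = _ := by rw [pow_add]
  have : (concreteScheme δ).keyLen n r = 2 * ⌈Real.logb 2 (4 * n * Real.pi * r / √δ)⌉₊ := rfl
  omega

omit h1 in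
-- The factor `2` in the key length squares the argument of the logarithm, so the probability of
-- guessing a key is of order `δ / (n r)²`.
theorem le_two_pow_keyLen :
    16 * n ^ 2 * Real.pi ^ 2 * r ^ 2 / δ ≤ 2 ^ (concreteScheme δ).keyLen n r := by
  have h := le_two_pow_ceil_logb (key_ratio_pos hn hr h0)
  have h2 := pow_le_pow_left₀ (key_ratio_pos hn hr h0).le h 2
  rw [← pow_mul, mul_comm _ 2, div_pow, Real.sq_sqrt h0.le] at h2
  refine le_trans (le_of_eq ?_) h2
  ring

theorem logLen_le_keyLen : logLen n r δ ≤ (concreteScheme δ).keyLen n r := by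
  apply ceil_logb_le (by linarith [two_lt_ratio hn hr h0 h1])
  refine le_trans ?_ (le_two_pow_keyLen hn hr h0)
  have hn' : (2 : ℝ) ≤ n := by exact_mod_cast hn
  have hr' : (1 : ℝ) ≤ r := by exact_mod_cast hr
  have hp := Real.pi_gt_three
  rw [div_le_div_iff_of_pos_right h0]
  have h3 : (1 : ℝ) ≤ Real.pi ^ 2 := by nlinarith
  have h4 : (1 : ℝ) ≤ n * r := by nlinarith
  calc (n * r : ℝ) ≤ 16 * (n * r) ^ 2 * 1 := by nlinarith
    _ ≤ 16 * (n * r) ^ 2 * Real.pi ^ 2 := by gcongr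
    _ = _ := by ring

omit h1 in
theorem concrete_strength_pos : 0 < (concreteScheme δ).strength n r := by
  have hn' : (2 : ℝ) ≤ n := by exact_mod_cast hn
  have hr' : (1 : ℝ) ≤ r := by exact_mod_cast hr
  have := Real.pi_pos
  unfold Scheme.strength concreteScheme
  positivity

theorem concrete_strength_le : (concreteScheme δ).strength n r ≤ 1 / 2 := by
  have hn' : (2 : ℝ) ≤ n := by exact_mod_cast hn
  have hr' : (1 : ℝ) ≤ r := by exact_mod_cast hr
  have hp := Real.pi_gt_three
  have h3 : (1 : ℝ) ≤ Real.pi ^ 2 := by nlinarith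
  have h4 : (1 : ℝ) ≤ n ^ 2 := by nlinarith
  have h5 : (1 : ℝ) ≤ r ^ 2 := by nlinarith
  have h6 : (1 : ℝ) ≤ n ^ 2 * Real.pi ^ 2 * r ^ 2 :=
    one_le_mul_of_one_le_of_one_le (one_le_mul_of_one_le_of_one_le h4 h3) h5
  unfold Scheme.strength concreteScheme
  rw [div_le_iff₀ (by positivity)]
  nlinarith

theorem strengthExp_le :
    ⌈Real.logb 2 (2 / (concreteScheme δ).strength n r)⌉₊ ≤ 5 * logLen n r δ := by
  have h2 := two_le_logLen hn hr h0 h1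
  have hs := concrete_strength_pos hn hr h0
  have hn' : (2 : ℝ) ≤ n := by exact_mod_cast hn
  have hr' : (1 : ℝ) ≤ r := by exact_mod_cast hr
  refine le_trans (ceil_logb_le (k := 6 + 2 * logLen n r δ) (by positivity) ?_) (by omega)
  have hp := Real.pi_pos
  calc 2 / (concreteScheme δ).strength n r = 4 * (n ^ 2 * Real.pi ^ 2 * r ^ 2) / δ := by
        unfold Scheme.strength concreteScheme
        field_simp
        ring
    _ ≤ 4 * (n ^ 2 * 4 ^ 2 * r ^ 2) / δ ^ 2 := by
        gcongr
        · exact Real.pi_le_four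
        · nlinarith
    _ = 2 ^ 6 * (n * r / δ) ^ 2 := by ring
    _ ≤ 2 ^ 6 * (2 ^ logLen n r δ) ^ 2 := by
        gcongr; exact ratio_le_two_pow hn hr h0 h1
    _ = _ := by rw [pow_add, ← pow_mul, mul_comm 2]

omit hn hr h0 h1 in
theorem codeLen_concrete : (concreteScheme δ).codeLen n r =
    6 * (concreteScheme δ).contentLen n r +
      4 * (⌈Real.logb 2 (2 / (concreteScheme δ).strength n r)⌉₊ + 1) := by
  change (_ + (amdExp _ _ + 1) + (amdExp _ _ + 1)) + (_ + (amdExp _ _ + 1) + (amdExp _ _ + 1)) = _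
  unfold amdExp
  ring

theorem codeLen_concrete_le : (concreteScheme δ).codeLen n r ≤ 106 * logLen n r δ := by
  have h2 := two_le_logLen hn hr h0 h1
  have h3 := keyLen_le hn hr h0 h1
  have h4 := strengthExp_le hn hr h0 h1
  have h5 := codeLen_concrete (n := n) (r := r) (δ := δ)
  unfold Scheme.contentLen at h5
  -- With `l = logLen n r δ`, `6 (4 + 12 l) + 4 (5 l + 1) = 92 l + 28 ≤ 106 l`, since `l ≥ 2`.
  omega

/-- The content holds two keys of at least `logLen` bits each, and the codeword is at least six
times as long as the content. A lower bound is needed because the adversary's price is a fraction of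
the codeword, while a wasted round costs whole words. -/
theorem le_codeLen_concrete : 12 * logLen n r δ ≤ (concreteScheme δ).codeLen n r := by
  have h3 := logLen_le_keyLen hn hr h0 h1
  have h5 := codeLen_concrete (n := n) (r := r) (δ := δ)
  unfold Scheme.contentLen at h5
  omega

end

/-- The value `6400` is the ratio of the word length `2400 l` to the number of flips `12 l / 32`
that the code is certain to correct. -/
theorem fits_concrete {n : ℕ} {δ : ℝ} (hn : 2 ≤ n) (h0 : 0 < δ) (h1 : δ < 1) :
    (concreteScheme δ).Fits n 6400 where
  strength_pos r hr := concrete_strength_pos hn hr h0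
  strength_le r hr := concrete_strength_le hn hr h0 h1
  codeLen_le r hr := by
    have := codeLen_concrete_le hn hr h0 h1
    rw [wordLen_concrete]; omega
  wordLen_le r hr := by
    have : (12 * logLen n r δ : ℝ) ≤ (concreteScheme δ).codeLen n r := by
      exact_mod_cast le_codeLen_concrete hn hr h0 h1
    rw [wordLen_concrete, show (concreteScheme δ).ecc.frac = 1 / 32 from rfl]
    push_cast
    linarith
  wordLen_pos r hr := by
    have := two_le_logLen hn hr h0 h1
    rw [wordLen_concrete]; omega
  wordLen_mono r hr := by
    have : (0 : ℝ) < n * r / δ := by linarith [two_lt_ratio hn hr h0 h1]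
    rw [wordLen_concrete, wordLen_concrete]
    gcongr
    apply Nat.ceil_mono
    apply Real.logb_le_logb_of_le (by norm_num) this
    gcongr
    omega
  three_le := by norm_num

/-! ### Received words -/

theorem contentBits_injective {κ : ℕ} : Function.Injective (contentBits (κ := κ)) := by
  rintro ⟨x, k⟩ ⟨x', k'⟩ h
  have hlast : ∀ i, contentBits (x, k) (Fin.natAdd _ i) = k i := by
    intro i
    cases x <;> simp [contentBits, -Fin.natAdd_eq_addNat]
  have hlast' : ∀ i, contentBits (x', k') (Fin.natAdd _ i) = k' i := by
    intro i
    cases x' <;> simp [contentBits, -Fin.natAdd_eq_addNat]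
  have hk : k = k' := by
    ext i
    rw [← hlast, ← hlast', h]
  subst hk
  have hb : ∀ i : Fin 4, contentBits (x, k) (Fin.castAdd _ (Fin.castAdd _ i)) =
      contentBits (x', k) (Fin.castAdd _ (Fin.castAdd _ i)) := fun i => by rw [h]
  have hm : ∀ i : Fin κ, contentBits (x, k) (Fin.castAdd _ (Fin.natAdd _ i)) =
      contentBits (x', k) (Fin.castAdd _ (Fin.natAdd _ i)) := fun i => by rw [h]
  have h0 := hb 0
  have h1 := hb 1
  have h2 := hb 2
  have h3 := hb 3
  cases x <;> cases x' <;>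
    simp only [contentBits, Fin.append_left, Fin.append_right] at h0 h1 h2 h3 hm <;>
    first
    | rfl
    | (rw [funext hm]; done)
    | (exfalso; revert h0; simp; done)
    | (exfalso; revert h1; simp; done)
    | congr 2

section Flips

variable {n : ℕ} (adv : Adversary n) (c : Channel n)

open Classical in
/-- Number of flips on a channel in the `w` time steps from `t` on. -/
def flipCount (t w : ℕ) : ℕ :=
  (adv.flips.filter fun x => x.2 = c ∧ t ≤ x.1 ∧ x.1 < t + w).card

/-- On a silent channel the received bit changes only at a flip, whatever the first bit was, so
alternations inject into flips. -/
theorem alternations_silent_le (carry : Option Bit) (t w : ℕ) :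
    alternations (received adv c carry t (none : Option (Fin w → Bit))) ≤ flipCount adv c t w := by
  classical
  unfold alternations flipCount
  rw [← Fintype.card_coe, ← Nat.card_eq_fintype_card]
  refine Nat.card_le_card_of_injective (fun i => ⟨(t + (i.1 + 1), c), ?_⟩) ?_
  · obtain ⟨i, hi, h⟩ := i
    have hf : adv.flip c (t + (i + 1)) ≠ 0 := by
      intro h0
      exact h (by simp [received, silentBit, h0])
    have hmem : (t + ((i : ℕ) + 1), c) ∈ adv.flips := by
      by_contra hc
      simp [Adversary.flip, hc] at hf
    simp only [Finset.mem_filter, true_and]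
    exact ⟨hmem, by omega, by omega⟩
  · rintro ⟨i, hi⟩ ⟨j, hj⟩ h
    simp at h
    exact Subtype.ext (Fin.ext h)

theorem le_flipCount_of_not_isSilence {carry : Option Bit} {t w : ℕ}
    (h : ¬ IsSilence (received adv c carry t (none : Option (Fin w → Bit)))) :
    w ≤ 3 * flipCount adv c t w := by
  have := alternations_silent_le adv c carry t w
  unfold IsSilence at h
  omega

theorem hammingNorm_flip_le {N w : ℕ} (h : N ≤ w) (t : ℕ) :
    hammingNorm (fun i : Fin N => adv.flip c (t + i)) ≤ flipCount adv c t w := by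
  classical
  unfold flipCount hammingNorm
  refine Finset.card_le_card_of_injOn (fun i => (t + i, c)) ?_ ?_
  · intro i hi
    simp only [Finset.coe_filter, Finset.mem_univ, true_and, Set.mem_ofPred_eq] at hi
    have hmem : (t + (i : ℕ), c) ∈ adv.flips := by
      by_contra hc
      simp [Adversary.flip, hc] at hi
    simp only [Finset.coe_filter, Set.mem_ofPred_eq, true_and]
    exact ⟨hmem, by omega, by omega⟩
  · intro i _ j _ h
    simp at h
    exact Fin.ext h

end Flips

section Decoding

variable {Sc : Scheme} {n r : ℕ}

/-- The flips reach the AMD codeword as an additive offset that depends on the flips alone, not on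
the word sent. This is the situation for which AMD codes are made. -/
theorem eccDecode_encodeWord_add (h : Sc.codeLen n r ≤ Sc.wordLen n r) (x : Sc.Pay n r)
    (k : Sc.Key n r) (ρ pad : ℕ → Bit) (e : ℕ → Bit) :
    Sc.eccDecode n r (fun i => Sc.encodeWord n r x k ρ pad i + e i) =
      Sc.amdEncode n r x k ρ + Sc.ecc.dec (Sc.amdLen n r) (fun i => e i) := by
  unfold Scheme.eccDecode
  rw [← Sc.ecc.dec_add]
  congr 1
  ext i
  have hi : (i : ℕ) < Sc.codeLen n r := i.2
  simp only [hi.trans_le h, dite_true, Scheme.encodeWord, hi, Pi.add_apply]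

theorem decodeWord_of_eq (hs : 0 < Sc.strength n r) (hs' : Sc.strength n r ≤ 1 / 2)
    {y : Sc.Word n r} {x : Sc.Pay n r} {k : Sc.Key n r} {ρ : ℕ → Bit}
    (h : Sc.eccDecode n r y = Sc.amdEncode n r x k ρ) : Sc.decodeWord n r y = some (x, k) := by
  have hc : Sc.IsAMDWord n r (Sc.eccDecode n r y) := by
    rw [h]; exact ⟨_, _, rfl⟩
  rw [Scheme.decodeWord, if_pos hc, h, Scheme.amdEncode, Sc.amd.dec_enc _ _ _ _ hs hs']
  exact Function.partialInv_left contentBits_injective _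

end Decoding

/-! ### One round on one channel -/

section Exchange

variable {Sc : Scheme} {n D : ℕ} {adv : Adversary n} {ω : Coins n} {R : ℕ} {c : Channel n}
  {alice : Option (Bit × Bit)} {bobOn : Prop} {carry : Option Bit}

/-- Number of flips on a channel in round `R + 1`. -/
def roundFlips (Sc : Scheme) (adv : Adversary n) (R : ℕ) (c : Channel n) : ℕ :=
  flipCount adv c (Sc.roundStart n R) (4 * Sc.wordLen n (R + 1))

/-- Some failure event happens in the exchange. -/
def Exchange.Failure (X : Exchange Sc n R) (ω : Coins n) (c : Channel n) : Prop :=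
  X.AMDFailure ω c ∨ X.ConversionToSilence ∨ X.KeyInstallation ω c

theorem wordFlips_le (j : Fin 4) :
    flipCount adv c (wordStart Sc n R j) (Sc.wordLen n (R + 1)) ≤ roundFlips Sc adv R c := by
  classical
  unfold roundFlips flipCount
  apply Finset.card_le_card
  apply Finset.monotone_filter_right
  rintro x - ⟨h1, h2, h3⟩
  have : wordStart Sc n R j = Sc.roundStart n R + j * Sc.wordLen n (R + 1) := rfl
  have hj : (j : ℕ) + 1 ≤ 4 := j.2
  have := Nat.mul_le_mul_right (Sc.wordLen n (R + 1)) hj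
  rw [add_mul, one_mul] at this
  exact ⟨h1, by omega, by omega⟩

local notation "X" => exchange Sc adv ω R c alice bobOn carry

theorem exchange_got (j : Fin 4) : ∃ cy, (X).got j =
    received adv c cy (wordStart Sc n R j) (transmit Sc ω R c j ((X).sig j)) := by
  fin_cases j <;> exact ⟨_, rfl⟩

theorem le_flips_of_not_isSilence (hD : Sc.Fits n D) {j : Fin 4} (hj : (X).sig j = .silent)
    (h : ¬ IsSilence ((X).got j)) : Sc.wordLen n (R + 1) ≤ D * roundFlips Sc adv R c := by
  obtain ⟨cy, hcy⟩ := exchange_got (Sc := Sc) (adv := adv) (ω := ω) (R := R) (c := c)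
    (alice := alice) (bobOn := bobOn) (carry := carry) j
  rw [hj] at hcy
  rw [hcy] at h
  calc _ ≤ 3 * flipCount adv c (wordStart Sc n R j) (Sc.wordLen n (R + 1)) :=
        le_flipCount_of_not_isSilence adv c h
    _ ≤ _ := Nat.mul_le_mul hD.three_le (wordFlips_le j)

/-- If the decoded string is an AMD codeword it must be the original one, as there is no AMD
failure. If it is not, then the linear code has not corrected the flips, so a constant fraction of
the codeword was flipped. -/
theorem decode_word (hD : Sc.Fits n D) (hX : ¬ (X).Failure ω c) {j : Fin 4}
    {x : Sc.Pay n (R + 1)} {k : Sc.Key n (R + 1)} (hj : (X).sig j = .word x k) :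
    Sc.decodeWord n (R + 1) ((X).got j) = some (x, k) ∨
      (Sc.decodeWord n (R + 1) ((X).got j) = none ∧
        Sc.wordLen n (R + 1) ≤ D * roundFlips Sc adv R c) := by
  obtain ⟨cy, hcy⟩ := exchange_got (Sc := Sc) (adv := adv) (ω := ω) (R := R) (c := c)
    (alice := alice) (bobOn := bobOn) (carry := carry) j
  by_cases hA : Sc.IsAMDWord n (R + 1) (Sc.eccDecode n (R + 1) ((X).got j))
  · left
    by_contra hne
    refine hX (.inl ⟨j, x, k, hj, hA, fun he => hne ?_⟩)
    exact decodeWord_of_eq (hD.strength_pos _ (by omega)) (hD.strength_le _ (by omega)) he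
  · right
    refine ⟨by rw [Scheme.decodeWord, if_neg hA], ?_⟩
    rw [hcy, hj] at hA
    have hl := hD.codeLen_le (R + 1) (by omega)
    rw [show received adv c cy (wordStart Sc n R j) (transmit Sc ω R c j (.word x k)) =
      fun i => Sc.encodeWord n (R + 1) x k (fun i => ω (R + 1, c, .amd j, i))
        (fun i => ω (R + 1, c, .pad j, i)) i + adv.flip c (wordStart Sc n R j + i) from rfl,
      eccDecode_encodeWord_add hl x k _ _ (fun i => adv.flip c (wordStart Sc n R j + i))] at hA
    have hf : ¬ ((hammingNorm fun i : Fin (Sc.codeLen n (R + 1)) =>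
        adv.flip c (wordStart Sc n R j + i) : ℕ) : ℝ) ≤ Sc.ecc.frac * Sc.codeLen n (R + 1) := by
      intro hf
      rw [Sc.ecc.dec_small _ _ hf, add_zero] at hA
      exact hA ⟨_, _, rfl⟩
    have h1 := hammingNorm_flip_le adv c hl (wordStart Sc n R j)
    have h2 := h1.trans (wordFlips_le j)
    have h3 := hD.wordLen_le (R + 1) (by omega)
    have h4 : (Sc.wordLen n (R + 1) : ℝ) ≤ D * roundFlips Sc adv R c := by
      refine h3.trans (mul_le_mul_of_nonneg_left ?_ (Nat.cast_nonneg _))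
      refine (not_le.1 hf).le.trans ?_
      exact_mod_cast h2
    exact_mod_cast h4

theorem bitsSent_le (E : Exchange Sc n R) : E.bitsSent ≤ 4 * Sc.wordLen n (R + 1) := by
  refine Nat.mul_le_mul_right _ ?_
  calc _ ≤ Nat.card (Fin 4) := Nat.card_le_card_of_injective _ Subtype.val_injective
    _ = 4 := by simp

theorem bitsSent_eq_zero (E : Exchange Sc n R) (h : ∀ j, E.sig j = .silent) : E.bitsSent = 0 := by
  simp [Exchange.bitsSent, h]

/-- Alice being silent, acceptance by Bob would mean that his key was guessed. He sends something
only if the first word does not sound silent, which takes flips. -/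
theorem exchange_idle (hD : Sc.Fits n D)
    (hX : ¬ (exchange Sc adv ω R c none bobOn carry).Failure ω c) :
    (exchange Sc adv ω R c none bobOn carry).accepted = none ∧
    ¬ (exchange Sc adv ω R c none bobOn carry).ReturnsEarly ∧
    ¬ (exchange Sc adv ω R c none bobOn carry).ReturnsFinally ∧
    ((exchange Sc adv ω R c none bobOn carry).bitsSent = 0 ∨
      Sc.wordLen n (R + 1) ≤ D * roundFlips Sc adv R c) := by
  set Y := exchange Sc adv ω R c none bobOn carry with hY
  have s0 : Y.sig 0 = .silent := rfl
  have s2 : Y.sig 2 = .silent := rfl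
  have s1 : Y.sig 1 = signal1 Sc ω R c bobOn (Y.got 0) := rfl
  have ha : Y.accepted = acceptMsg Sc ω R c (Y.sig 1) (Y.got 2) := rfl
  have s3 : Y.sig 3 = signal3 Sc R (Y.sig 1) Y.accepted := rfl
  have hacc : Y.accepted = none := by
    rcases h1 : Y.sig 1 with _ | _ | ⟨x, k⟩
    · rw [ha, h1]; rfl
    · rw [ha, h1]; rfl
    · rw [ha, h1, acceptMsg]
      rcases hd : Sc.decodeWord n (R + 1) (Y.got 2) with _ | ⟨x', k'⟩
      · simp
      · cases x' <;> simp only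
        split_ifs with hk
        · exfalso
          apply hX
          right; right; right
          exact ⟨by rw [h1]; trivial, s2, _, by rw [← hk]; exact hd⟩
        · rfl
  refine ⟨hacc, ?_, ?_, ?_⟩
  · rintro ⟨h, -⟩; rw [s0] at h; exact h
  · rintro ⟨h, -⟩; rw [s2] at h; exact h
  · by_cases h0 : IsSilence (Y.got 0)
    · left
      have h1 : Y.sig 1 = .silent := by
        rw [s1, signal1, if_pos (Or.inr h0)]
      have h3 : Y.sig 3 = .silent := by rw [s3, h1]; rfl
      apply bitsSent_eq_zero
      intro j
      fin_cases j
      · exact s0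
      · exact h1
      · exact s2
      · exact h3
    · right
      exact le_flips_of_not_isSilence hD s0 h0

/-- A user who no longer listens stays silent throughout. Alice would proceed to the third word only
on hearing her own key, which nobody sent back. -/
theorem exchange_unanswered (hD : Sc.Fits n D) (hb : ¬ bobOn) {m b : Bit}
    (hX : ¬ (exchange Sc adv ω R c (some (m, b)) bobOn carry).Failure ω c) :
    (exchange Sc adv ω R c (some (m, b)) bobOn carry).accepted = none ∧
    ¬ (exchange Sc adv ω R c (some (m, b)) bobOn carry).ReturnsFinally ∧
    ((exchange Sc adv ω R c (some (m, b)) bobOn carry).ReturnsEarly ∨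
      Sc.wordLen n (R + 1) ≤ D * roundFlips Sc adv R c) := by
  set Y := exchange Sc adv ω R c (some (m, b)) bobOn carry with hY
  have s0 : Y.sig 0 = .word .keyReq (keyA Sc ω R c) := rfl
  have s1 : Y.sig 1 = .silent := by
    change signal1 Sc ω R c bobOn (Y.got 0) = _
    rw [signal1, if_pos (Or.inl hb)]
  have ha : Y.accepted = none := by
    change acceptMsg Sc ω R c (Y.sig 1) (Y.got 2) = _
    rw [s1]; rfl
  have s2 : Y.sig 2 = signal2 Sc ω R c (some (m, b)) (Y.got 1) := rfl
  have hs2 : Y.sig 2 = .silent := by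
    rw [s2]
    unfold signal2
    simp only
    split_ifs with h
    · rfl
    rcases hd : Sc.decodeWord n (R + 1) (Y.got 1) with _ | ⟨x', k'⟩
    · simp
    · cases x' <;> simp only
      split_ifs with hk
      · exfalso
        apply hX
        right; right; left
        exact ⟨by rw [s0]; trivial, by rw [s1]; exact id, _, by rw [← hk]; exact hd⟩
      · rfl
  refine ⟨ha, ?_, ?_⟩
  · rintro ⟨h, -⟩; rw [hs2] at h; exact h
  · by_cases h1 : IsSilence (Y.got 1)
    · exact .inl ⟨by rw [s0]; trivial, h1⟩
    · exact .inr (le_flips_of_not_isSilence hD s1 h1)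

/-- The exchange is followed word by word. Each word does its job or is spoiled at the price of a
constant fraction of flips; a spoiled word is answered so that Alice does not return, since noise
and words are never heard as silence. Only spoiling the last word leaves Bob with an accepted
message that Alice will repeat. -/
theorem exchange_answered (hD : Sc.Fits n D) (hb : bobOn) {m b : Bit}
    (hX : ¬ (exchange Sc adv ω R c (some (m, b)) bobOn carry).Failure ω c) :
    ¬ (exchange Sc adv ω R c (some (m, b)) bobOn carry).ReturnsEarly ∧
    ((exchange Sc adv ω R c (some (m, b)) bobOn carry).accepted = none ∨
      (exchange Sc adv ω R c (some (m, b)) bobOn carry).accepted = some (m, b)) ∧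
    ((exchange Sc adv ω R c (some (m, b)) bobOn carry).ReturnsFinally →
      (exchange Sc adv ω R c (some (m, b)) bobOn carry).accepted = some (m, b)) ∧
    ((exchange Sc adv ω R c (some (m, b)) bobOn carry).ReturnsFinally ∨
      Sc.wordLen n (R + 1) ≤ D * roundFlips Sc adv R c) := by
  set Y := exchange Sc adv ω R c (some (m, b)) bobOn carry with hY
  have s0 : Y.sig 0 = .word .keyReq (keyA Sc ω R c) := rfl
  have s1 : Y.sig 1 = signal1 Sc ω R c bobOn (Y.got 0) := rfl
  have s2 : Y.sig 2 = signal2 Sc ω R c (some (m, b)) (Y.got 1) := rfl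
  have ha : Y.accepted = acceptMsg Sc ω R c (Y.sig 1) (Y.got 2) := rfl
  have s3 : Y.sig 3 = signal3 Sc R (Y.sig 1) Y.accepted := rfl
  have hconv : ∀ j, Y.sig j ≠ .silent → ¬ IsSilence (Y.got j) :=
    fun j h1 h2 => hX (.inr (.inl ⟨j, h1, h2⟩))
  have hg0 : ¬ IsSilence (Y.got 0) := hconv 0 (by rw [s0]; simp)
  have hdec : ∀ j x k, Y.sig j = .word x k → Sc.decodeWord n (R + 1) (Y.got j) = some (x, k) ∨
      (Sc.decodeWord n (R + 1) (Y.got j) = none ∧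
        Sc.wordLen n (R + 1) ≤ D * roundFlips Sc adv R c) := fun j x k h => decode_word hD hX h
  rcases hdec _ _ _ s0 with d0 | ⟨d0, hf⟩
  swap
  -- The key request is unreadable: Bob's noise is neither heard as silence nor as a word with
  -- Alice's key.
  · have h1 : Y.sig 1 = .noise := by
      rw [s1, signal1, if_neg (by tauto), d0]
    have hg1 : ¬ IsSilence (Y.got 1) := hconv 1 (by rw [h1]; simp)
    have hacc : Y.accepted = none := by rw [ha, h1]; rfl
    have h2 : Y.sig 2 = .silent := by
      rw [s2, signal2]
      simp only [if_neg hg1]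
      rcases hd : Sc.decodeWord n (R + 1) (Y.got 1) with _ | ⟨x', k'⟩
      · simp
      · cases x' <;> simp only
        split_ifs with hk
        · exfalso
          apply hX
          right; right; left
          exact ⟨by rw [s0]; trivial, by rw [h1]; exact id, _, by rw [← hk]; exact hd⟩
        · rfl
    have hRF : ¬ Y.ReturnsFinally := by
      rintro ⟨h, -⟩; rw [h2] at h; exact h
    exact ⟨fun h => hg1 h.2, .inl hacc, fun h => absurd h hRF, .inr hf⟩
  have h1 : Y.sig 1 = .word (.key (keyB Sc ω R c)) (keyA Sc ω R c) := by
    rw [s1, signal1, if_neg (by tauto), d0]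
  have hg1 : ¬ IsSilence (Y.got 1) := hconv 1 (by rw [h1]; simp)
  refine ⟨fun h => hg1 h.2, ?_⟩
  rcases hdec _ _ _ h1 with d1 | ⟨d1, hf⟩
  swap
  -- Bob's key is unreadable: Alice stays silent in the third word, so acceptance would be a guess
  -- of Bob's key.
  · have h2 : Y.sig 2 = .silent := by
      rw [s2, signal2]
      simp only [if_neg hg1, d1]
    have hacc : Y.accepted = none := by
      rw [ha, h1, acceptMsg]
      rcases hd : Sc.decodeWord n (R + 1) (Y.got 2) with _ | ⟨x', k'⟩
      · simp
      · cases x' <;> simp only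
        split_ifs with hk
        · exfalso
          apply hX
          right; right; right
          exact ⟨by rw [h1]; trivial, h2, _, by rw [← hk]; exact hd⟩
        · rfl
    have hRF : ¬ Y.ReturnsFinally := by
      rintro ⟨h, -⟩; rw [h2] at h; exact h
    exact ⟨.inl hacc, fun h => absurd h hRF, .inr hf⟩
  have h2 : Y.sig 2 = .word (.msg m b) (keyB Sc ω R c) := by
    rw [s2, signal2]
    simp only [if_neg hg1, d1, if_true]
  rcases hdec _ _ _ h2 with d2 | ⟨d2, hf⟩
  swap
  -- The message is unreadable: Bob's noise in the fourth word prevents Alice from returning.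
  · have hacc : Y.accepted = none := by
      rw [ha, h1, acceptMsg]
      simp only [d2]
    have h3 : Y.sig 3 = .noise := by rw [s3, h1, hacc]; rfl
    have hg3 : ¬ IsSilence (Y.got 3) := hconv 3 (by rw [h3]; simp)
    exact ⟨.inl hacc, fun h => absurd h.2 hg3, .inr hf⟩
  have hacc : Y.accepted = some (m, b) := by
    rw [ha, h1, acceptMsg]
    simp only [d2, if_true]
  have h3 : Y.sig 3 = .silent := by rw [s3, h1, hacc]; rfl
  refine ⟨.inr hacc, fun _ => hacc, ?_⟩
  -- Bob has accepted. If Alice does not hear his silence she will retry, and the parity bit will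
  -- reveal the repetition.
  by_cases hg3 : IsSilence (Y.got 3)
  · exact .inl ⟨by rw [h2]; trivial, hg3⟩
  · exact .inr (le_flips_of_not_isSilence hD h3 hg3)

end Exchange

/-! ### Fair coins -/

section Coins

variable {n : ℕ}

theorem map_add_uniformBit (b : Bit) :
    ((PMF.uniformOfFintype Bit).toMeasure).map (· + b) = (PMF.uniformOfFintype Bit).toMeasure := by
  classical
  ext s hs
  rw [Measure.map_apply (measurable_of_countable _) hs,
    PMF.toMeasure_uniformOfFintype_apply _ hs,
    PMF.toMeasure_uniformOfFintype_apply _ (measurable_of_countable _ hs)]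
  congr 2
  exact Fintype.card_congr ((Equiv.addRight b).subtypeEquiv fun a => Iff.rfl)

/-- Translation invariance replaces conditioning: probabilities may be averaged over translations of
chosen coins. -/
theorem coinMeasure_map_add (d : Coins n) :
    (coinMeasure n).map (fun ω => ω + d) = coinMeasure n := by
  have := Measure.infinitePi_map_pi
    (μ := fun _ : ℕ × Channel n × Purpose × ℕ => (PMF.uniformOfFintype Bit).toMeasure)
    (f := fun i b => b + d i) fun i => measurable_of_countable _
  simp only [map_add_uniformBit] at this
  exact this

theorem measurable_add_coins (d : Coins n) : Measurable fun ω : Coins n => ω + d :=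
  measurable_pi_lambda _ fun i =>
    (measurable_of_countable (fun b : Bit => b + d i)).comp (measurable_pi_apply i)

/-- Sets that depend on finitely many coins are measurable. -/
theorem measurableSet_of_finite_dependence (A : Set (Coins n))
    (J : Set (ℕ × Channel n × Purpose × ℕ)) (hJ : J.Finite)
    (h : ∀ ω ω' : Coins n, (∀ i ∈ J, ω i = ω' i) → ω ∈ A → ω' ∈ A) : MeasurableSet A := by
  lift J to Finset (ℕ × Channel n × Purpose × ℕ) using hJ
  have hA : A = J.restrict ⁻¹' (J.restrict '' A) := by
    refine subset_antisymm (Set.subset_preimage_image _ _) ?_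
    rintro ω ⟨ω', hω', he⟩
    exact h ω' ω (fun i hi => congrFun he ⟨i, hi⟩) hω'
  rw [hA]
  exact (Finset.measurable_restrict J) (Set.toFinite _).measurableSet

/-- Adding all strings `z` to the chosen coins and overwriting these coins by all strings `z` reach
the same points. -/
theorem card_extend_eq {N : ℕ} (e : Fin N → ℕ × Channel n × Purpose × ℕ)
    (he : Function.Injective e) (A : Set (Coins n)) (ω : Coins n) :
    Nat.card {z : Fin N → Bit // ω + Function.extend e z 0 ∈ A} =
      Nat.card {z : Fin N → Bit // Function.extend e z ω ∈ A} := by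
  refine Nat.card_congr ((Equiv.addLeft (ω ∘ e)).subtypeEquiv fun z => ?_)
  have : ω + Function.extend e z 0 = Function.extend e ((Equiv.addLeft (ω ∘ e)) z) ω := by
    ext i
    by_cases hi : ∃ a, e a = i
    · obtain ⟨a, rfl⟩ := hi
      simp [he.extend_apply]
    · simp [Function.extend_apply' _ _ _ hi]
  rw [this]

/-- A set of coin sequences has measure at most `ε` if, whatever the other coins are, at most a
fraction of `ε` of the values of the coins `e 0, …, e (N - 1)` leads to it. -/
theorem measure_le_of_card {N : ℕ} (e : Fin N → ℕ × Channel n × Purpose × ℕ)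
    (he : Function.Injective e) (A : Set (Coins n)) (hA : MeasurableSet A) (ε : ℝ)
    (h : ∀ ω, (Nat.card {z : Fin N → Bit // Function.extend e z ω ∈ A} : ℝ) ≤ ε * 2 ^ N) :
    coinMeasure n A ≤ ENNReal.ofReal ε := by
  classical
  have hprob : IsProbabilityMeasure (coinMeasure n) := by
    unfold coinMeasure; infer_instance
  -- The measure of `A` is unchanged when the chosen coins are translated by `z`. Summing over all
  -- `z` inside the integral leaves, for each `ω`, the number of strings that lead into `A`.
  have hshift : ∀ z : Fin N → Bit, coinMeasure n A =
      ∫⁻ ω, A.indicator 1 (ω + Function.extend e z 0) ∂(coinMeasure n) := by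
    intro z
    have hm := measurable_add_coins (Function.extend e z (0 : Coins n))
    calc coinMeasure n A = (coinMeasure n).map (fun ω => ω + Function.extend e z 0) A := by
          rw [coinMeasure_map_add]
      _ = coinMeasure n ((fun ω => ω + Function.extend e z 0) ⁻¹' A) := Measure.map_apply hm hA
      _ = _ := by
          rw [← lintegral_indicator_one (hm hA)]
          rfl
  have hsum : (2 ^ N : ENNReal) * coinMeasure n A ≤ 2 ^ N * ENNReal.ofReal ε := by
    calc (2 ^ N : ENNReal) * coinMeasure n A = ∑ _z : Fin N → Bit, coinMeasure n A := by
          simp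
      _ = ∑ z : Fin N → Bit,
            ∫⁻ ω, A.indicator 1 (ω + Function.extend e z 0) ∂(coinMeasure n) :=
          Finset.sum_congr rfl fun z _ => hshift z
      _ = ∫⁻ ω, ∑ z : Fin N → Bit, A.indicator 1 (ω + Function.extend e z 0)
            ∂(coinMeasure n) := by
          rw [lintegral_finsetSum]
          intro z _
          exact (measurable_one.indicator hA).comp (measurable_add_coins _)
      _ ≤ ∫⁻ _, 2 ^ N * ENNReal.ofReal ε ∂(coinMeasure n) := by
          refine lintegral_mono fun ω => ?_
          have h1 : ∑ z : Fin N → Bit, A.indicator (1 : Coins n → ENNReal)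
              (ω + Function.extend e z 0) =
              Nat.card {z : Fin N → Bit // ω + Function.extend e z 0 ∈ A} := by
            simp only [Set.indicator_apply, Pi.one_apply]
            rw [Finset.sum_boole, Nat.card_eq_fintype_card, Fintype.card_subtype]
          rw [h1, card_extend_eq e he]
          have h2 := h ω
          rw [← ENNReal.ofReal_natCast, show (2 : ENNReal) ^ N = ENNReal.ofReal (2 ^ N) by
            rw [ENNReal.ofReal_pow (by norm_num)]; simp, ← ENNReal.ofReal_mul (by positivity),
            mul_comm]
          exact ENNReal.ofReal_le_ofReal h2
      _ = _ := by simp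
  exact (ENNReal.mul_le_mul_iff_right (by simp) (by simp)).1 hsum

end Coins

/-! ### Random strings are rarely silence -/

/-- Number of bit alternations of a nonempty string. -/
def altCount {N : ℕ} (z : Fin (N + 1) → Bit) : ℕ :=
  (Finset.univ.filter fun i : Fin N => z i.succ ≠ z i.castSucc).card

/-- Prepending a bit creates an alternation for exactly one of its two values, so every further
position contributes a factor `1 + a`. -/
theorem sum_pow_altCount (N : ℕ) (a : ℝ) :
    ∑ z : Fin (N + 1) → Bit, a ^ altCount z = 2 * (1 + a) ^ N := by
  have h : ∀ (N : ℕ) (z : Fin (N + 1) → Bit),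
      a ^ altCount z = ∏ i : Fin N, (if z i.succ ≠ z i.castSucc then a else 1) := by
    intro N z
    rw [altCount, Finset.prod_ite, Finset.prod_const, Finset.prod_const_one, mul_one]
  induction N with
  | zero =>
    simp [h]
  | succ N ih =>
    rw [← (Fin.consEquiv fun _ => Bit).sum_comp, Fintype.sum_prod_type_right]
    have hcons : ∀ (z : Fin (N + 1) → Bit) (b : Bit),
        a ^ altCount ((Fin.consEquiv fun _ : Fin (N + 2) => Bit) (b, z)) =
          a ^ altCount z * (if z 0 ≠ b then a else 1) := by
      intro z b
      rw [h, h, Fin.prod_univ_succ, mul_comm]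
      congr 1
    simp_rw [hcons, ← Finset.mul_sum]
    have h2 : ∀ x : Bit, ∑ b : Bit, (if x ≠ b then a else 1) = 1 + a := by
      intro x
      rw [show (Finset.univ : Finset Bit) = {x, x + 1} from by revert x; decide]
      rw [Finset.sum_insert (by revert x; decide), Finset.sum_singleton]
      simp
    simp_rw [h2]
    rw [← Finset.sum_mul, ih, pow_succ]
    ring

/-- Chernoff bound with weight `1/2` per alternation. -/
theorem card_altCount_lt (N M : ℕ) :
    (Nat.card {z : Fin (N + 1) → Bit // altCount z < M} : ℝ) ≤
      (3 / 4) ^ N * 2 ^ M * 2 ^ (N + 1) := by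
  classical
  set B := Finset.univ.filter fun z : Fin (N + 1) → Bit => altCount z < M
  have hB : Nat.card {z : Fin (N + 1) → Bit // altCount z < M} = B.card := by
    rw [Nat.card_eq_fintype_card, Fintype.card_subtype]
  have h1 : (B.card : ℝ) * (1 / 2) ^ M ≤ 2 * (3 / 2) ^ N := by
    have := sum_pow_altCount N (1 / 2)
    rw [show (1 : ℝ) + 1 / 2 = 3 / 2 by norm_num] at this
    rw [← this, ← nsmul_eq_mul]
    calc _ ≤ ∑ z ∈ B, (1 / 2 : ℝ) ^ altCount z := by
          apply Finset.card_nsmul_le_sum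
          intro e he
          exact pow_le_pow_of_le_one (by norm_num) (by norm_num) (Finset.mem_filter.1 he).2.le
      _ ≤ _ := Finset.sum_le_univ_sum_of_nonneg fun _ => by positivity
  rw [hB]
  calc (B.card : ℝ) = B.card * (1 / 2) ^ M * 2 ^ M := by
        rw [mul_assoc, ← mul_pow]; norm_num
    _ ≤ 2 * (3 / 2) ^ N * 2 ^ M := by gcongr
    _ = _ := by
        rw [show (3 / 2 : ℝ) = 3 / 4 * 2 by norm_num, mul_pow]; ring

theorem altCount_le_alternations {w a N : ℕ} (hw : w = a + (N + 1)) (y : Fin w → Bit) :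
    altCount (fun i : Fin (N + 1) => y ⟨a + i, by omega⟩) ≤ alternations y := by
  classical
  subst hw
  unfold altCount alternations
  rw [← Fintype.card_coe, ← Nat.card_eq_fintype_card]
  refine Nat.card_le_card_of_injective (fun i => ⟨⟨a + i.1, by omega⟩, ?_⟩) ?_
  · obtain ⟨i, hi⟩ := i
    simp only [Finset.mem_filter] at hi
    exact ⟨by simp only; omega, hi.2⟩
  · rintro ⟨i, hi⟩ ⟨j, hj⟩ h
    simp only [Subtype.mk.injEq, Fin.mk.injEq] at h
    exact Subtype.ext (Fin.ext (Nat.add_left_cancel h))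

/-- A string that consists of fair coins, shifted by fixed bits, from position `a` on, is rarely
silence. -/
theorem measure_isSilence_le {n w a N M : ℕ} (hw : w = a + (N + 1)) (hM : w ≤ 3 * M)
    (e : ℕ → ℕ × Channel n × Purpose × ℕ) (he : Function.Injective e) (f : ℕ → Bit) :
    coinMeasure n {ω | ∃ y : Fin w → Bit, (∀ i : Fin w, a ≤ i → y i = ω (e i) + f i) ∧
      IsSilence y} ≤ ENNReal.ofReal ((3 / 4) ^ N * 2 ^ M) := by
  set A : Set (Coins n) :=
    {ω | altCount (fun i : Fin (N + 1) => ω (e (a + i)) + f (a + i)) < M} with hA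
  refine (measure_mono (t := A) ?_).trans ?_
  · rintro ω ⟨y, hy, hs⟩
    have h1 := altCount_le_alternations hw y
    have h2 : (fun i : Fin (N + 1) => y ⟨a + i, by omega⟩) =
        fun i : Fin (N + 1) => ω (e (a + i)) + f (a + i) := by
      ext i
      exact hy ⟨a + i, by omega⟩ (by simp)
    rw [h2] at h1
    unfold IsSilence at hs
    simp only [hA, Set.mem_ofPred_eq]
    omega
  have hinj : Function.Injective fun i : Fin (N + 1) => e (a + i) := by
    intro i j h
    have := he h
    exact Fin.ext (by omega)
  refine measure_le_of_card (fun i : Fin (N + 1) => e (a + i)) hinj A ?_ _ fun ω => ?_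
  · refine measurableSet_of_finite_dependence A (Set.range fun i : Fin (N + 1) => e (a + i))
      (Set.finite_range _) fun ω ω' h hω => ?_
    have : ∀ i : Fin (N + 1), ω (e (a + i)) = ω' (e (a + i)) := fun i => h _ ⟨i, rfl⟩
    simp only [hA, Set.mem_ofPred_eq, this] at hω ⊢
    exact hω
  · refine le_trans (le_of_eq ?_) (card_altCount_lt N M)
    congr 1
    -- Adding the fixed bits `f` is a bijection of strings, so flips do not affect the count.
    refine Nat.card_congr
      ((Equiv.addRight (fun i : Fin (N + 1) => f (a + i))).subtypeEquiv fun z => ?_)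
    simp only [hA, Set.mem_ofPred_eq]
    have : ∀ i : Fin (N + 1),
        Function.extend (fun i : Fin (N + 1) => e (a + i)) z ω (e (a + i)) = z i :=
      fun i => hinj.extend_apply z ω i
    simp only [this]
    rfl

/-! ### Dependence on the coins -/

section Dependence

variable {Sc : Scheme} {n : ℕ} {adv : Adversary n} {ω ω' : Coins n} {R : ℕ} {c : Channel n}
  {alice : Option (Bit × Bit)} {bobOn : Prop} {carry : Option Bit}

theorem signal0_congr (hA : keyA Sc ω R c = keyA Sc ω' R c) :
    signal0 Sc ω R c = signal0 Sc ω' R c := by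
  funext a; unfold signal0; rw [hA]

theorem signal1_congr (hB : keyB Sc ω R c = keyB Sc ω' R c) :
    signal1 Sc ω R c = signal1 Sc ω' R c := by
  funext a; unfold signal1; rw [hB]

theorem signal2_congr (hA : keyA Sc ω R c = keyA Sc ω' R c) :
    signal2 Sc ω R c = signal2 Sc ω' R c := by
  funext a; unfold signal2; rw [hA]

theorem acceptMsg_congr (hB : keyB Sc ω R c = keyB Sc ω' R c) :
    acceptMsg Sc ω R c = acceptMsg Sc ω' R c := by
  funext a; unfold acceptMsg; rw [hB]

theorem exchange_congr (hA : keyA Sc ω R c = keyA Sc ω' R c)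
    (hB : keyB Sc ω R c = keyB Sc ω' R c)
    (ht : ∀ j, transmit Sc ω R c j = transmit Sc ω' R c j) :
    exchange Sc adv ω R c alice bobOn carry = exchange Sc adv ω' R c alice bobOn carry := by
  unfold exchange
  rw [signal0_congr hA, signal1_congr hB, signal2_congr hA, acceptMsg_congr hB,
    ht 0, ht 1, ht 2, ht 3]

/-- What is done in word `j` does not depend on the coins used for transmitting it. -/
theorem exchange_sig_congr (j : Fin 4) (hA : keyA Sc ω R c = keyA Sc ω' R c)
    (hB : keyB Sc ω R c = keyB Sc ω' R c)
    (ht : ∀ i, i ≠ j → transmit Sc ω R c i = transmit Sc ω' R c i) :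
    (exchange Sc adv ω R c alice bobOn carry).sig j =
      (exchange Sc adv ω' R c alice bobOn carry).sig j := by
  have e0 := signal0_congr hA
  have e1 := signal1_congr hB
  have e2 := signal2_congr hA
  have e3 := acceptMsg_congr hB
  fin_cases j
  · change signal0 Sc ω R c alice = signal0 Sc ω' R c alice
    rw [e0]
  · have t0 := ht 0 (by decide)
    change signal1 Sc ω R c bobOn (received adv c carry (wordStart Sc n R 0)
        (transmit Sc ω R c 0 (signal0 Sc ω R c alice))) = signal1 Sc ω' R c bobOn
      (received adv c carry (wordStart Sc n R 0)
        (transmit Sc ω' R c 0 (signal0 Sc ω' R c alice)))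
    rw [e0, e1, t0]
  · have t0 := ht 0 (by decide)
    have t1 := ht 1 (by decide)
    simp only [exchange, e0, e1, e2, t0, t1]
    rfl
  · have t0 := ht 0 (by decide)
    have t1 := ht 1 (by decide)
    have t2 := ht 2 (by decide)
    simp only [exchange, e0, e1, e2, e3, t0, t1, t2]

/-- Only coins with smaller positions are used in round `r`. -/
def coinBound (Sc : Scheme) (n r : ℕ) : ℕ :=
  Sc.keyLen n r + Sc.amd.rlen (Sc.strength n r) (Sc.contentLen n r) + Sc.wordLen n r

theorem keyA_congr (h : ∀ i < coinBound Sc n (R + 1), ω (R + 1, c, .keyA, i) =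
    ω' (R + 1, c, .keyA, i)) : keyA Sc ω R c = keyA Sc ω' R c := by
  funext i
  exact h i (by have := i.2; unfold coinBound; omega)

theorem keyB_congr (h : ∀ i < coinBound Sc n (R + 1), ω (R + 1, c, .keyB, i) =
    ω' (R + 1, c, .keyB, i)) : keyB Sc ω R c = keyB Sc ω' R c := by
  funext i
  exact h i (by have := i.2; unfold coinBound; omega)

theorem transmit_congr (j : Fin 4)
    (h : ∀ p, (p = .amd j ∨ p = .pad j ∨ p = .noise j) → ∀ i < coinBound Sc n (R + 1),
      ω (R + 1, c, p, i) = ω' (R + 1, c, p, i)) :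
    transmit Sc ω R c j = transmit Sc ω' R c j := by
  have h1 : ∀ i : Fin (Sc.amd.rlen (Sc.strength n (R + 1)) (Sc.contentLen n (R + 1))),
      ω (R + 1, c, .amd j, i) = ω' (R + 1, c, .amd j, i) :=
    fun i => h _ (.inl rfl) i (by have := i.2; unfold coinBound; omega)
  have h2 : ∀ i : Fin (Sc.wordLen n (R + 1)),
      ω (R + 1, c, .pad j, i) = ω' (R + 1, c, .pad j, i) :=
    fun i => h _ (.inr (.inl rfl)) i (by have := i.2; unfold coinBound; omega)
  have h3 : ∀ i : Fin (Sc.wordLen n (R + 1)),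
      ω (R + 1, c, .noise j, i) = ω' (R + 1, c, .noise j, i) :=
    fun i => h _ (.inr (.inr rfl)) i (by have := i.2; unfold coinBound; omega)
  funext s
  cases s
  · rfl
  · simp only [transmit, h3]
  · simp only [transmit]
    congr 1
    funext i
    simp only [Scheme.encodeWord, Scheme.amdEncode, h1, h2]

variable {G : SimpleGraph (Fin n)} {S : Fin n → Type*} {P : Protocol G S} (Rv : P.Resolver)

theorem exch_congr (g : Global P) (h : ∀ c p, ∀ i < coinBound Sc n (R + 1),
    ω (R + 1, c, p, i) = ω' (R + 1, c, p, i)) (u v : Fin n) :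
    g.exch Sc adv ω R u v = g.exch Sc adv ω' R u v :=
  exchange_congr (keyA_congr (h _ _)) (keyB_congr (h _ _))
    fun j => transmit_congr j fun p _ => h _ p

theorem round_congr (g : Global P) (h : ∀ c p, ∀ i < coinBound Sc n (R + 1),
    ω (R + 1, c, p, i) = ω' (R + 1, c, p, i)) :
    g.round Sc adv ω Rv R = g.round Sc adv ω' Rv R := by
  have h1 : g.exch Sc adv ω R = g.exch Sc adv ω' R :=
    funext fun u => funext (exch_congr (adv := adv) g h u)
  have h2 : ∀ u v, g.recorded Sc adv ω R u v = g.recorded Sc adv ω' R u v := by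
    intro u v; unfold Global.recorded; rw [h1]
  have h3 : ∀ v, g.received Sc adv ω R v = g.received Sc adv ω' R v := by
    intro v; unfold Global.received; simp only [h2]
  have h4 : ∀ v, g.react Sc adv ω Rv R v = g.react Sc adv ω' Rv R v := by
    intro v; unfold Global.react; rw [h3]
  unfold Global.round
  rw [h1, funext h3, funext h4]

theorem execution_congr (h : ∀ r ≤ R, ∀ c p, ∀ i < coinBound Sc n r,
    ω (r, c, p, i) = ω' (r, c, p, i)) :
    execution Sc adv ω Rv R = execution Sc adv ω' Rv R := by
  induction R with
  | zero => rfl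
  | succ R ih =>
    rw [execution, execution, ih fun r hr => h r (by omega)]
    exact round_congr Rv _ (h (R + 1) le_rfl)

/-- The coins used in the first `R` rounds. -/
def usedCoins (Sc : Scheme) (n R : ℕ) : Set (ℕ × Channel n × Purpose × ℕ) :=
  {x | x.1 ≤ R ∧ x.2.2.2 < coinBound Sc n x.1}

instance : Finite Purpose := by
  refine Finite.of_injective (β := Fin 5 × Fin 4) (fun p => match p with
    | .keyA => (0, 0)
    | .keyB => (1, 0)
    | .amd j => (2, j)
    | .pad j => (3, j)
    | .noise j => (4, j)) ?_
  intro p q h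
  cases p <;> cases q <;> simp_all

theorem usedCoins_finite (Sc : Scheme) (n R : ℕ) : (usedCoins Sc n R).Finite := by
  have hfin : (⋃ r ∈ Set.Iic R, ({r} ×ˢ (Set.univ ×ˢ (Set.univ ×ˢ Set.Iio (coinBound Sc n r))) :
      Set (ℕ × Channel n × Purpose × ℕ))).Finite := by
    refine (Set.finite_Iic R).biUnion fun r _ => ?_
    exact (Set.finite_singleton r).prod
      (Set.finite_univ.prod (Set.finite_univ.prod (Set.finite_Iio _)))
  refine hfin.subset ?_
  rintro ⟨r, c, p, i⟩ ⟨h1, h2⟩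
  simp only [Set.mem_iUnion]
  exact ⟨r, h1, rfl, trivial, trivial, h2⟩

theorem currentExch_congr (h : ∀ x ∈ usedCoins Sc n (R + 1), ω x = ω' x) (u v : Fin n) :
    (execution Sc adv ω Rv R).exch Sc adv ω R u v =
      (execution Sc adv ω' Rv R).exch Sc adv ω' R u v := by
  rw [execution_congr (ω' := ω') Rv fun r hr c p i hi => h (r, c, p, i) ⟨by simp; omega, hi⟩]
  exact exch_congr _ (fun c p i hi => h (R + 1, c, p, i) ⟨le_rfl, hi⟩) u v

/-- What is sent in a word is decided before the coins of its AMD encoding are used, so these coins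
may be redrawn with the content of the word kept. -/
theorem currentExch_sig_congr (j : Fin 4) (u v : Fin n)
    (h : ∀ x, (∀ i, x ≠ (R + 1, (u, v), .amd j, i)) → ω x = ω' x) :
    ((execution Sc adv ω Rv R).exch Sc adv ω R u v).sig j =
      ((execution Sc adv ω' Rv R).exch Sc adv ω' R u v).sig j := by
  rw [execution_congr (ω' := ω') Rv fun r hr c p i hi => h (r, c, p, i) (by
    intro i' h'; simp only [Prod.mk.injEq] at h'; omega)]
  refine exchange_sig_congr j ?_ ?_ fun i hi => ?_
  · exact keyA_congr fun i _ => h _ (by simp)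
  · exact keyB_congr fun i _ => h _ (by simp)
  · refine transmit_congr i fun p hp i' _ => h _ ?_
    rintro i'' h'
    simp only [Prod.mk.injEq] at h'
    rcases hp with rfl | rfl | rfl
    · exact hi (Purpose.amd.inj h'.2.2.1)
    · cases h'.2.2.1
    · cases h'.2.2.1

end Dependence

/-! ### Failure probability -/

section Failure

variable {Sc : Scheme} {n D : ℕ} {adv : Adversary n} {R : ℕ}
  {G : SimpleGraph (Fin n)} {S : Fin n → Type*} {P : Protocol G S} {Rv : P.Resolver}

/-- The exchange of round `R + 1` on channel `(u, v)` in the execution of `π'`. -/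
def currentExch (Sc : Scheme) (adv : Adversary n) (Rv : P.Resolver) (R : ℕ) (u v : Fin n)
    (ω : Coins n) : Exchange Sc n R :=
  (execution Sc adv ω Rv R).exch Sc adv ω R u v

theorem purpose_injective (r : ℕ) (c : Channel n) (p : Purpose) :
    Function.Injective fun i : ℕ => ((r, c, p, i) : ℕ × Channel n × Purpose × ℕ) := by
  intro i j h
  simpa using h

theorem purpose_fin_injective (r : ℕ) (c : Channel n) (p : Purpose) (N : ℕ) :
    Function.Injective
      fun i : Fin N => ((r, c, p, (i : ℕ)) : ℕ × Channel n × Purpose × ℕ) := by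
  intro i j h
  exact Fin.ext (by simpa using h)

/-- With all other coins fixed, the content of the word is fixed while the encoding randomness stays
uniform, so the detection property of the AMD code applies to the fixed offset `s`. -/
theorem measure_amd_le (hD : Sc.Fits n D) (u v : Fin n) (j : Fin 4)
    (s : Fin (Sc.amdLen n (R + 1)) → Bit) :
    coinMeasure n {ω | ∃ x k, (currentExch Sc adv Rv R u v ω).sig j = .word x k ∧ s ≠ 0 ∧
      Sc.IsAMDWord n (R + 1)
        (Sc.amdEncode n (R + 1) x k (fun i => ω (R + 1, (u, v), .amd j, i)) + s)} ≤
      ENNReal.ofReal (Sc.strength n (R + 1)) := by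
  set A : Set (Coins n) := {ω | ∃ x k, (currentExch Sc adv Rv R u v ω).sig j = .word x k ∧ s ≠ 0 ∧
      Sc.IsAMDWord n (R + 1)
        (Sc.amdEncode n (R + 1) x k (fun i => ω (R + 1, (u, v), .amd j, i)) + s)} with hA
  set N := Sc.amd.rlen (Sc.strength n (R + 1)) (Sc.contentLen n (R + 1)) with hN
  have hinj := purpose_fin_injective (R + 1) (u, v) (.amd j) N
  refine measure_le_of_card _ hinj A ?_ _ fun ω => ?_
  · refine measurableSet_of_finite_dependence A _ (usedCoins_finite Sc n (R + 1))
      fun ω ω' h hω => ?_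
    obtain ⟨x, k, h1, h2, h3⟩ := hω
    refine ⟨x, k, ?_, h2, ?_⟩
    · rw [← h1]
      exact congrArg (fun E => Exchange.sig E j) (currentExch_congr Rv h u v).symm
    · convert h3 using 2
      unfold Scheme.amdEncode
      congr 1
      funext i
      refine (h _ ⟨le_rfl, ?_⟩).symm
      have := i.2
      simp only [coinBound]
      omega
  · have hsig : ∀ z : Fin N → Bit, (currentExch Sc adv Rv R u v
        (Function.extend (fun i : Fin N => (R + 1, (u, v), Purpose.amd j, (i : ℕ))) z ω)).sig j =
        (currentExch Sc adv Rv R u v ω).sig j := by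
      intro z
      refine currentExch_sig_congr Rv j u v fun x hx => ?_
      refine Function.extend_apply' _ _ _ ?_
      rintro ⟨a, ha⟩
      exact hx a ha.symm
    by_cases hc : (∃ x k, (currentExch Sc adv Rv R u v ω).sig j = .word x k) ∧ s ≠ 0
    · obtain ⟨⟨x, k, hxk⟩, hs⟩ := hc
      refine le_trans ?_ (Sc.amd.detect _ _ (contentBits (x, k)) s
        (hD.strength_pos (R + 1) (by omega)) (hD.strength_le (R + 1) (by omega)) hs)
      rw [Nat.cast_le]
      refine Nat.card_mono (Set.toFinite _) ?_
      rintro z ⟨x', k', h1, -, ρ', m', h2⟩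
      rw [hsig z, hxk] at h1
      injection h1 with hx hk
      subst hx hk
      refine ⟨ρ', m', h2.trans ?_⟩
      unfold Scheme.amdEncode
      congr 2
      funext i
      exact hinj.extend_apply z ω i
    · have : IsEmpty {z : Fin N → Bit //
          Function.extend (fun i : Fin N => (R + 1, (u, v), Purpose.amd j, (i : ℕ))) z ω ∈ A} := by
        refine ⟨?_⟩
        rintro ⟨z, x, k, h1, h2, -⟩
        rw [hsig z] at h1
        exact hc ⟨⟨x, k, h1⟩, h2⟩
      rw [Nat.card_of_isEmpty]
      have := hD.strength_pos (R + 1) (by omega)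
      push_cast
      positivity

/-- The key made of the coins for purpose `p`. -/
def keyCoins (Sc : Scheme) (R : ℕ) (c : Channel n) (p : Purpose) (ω : Coins n) :
    Sc.Key n (R + 1) :=
  fun i => ω (R + 1, c, p, i)

/-- The word `Y` ignores the coins of the key. Once the other coins are fixed it decodes to at most
one key, which only one value of those coins can match. -/
theorem measure_key_le (c : Channel n) (p : Purpose) (Y : Coins n → Sc.Word n (R + 1))
    (J : Set (ℕ × Channel n × Purpose × ℕ)) (hJ : J.Finite)
    (hY : ∀ ω ω' : Coins n, (∀ x ∈ J, ω x = ω' x) → Y ω = Y ω')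
    (hp : ∀ i, (R + 1, c, p, i) ∉ J) :
    coinMeasure n {ω | ∃ x, Sc.decodeWord n (R + 1) (Y ω) =
      some (x, keyCoins Sc R c p ω)} ≤
      ENNReal.ofReal (1 / 2 ^ Sc.keyLen n (R + 1)) := by
  set A : Set (Coins n) := {ω | ∃ x, Sc.decodeWord n (R + 1) (Y ω) =
      some (x, keyCoins Sc R c p ω)} with hA
  set N := Sc.keyLen n (R + 1) with hN
  have hinj := purpose_fin_injective (R + 1) c p N
  refine measure_le_of_card _ hinj A ?_ _ fun ω => ?_
  · refine measurableSet_of_finite_dependence A (J ∪ Set.range fun i : Fin N => (R + 1, c, p, (i : ℕ)))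
      (hJ.union (Set.finite_range _)) fun ω ω' h hω => ?_
    obtain ⟨x, hx⟩ := hω
    refine ⟨x, ?_⟩
    rw [← hY ω ω' fun x hx => h x (.inl hx), hx]
    congr 2
    funext i
    exact h _ (.inr ⟨i, rfl⟩)
  · have hsub : Subsingleton {z : Fin N → Bit //
        Function.extend (fun i : Fin N => (R + 1, c, p, (i : ℕ))) z ω ∈ A} := by
      have key : ∀ z : Fin N → Bit,
          Function.extend (fun i : Fin N => (R + 1, c, p, (i : ℕ))) z ω ∈ A →
          ∃ x, Sc.decodeWord n (R + 1) (Y ω) = some (x, z) := by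
        rintro z ⟨x, hx⟩
        refine ⟨x, ?_⟩
        rw [← hY (Function.extend (fun i : Fin N => (R + 1, c, p, (i : ℕ))) z ω) ω, hx]
        · congr 2
          funext i
          exact hinj.extend_apply z ω i
        · intro y hy
          refine Function.extend_apply' _ _ _ ?_
          rintro ⟨a, rfl⟩
          exact hp a hy
      refine ⟨?_⟩
      rintro ⟨z, hz⟩ ⟨z', hz'⟩
      obtain ⟨x, hx⟩ := key z hz
      obtain ⟨x', hx'⟩ := key z' hz'
      rw [hx] at hx'
      simp only [Option.some.injEq, Prod.mk.injEq] at hx'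
      exact Subtype.ext hx'.2
    have h1 := Finite.card_le_one_iff_subsingleton.2 hsub
    have h2 : (1 / 2 ^ N * 2 ^ N : ℝ) = 1 := by field_simp
    rw [h2]
    exact_mod_cast h1

/-- What is received in the second word after a key request when Bob sends noise. -/
def noisyWord (Sc : Scheme) (adv : Adversary n) (R : ℕ) (c : Channel n) (j : Fin 4)
    (ω : Coins n) : Sc.Word n (R + 1) :=
  fun i => ω (R + 1, c, .noise j, i) + adv.flip c (wordStart Sc n R j + i)

/-- What is received in a silent word that follows a word that is not silent. -/
def silentWord (Sc : Scheme) (adv : Adversary n) (R : ℕ) (c : Channel n) (j : Fin 4) :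
    Sc.Word n (R + 1) :=
  received adv c none (wordStart Sc n R j) none

theorem nextCarry_transmit {ω : Coins n} {c : Channel n} {j : Fin 4} {carry : Option Bit} {t : ℕ}
    {s : Signal (Sc.keyLen n (R + 1))} (hs : s ≠ .silent) :
    nextCarry adv c carry t (transmit Sc ω R c j s) = none := by
  cases s
  · exact absurd rfl hs
  · rfl
  · rfl

/-- The failure event of a round and channel is contained in a union of simple events. -/
theorem failure_subset (hD : Sc.Fits n D) (u v : Fin n) {ω : Coins n}
    (h : (currentExch Sc adv Rv R u v ω).Failure ω (u, v)) :
    (∃ j x k, (currentExch Sc adv Rv R u v ω).sig j = .word x k ∧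
      Sc.ecc.dec (Sc.amdLen n (R + 1))
        (fun i => adv.flip (u, v) (wordStart Sc n R j + i)) ≠ 0 ∧
      Sc.IsAMDWord n (R + 1)
        (Sc.amdEncode n (R + 1) x k (fun i => ω (R + 1, (u, v), .amd j, i)) +
          Sc.ecc.dec (Sc.amdLen n (R + 1))
            (fun i => adv.flip (u, v) (wordStart Sc n R j + i)))) ∨
    (∃ j, ∃ y : Sc.Word n (R + 1), (∀ i : Fin (Sc.wordLen n (R + 1)),
        Sc.codeLen n (R + 1) ≤ i → y i = ω (R + 1, (u, v), .pad j, i) +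
          adv.flip (u, v) (wordStart Sc n R j + i)) ∧ IsSilence y) ∨
    (∃ j, ∃ y : Sc.Word n (R + 1), (∀ i : Fin (Sc.wordLen n (R + 1)),
        Sc.codeLen n (R + 1) ≤ i → y i = ω (R + 1, (u, v), .noise j, i) +
          adv.flip (u, v) (wordStart Sc n R j + i)) ∧ IsSilence y) ∨
    (∃ x, Sc.decodeWord n (R + 1) (silentWord Sc adv R (u, v) 1) =
      some (x, keyCoins Sc R (u, v) .keyA ω)) ∨
    (∃ x, Sc.decodeWord n (R + 1) (noisyWord Sc adv R (u, v) 1 ω) =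
      some (x, keyCoins Sc R (u, v) .keyA ω)) ∨
    (∃ x, Sc.decodeWord n (R + 1) (silentWord Sc adv R (u, v) 2) =
      some (x, keyCoins Sc R (u, v) .keyB ω)) := by
  set X := currentExch Sc adv Rv R u v ω with hX
  have hgot : ∀ j, ∃ cy, X.got j = received adv (u, v) cy (wordStart Sc n R j)
      (transmit Sc ω R (u, v) j (X.sig j)) := fun j => exchange_got j
  rcases h with ⟨j, x, k, hs, hA, hne⟩ | ⟨j, hs, hsil⟩ | ⟨h0, h1, x, hx⟩ | ⟨h1, h2, x, hx⟩
  · left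
    obtain ⟨cy, hcy⟩ := hgot j
    have hd : Sc.eccDecode n (R + 1) (X.got j) =
        Sc.amdEncode n (R + 1) x k (fun i => ω (R + 1, (u, v), .amd j, i)) +
          Sc.ecc.dec (Sc.amdLen n (R + 1))
            (fun i => adv.flip (u, v) (wordStart Sc n R j + i)) := by
      rw [hcy, hs]
      exact eccDecode_encodeWord_add (hD.codeLen_le (R + 1) (by omega)) x k _ _
        (fun i => adv.flip (u, v) (wordStart Sc n R j + i))
    rw [hd] at hA hne
    exact ⟨j, x, k, hs, fun h0 => hne (by rw [h0, add_zero]), hA⟩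
  -- For conversion to silence only positions beyond the codeword are used: there both padding and
  -- noise are fair coins shifted by flips.
  · obtain ⟨cy, hcy⟩ := hgot j
    rcases hsig : X.sig j with _ | _ | ⟨x, k⟩
    · exact absurd hsig hs
    · right; right; left
      refine ⟨j, X.got j, fun i _ => ?_, hsil⟩
      rw [hcy, hsig]
      rfl
    · right; left
      refine ⟨j, X.got j, fun i hi => ?_, hsil⟩
      rw [hcy, hsig]
      change Sc.encodeWord n (R + 1) x k _ _ i + _ = _
      rw [Scheme.encodeWord, dif_neg (not_lt.2 hi)]
  · have hg : ∃ cy, X.got 1 = received adv (u, v)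
        (nextCarry adv (u, v) cy (wordStart Sc n R 0) (transmit Sc ω R (u, v) 0 (X.sig 0)))
        (wordStart Sc n R 1) (transmit Sc ω R (u, v) 1 (X.sig 1)) := ⟨_, rfl⟩
    obtain ⟨cy, hcy⟩ := hg
    -- Alice's request has ended any earlier silence. If Bob is silent now, the received word starts
    -- with the adversary's free bit, and hence depends on no coins at all.
    rw [nextCarry_transmit (by intro h; rw [h] at h0; exact h0)] at hcy
    right; right; right
    rcases hsig : X.sig 1 with _ | _ | ⟨x', k⟩
    · left
      rw [hsig] at hcy
      rw [hcy] at hx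
      exact ⟨x, hx⟩
    · right; left
      rw [hsig] at hcy
      rw [hcy] at hx
      exact ⟨x, hx⟩
    · rw [hsig] at h1
      exact absurd trivial h1
  · have hg : ∃ cy, X.got 2 = received adv (u, v)
        (nextCarry adv (u, v) cy (wordStart Sc n R 1) (transmit Sc ω R (u, v) 1 (X.sig 1)))
        (wordStart Sc n R 2) (transmit Sc ω R (u, v) 2 (X.sig 2)) := ⟨_, rfl⟩
    obtain ⟨cy, hcy⟩ := hg
    -- Likewise Bob's key precedes Alice's silence, so the third word depends on no coins.
    rw [nextCarry_transmit (by intro h; rw [h] at h1; exact h1), h2] at hcy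
    right; right; right; right; right
    rw [hcy] at hx
    exact ⟨x, hx⟩

theorem measure_union_le_ofReal {A B : Set (Coins n)} {a b : ℝ} (ha0 : 0 ≤ a) (hb0 : 0 ≤ b)
    (ha : coinMeasure n A ≤ ENNReal.ofReal a) (hb : coinMeasure n B ≤ ENNReal.ofReal b) :
    coinMeasure n (A ∪ B) ≤ ENNReal.ofReal (a + b) := by
  rw [ENNReal.ofReal_add ha0 hb0]
  exact (measure_union_le _ _).trans (add_le_add ha hb)

theorem measure_iUnion_le_ofReal {ι : Type*} [Fintype ι] {A : ι → Set (Coins n)} {a : ℝ}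
    (ha : ∀ j, coinMeasure n (A j) ≤ ENNReal.ofReal a) :
    coinMeasure n (⋃ j, A j) ≤ ENNReal.ofReal (Fintype.card ι * a) := by
  refine (measure_iUnion_fintype_le _ _).trans ?_
  refine (Finset.sum_le_sum fun j _ => ha j).trans (le_of_eq ?_)
  rw [Finset.sum_const, Finset.card_univ, nsmul_eq_mul, ENNReal.ofReal_mul (by positivity),
    ENNReal.ofReal_natCast]

/-- Union bound: four AMD words, padding, noise, and three ways to guess a key (Alice's against
silence or noise, Bob's against silence). Only the bound `ε` for padding and noise depends on the
proportions of the scheme, so it is a hypothesis. -/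
theorem measure_failure_le (hD : Sc.Fits n D) (u v : Fin n) {ε : ℝ} (hε : 0 ≤ ε)
    (hp : ∀ p : Fin 4 → Purpose, coinMeasure n {ω | ∃ j, ∃ y : Sc.Word n (R + 1),
      (∀ i : Fin (Sc.wordLen n (R + 1)), Sc.codeLen n (R + 1) ≤ i →
        y i = ω (R + 1, (u, v), p j, i) + adv.flip (u, v) (wordStart Sc n R j + i)) ∧
      IsSilence y} ≤ ENNReal.ofReal ε) :
    coinMeasure n {ω | (currentExch Sc adv Rv R u v ω).Failure ω (u, v)} ≤
      ENNReal.ofReal (4 * Sc.strength n (R + 1) + (ε + (ε + (1 / 2 ^ Sc.keyLen n (R + 1) +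
        (1 / 2 ^ Sc.keyLen n (R + 1) + 1 / 2 ^ Sc.keyLen n (R + 1)))))) := by
  have hs := (hD.strength_pos (R + 1) (by omega)).le
  refine (measure_mono fun ω h => failure_subset hD u v h).trans ?_
  refine measure_union_le_ofReal (by positivity) (by positivity) ?_
    (measure_union_le_ofReal hε (by positivity) ?_
    (measure_union_le_ofReal hε (by positivity) ?_
    (measure_union_le_ofReal (by positivity) (by positivity) ?_
    (measure_union_le_ofReal (by positivity) (by positivity) ?_ ?_))))
  · have := measure_iUnion_le_ofReal fun j : Fin 4 =>
      measure_amd_le (adv := adv) (Rv := Rv) hD u v j (Sc.ecc.dec (Sc.amdLen n (R + 1))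
        (fun i => adv.flip (u, v) (wordStart Sc n R j + i)))
    rw [Fintype.card_fin] at this
    refine (measure_mono ?_).trans this
    rintro ω ⟨j, hj⟩
    exact Set.mem_iUnion.2 ⟨j, hj⟩
  · exact hp .pad
  · exact hp .noise
  · exact measure_key_le _ _ (fun _ => silentWord Sc adv R (u, v) 1) ∅ Set.finite_empty
      (fun _ _ _ => rfl) fun _ => id
  · refine measure_key_le _ _ (noisyWord Sc adv R (u, v) 1)
      (Set.range fun i : Fin (Sc.wordLen n (R + 1)) => (R + 1, (u, v), .noise 1, (i : ℕ)))
      (Set.finite_range _) (fun ω ω' h => ?_) ?_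
    · funext i
      unfold noisyWord
      rw [h _ ⟨i, rfl⟩]
    · rintro i ⟨a, ha⟩
      simp at ha
  · exact measure_key_le _ _ (fun _ => silentWord Sc adv R (u, v) 2) ∅ Set.finite_empty
      (fun _ _ _ => rfl) fun _ => id

end Failure

/-! ### Failure probability for the concrete parameters. -/

section Concrete

variable {n : ℕ} {δ : ℝ} {adv : Adversary n}
  {G : SimpleGraph (Fin n)} {S : Fin n → Type*} {P : Protocol G S} {Rv : P.Resolver}

/-- Of the `2400 l` bits of a word at most `106 l` carry the codeword, so more than `2250 l` are
random. The silence threshold is `800 l` alternations, well below half of this. -/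
theorem measure_conversion_le (hn : 2 ≤ n) (h0 : 0 < δ) (h1 : δ < 1) (R : ℕ) (u v : Fin n)
    (p : Fin 4 → Purpose) :
    coinMeasure n {ω | ∃ j, ∃ y : (concreteScheme δ).Word n (R + 1),
      (∀ i : Fin ((concreteScheme δ).wordLen n (R + 1)), (concreteScheme δ).codeLen n (R + 1) ≤ i →
        y i = ω (R + 1, (u, v), p j, i) +
          adv.flip (u, v) (wordStart (concreteScheme δ) n R j + i)) ∧
      IsSilence y} ≤ ENNReal.ofReal (δ / (64 * n ^ 2 * (R + 1) ^ 2)) := by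
  set l := logLen n (R + 1) δ with hl
  have hw : (concreteScheme δ).wordLen n (R + 1) = 2400 * l := wordLen_concrete
  have hc := codeLen_concrete_le hn (Nat.le_add_left 1 R) h0 h1
  have hl2 := two_le_logLen hn (Nat.le_add_left 1 R) h0 h1
  have hratio := ratio_le_two_pow hn (Nat.le_add_left 1 R) h0 h1
  rw [← hl] at hc hl2 hratio
  set a := (concreteScheme δ).codeLen n (R + 1)
  obtain ⟨N, hN⟩ : ∃ N, (concreteScheme δ).wordLen n (R + 1) = a + (N + 1) :=
    ⟨2400 * l - a - 1, by omega⟩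
  have hNl : 2250 * l ≤ N := by omega
  have hone : ∀ j, coinMeasure n {ω | ∃ y : (concreteScheme δ).Word n (R + 1),
      (∀ i : Fin ((concreteScheme δ).wordLen n (R + 1)), a ≤ i →
        y i = ω (R + 1, (u, v), p j, i) +
          adv.flip (u, v) (wordStart (concreteScheme δ) n R j + i)) ∧
      IsSilence y} ≤ ENNReal.ofReal (δ / (256 * n ^ 2 * (R + 1) ^ 2)) := by
    intro j
    refine (measure_isSilence_le hN (M := 800 * l) (by omega)
      (fun i => (R + 1, (u, v), p j, i)) (purpose_injective _ _ _)
      (fun i => adv.flip (u, v) (wordStart (concreteScheme δ) n R j + i))).trans ?_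
    apply ENNReal.ofReal_le_ofReal
    have hn' : (2 : ℝ) ≤ n := by exact_mod_cast hn
    calc (3 / 4 : ℝ) ^ N * 2 ^ (800 * l) ≤ (3 / 4) ^ (2250 * l) * 2 ^ (800 * l) := by
          refine mul_le_mul_of_nonneg_right ?_ (by positivity)
          exact pow_le_pow_of_le_one (by norm_num) (by norm_num) hNl
      -- The exponents `2250` and `800` are `50` times `45` and `16`. The resulting `4 ^ (-50 l)` is
      -- far smaller than the required bound of order `(2 ^ l) ^ (-2)`.
      _ = ((3 / 4) ^ 45 * 2 ^ 16) ^ (50 * l) := by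
          rw [mul_pow, ← pow_mul, ← pow_mul]
          congr 2 <;> ring
      _ ≤ (1 / 4) ^ (50 * l) := by
          refine pow_le_pow_left₀ (by positivity) ?_ _
          norm_num
      _ ≤ (1 / 4) ^ (4 + l) := pow_le_pow_of_le_one (by norm_num) (by norm_num) (by omega)
      _ = (256 * ((2 : ℝ) ^ l) ^ 2)⁻¹ := by
          rw [pow_add, ← pow_mul, mul_comm l 2, pow_mul, mul_inv, one_div, inv_pow, inv_pow]
          norm_num
      _ ≤ (256 * (n * (R + 1 : ℕ) / δ) ^ 2)⁻¹ := by
          gcongr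
      _ = δ ^ 2 / (256 * n ^ 2 * (R + 1) ^ 2) := by
          push_cast
          field_simp
      _ ≤ δ / (256 * n ^ 2 * (R + 1) ^ 2) := by
          gcongr
          nlinarith
  have := measure_iUnion_le_ofReal hone
  rw [Fintype.card_fin] at this
  refine (measure_mono ?_).trans (this.trans (le_of_eq ?_))
  · rintro ω ⟨j, hj⟩
    exact Set.mem_iUnion.2 ⟨j, hj⟩
  · congr 1
    have hn' : (2 : ℝ) ≤ n := by exact_mod_cast hn
    push_cast
    field_simp
    norm_num

theorem measure_round_failure_le (hn : 2 ≤ n) (h0 : 0 < δ) (h1 : δ < 1) (R : ℕ) (u v : Fin n) :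
    coinMeasure n {ω | (currentExch (concreteScheme δ) adv Rv R u v ω).Failure ω (u, v)} ≤
      ENNReal.ofReal (δ / (2 * n ^ 2 * (R + 1) ^ 2)) := by
  have hn' : (2 : ℝ) ≤ n := by exact_mod_cast hn
  refine (measure_failure_le (fits_concrete hn h0 h1) u v
    (ε := δ / (64 * n ^ 2 * (R + 1) ^ 2)) (by positivity)
    fun p => measure_conversion_le hn h0 h1 R u v p).trans ?_
  apply ENNReal.ofReal_le_ofReal
  set q : ℝ := δ / (n ^ 2 * (R + 1) ^ 2) with hq
  have hq0 : 0 < q := by positivity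
  have hpi := Real.pi_gt_three
  have hpi2 : (9 : ℝ) ≤ Real.pi ^ 2 := by nlinarith
  have e1 : (concreteScheme δ).strength n (R + 1) ≤ q / 18 := by
    have : (concreteScheme δ).strength n (R + 1) = q / (2 * Real.pi ^ 2) := by
      unfold Scheme.strength concreteScheme
      rw [hq]
      push_cast
      field_simp
    rw [this]
    gcongr
    linarith
  have e2 : 1 / 2 ^ (concreteScheme δ).keyLen n (R + 1) ≤ q / 144 := by
    have := le_two_pow_keyLen hn (Nat.le_add_left 1 R) h0
    calc 1 / 2 ^ (concreteScheme δ).keyLen n (R + 1) ≤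
          1 / (16 * n ^ 2 * Real.pi ^ 2 * (R + 1 : ℕ) ^ 2 / δ) := by
          gcongr
      _ = q / (16 * Real.pi ^ 2) := by
          rw [hq]
          push_cast
          field_simp
      _ ≤ _ := by gcongr; linarith
  have e3 : δ / (64 * n ^ 2 * (R + 1) ^ 2) = q / 64 := by
    rw [hq]; field_simp
  have e4 : δ / (2 * n ^ 2 * (R + 1) ^ 2) = q / 2 := by
    rw [hq]; field_simp
  rw [e3, e4]
  -- In total `4/18 + 2/64 + 3/144 < 1/2`.
  linarith

theorem tsum_inv_succ_sq_le : Summable (fun R : ℕ => 1 / ((R : ℝ) + 1) ^ 2) ∧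
    ∑' R : ℕ, 1 / ((R : ℝ) + 1) ^ 2 ≤ 2 := by
  have h := (hasSum_nat_add_iff' 1).2 hasSum_zeta_two
  simp only [Finset.sum_range_one, Nat.cast_zero, Nat.cast_add, Nat.cast_one] at h
  refine ⟨h.summable, ?_⟩
  rw [h.tsum_eq]
  have h1 := Real.pi_lt_d2
  have h2 := Real.pi_pos
  norm_num
  nlinarith

/-- Summing over `n²` channels cancels `n²`, and `∑ 1 / r² ≤ 2` cancels the remaining `1/2`.
Countable subadditivity holds for all sets, so the failure event itself need not be measurable. -/
theorem measure_fails_le (hn : 2 ≤ n) (h0 : 0 < δ) (h1 : δ < 1) :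
    coinMeasure n {ω | Fails (concreteScheme δ) adv ω Rv} ≤ ENNReal.ofReal δ := by
  have hn' : (2 : ℝ) ≤ n := by exact_mod_cast hn
  have hR : ∀ R : ℕ, coinMeasure n (⋃ c : Channel n,
      {ω | (currentExch (concreteScheme δ) adv Rv R c.1 c.2 ω).Failure ω (c.1, c.2)}) ≤
      ENNReal.ofReal (δ / 2 * (1 / ((R : ℝ) + 1) ^ 2)) := by
    intro R
    refine (measure_iUnion_le_ofReal fun c : Channel n =>
      measure_round_failure_le (adv := adv) (Rv := Rv) hn h0 h1 R c.1 c.2).trans (le_of_eq ?_)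
    congr 1
    rw [Fintype.card_prod, Fintype.card_fin]
    push_cast
    field_simp
  have hsub : {ω | Fails (concreteScheme δ) adv ω Rv} ⊆ ⋃ R : ℕ, ⋃ c : Channel n,
      {ω | (currentExch (concreteScheme δ) adv Rv R c.1 c.2 ω).Failure ω (c.1, c.2)} := by
    rintro ω ⟨R, u, v, h⟩
    exact Set.mem_iUnion.2 ⟨R, Set.mem_iUnion.2 ⟨(u, v), h⟩⟩
  obtain ⟨hs, ht⟩ := tsum_inv_succ_sq_le
  calc _ ≤ _ := measure_mono hsub
    _ ≤ ∑' R : ℕ, _ := measure_iUnion_le _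
    _ ≤ ∑' R : ℕ, ENNReal.ofReal (δ / 2 * (1 / ((R : ℝ) + 1) ^ 2)) := ENNReal.tsum_le_tsum hR
    _ = ENNReal.ofReal (∑' R : ℕ, δ / 2 * (1 / ((R : ℝ) + 1) ^ 2)) :=
        (ENNReal.ofReal_tsum_of_nonneg (fun R => by positivity) (hs.mul_left _)).symm
    _ ≤ ENNReal.ofReal δ := by
        apply ENNReal.ofReal_le_ofReal
        rw [tsum_mul_left]
        nlinarith

end Concrete

/-! ### Asynchronous runs -/

section Runs

variable {n : ℕ} {G : SimpleGraph (Fin n)} {S : Fin n → Type*} {P : Protocol G S}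

theorem Protocol.Run.append {c c' c'' : Config S} {t t' : List (Event n)} (h : P.Run c t c')
    (h' : P.Run c' t' c'') : P.Run c (t ++ t') c'' := by
  induction h with
  | nil c => exact h'
  | cons c c₁ c₂ e tr hs _ ih => exact .cons c c₁ _ e _ hs (ih h')

theorem Config.ext' {c c' : Config S} (h1 : ∀ u, c.st u = c'.st u)
    (h2 : ∀ u v, c.chan u v = c'.chan u v) : c = c' := by
  cases c; cases c'
  congr 1
  · exact funext h1
  · exact funext fun u => funext (h2 u)

variable {Rv : P.Resolver}

theorem burst_settled {u : Fin n} {s : S u} (h : Settled Rv u s) (k : ℕ) :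
    burst Rv u k s = ([], s) := by
  cases k with
  | zero => rfl
  | succ k =>
    rcases h with h | h
    · simp [burst, h]
    · simp [burst, h]

theorem drain_settled {u : Fin n} {s : S u} (h : Settled Rv u s) : drain Rv u s = ([], s) := by
  have : ∃ k, Settled Rv u (burst Rv u k s).2 := ⟨0, h⟩
  rw [drain, dif_pos this, burst_settled h]

theorem drain_spec {u : Fin n} {s : S u} (h : ∃ k, Settled Rv u (burst Rv u k s).2) :
    (∃ k, drain Rv u s = burst Rv u k s) ∧ Settled Rv u (drain Rv u s).2 := by
  classical
  rw [drain, dif_pos h]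
  exact ⟨⟨_, rfl⟩, Nat.find_spec h⟩

theorem burst_of_pick {u v : Fin n} {s s' : S u} {m : Bit} (h : s ∉ P.term u)
    (hp : Rv.pick u s = some (v, m, s')) (k : ℕ) :
    burst Rv u (k + 1) s = ((v, m) :: (burst Rv u k s').1, (burst Rv u k s').2) := by
  simp [burst, h, hp]

theorem exists_pick {u : Fin n} {s : S u} (h : ¬ Settled Rv u s) :
    s ∉ P.term u ∧ ∃ v m s', Rv.pick u s = some (v, m, s') := by
  unfold Settled at h
  push Not at h
  refine ⟨h.1, ?_⟩
  rcases hp : Rv.pick u s with _ | ⟨v, m, s'⟩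
  · exact absurd hp h.2
  · exact ⟨v, m, s', rfl⟩

theorem burst_succ_state (u : Fin n) (k : ℕ) (s : S u) :
    (burst Rv u (k + 1) s).2 = (burst Rv u 1 (burst Rv u k s).2).2 := by
  induction k generalizing s with
  | zero => rfl
  | succ k ih =>
    by_cases h : Settled Rv u s
    · simp only [burst_settled h]
    · obtain ⟨h1, v, m, s', hp⟩ := exists_pick h
      rw [burst_of_pick h1 hp, burst_of_pick h1 hp, ih]

/-- A burst that never settled would be an infinite succession of sends from a reachable state. -/
theorem exists_settled (hP : P.Terminates) {tr : List (Event n)} {c : Config S}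
    (hr : P.Run P.initConfig tr c) (u : Fin n) :
    ∃ k, Settled Rv u (burst Rv u k (c.st u)).2 := by
  by_contra! hc
  refine hP.no_burst tr c u hr ⟨fun k => (burst Rv u k (c.st u)).2, rfl, fun k => ?_⟩
  obtain ⟨h1, v, m, s', hp⟩ := exists_pick (hc k)
  refine ⟨h1, v, m, ?_⟩
  have h2 : (burst Rv u (k + 1) (c.st u)).2 = s' := by
    rw [burst_succ_state, burst_of_pick h1 hp]
    rfl
  change P.step u (burst Rv u k (c.st u)).2 _ (burst Rv u (k + 1) (c.st u)).2
  rw [h2]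
  exact Rv.pick_some _ _ _ _ _ hp

theorem toUser_nil (v : Fin n) : toUser v [] = [] := rfl

theorem toUser_cons (v w : Fin n) (m : Bit) (l : List (Fin n × Bit)) :
    toUser v ((w, m) :: l) = if w = v then m :: toUser v l else toUser v l := by
  unfold toUser
  by_cases h : w = v <;> simp [h]

theorem run_sends (v : Fin n) (k : ℕ) (c : Config S) (s : S v) (hs : c.st v = s) :
    P.Run c ((burst Rv v k s).1.map fun p => .send v p.1 p.2)
      ⟨Function.update c.st v (burst Rv v k s).2,
        fun a b => if a = v then c.chan a b ++ toUser b (burst Rv v k s).1 else c.chan a b⟩ := by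
  induction k generalizing c s with
  | zero =>
    subst hs
    convert Protocol.Run.nil c
    · simp [burst]
    · simp [burst]
    · split_ifs <;> simp [burst, toUser_nil]
  | succ k ih =>
    subst hs
    by_cases h : Settled Rv v (c.st v)
    · rw [burst_settled h]
      convert Protocol.Run.nil c
      · simp
      · simp
      · split_ifs <;> simp [toUser_nil]
    · obtain ⟨h1, w, m, s', hp⟩ := exists_pick h
      rw [burst_of_pick h1 hp]
      have hstep := Protocol.Step.send (P := P) c v w m s' h1 (Rv.pick_some _ _ _ _ _ hp)
      refine .cons _ _ _ _ _ hstep ?_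
      have := ih ⟨Function.update c.st v s', Function.update c.chan v
        (Function.update (c.chan v) w (c.chan v w ++ [m]))⟩ s' (by simp)
      convert this using 2
      · simp
      · funext a b
        by_cases ha : a = v
        · subst ha
          by_cases hb : w = b
          · subst hb; simp [toUser_cons]
          · have hb' : b ≠ w := fun h => hb h.symm
            simp [toUser_cons, hb, hb']
        · simp [ha]

/-- The senders are distinct, as at most one message per channel is recorded in a round. So each
reception removes the head of its own queue and leaves the other heads in place. -/
theorem run_recvs (v : Fin n) (l : List (Fin n × Bit)) (c : Config S)
    (hl : (l.map Prod.fst).Nodup)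
    (h : ∀ p ∈ l, G.Adj p.1 v ∧ ∃ q, c.chan p.1 v = p.2 :: q) :
    P.Run c (l.map fun p => .recv p.1 v p.2)
      ⟨Function.update c.st v (l.foldl (fun s p => Rv.next v s p.1 p.2) (c.st v)),
        fun a b => if b = v ∧ a ∈ l.map Prod.fst then (c.chan a b).tail else c.chan a b⟩ := by
  induction l generalizing c with
  | nil =>
    convert Protocol.Run.nil c
    · simp
    · simp
    · split_ifs <;> simp_all
  | cons p l ih =>
    obtain ⟨u, m⟩ := p
    obtain ⟨hadj, q, hq⟩ := h (u, m) (by simp)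
    simp only at hadj hq
    simp only [List.map_cons, List.nodup_cons] at hl
    have hstep := Protocol.Step.recv (P := P) c u v m q (Rv.next v (c.st v) u m) hq
      (Rv.next_step _ _ _ _ hadj)
    refine .cons _ _ _ _ _ hstep ?_
    have := ih ⟨Function.update c.st v (Rv.next v (c.st v) u m),
      Function.update c.chan u (Function.update (c.chan u) v q)⟩ hl.2 ?_
    · convert this using 2
      · simp
      · funext a b
        by_cases ha : a = u
        · subst ha
          by_cases hb : b = v
          · subst hb; simp [hl.1, hq]
          · simp [hb]
        · simp [ha]
    · intro p hp
      obtain ⟨h1, q', h2⟩ := h p (List.mem_cons_of_mem _ hp)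
      have hne : p.1 ≠ u := by
        rintro rfl
        exact hl.1 (List.mem_map_of_mem hp)
      refine ⟨h1, q', ?_⟩
      simpa [hne] using h2

open Classical in
theorem sendCount_cons_send (tr : List (Event n)) (a b u v : Fin n) (m : Bit) :
    sendCount (.send a b m :: tr) u v = sendCount tr u v + if a = u ∧ b = v then 1 else 0 := by
  split_ifs with h
  · exact List.countP_cons_of_pos (decide_eq_true (p := Event.IsSendOn u v (.send a b m)) h)
  · exact List.countP_cons_of_neg
      fun h' => h (of_decide_eq_true (p := Event.IsSendOn u v (.send a b m)) h')

open Classical in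
theorem sendCount_cons_recv (tr : List (Event n)) (a b u v : Fin n) (m : Bit) :
    sendCount (.recv a b m :: tr) u v = sendCount tr u v := by
  exact List.countP_cons_of_neg
    fun h => of_decide_eq_true (p := Event.IsSendOn u v (.recv a b m)) h

open Classical in
theorem recvCount_cons_recv (tr : List (Event n)) (a b u v : Fin n) (m : Bit) :
    recvCount (.recv a b m :: tr) u v = recvCount tr u v + if a = u ∧ b = v then 1 else 0 := by
  split_ifs with h
  · exact List.countP_cons_of_pos (decide_eq_true (p := Event.IsRecvOn u v (.recv a b m)) h)
  · exact List.countP_cons_of_neg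
      fun h' => h (of_decide_eq_true (p := Event.IsRecvOn u v (.recv a b m)) h')

open Classical in
theorem recvCount_cons_send (tr : List (Event n)) (a b u v : Fin n) (m : Bit) :
    recvCount (.send a b m :: tr) u v = recvCount tr u v := by
  exact List.countP_cons_of_neg
    fun h => of_decide_eq_true (p := Event.IsRecvOn u v (.send a b m)) h

/-- Conservation of messages on a channel; it translates queue lengths into message numbers. -/
theorem run_counts {c c' : Config S} {tr : List (Event n)} (h : P.Run c tr c') (u v : Fin n) :
    (c.chan u v).length + sendCount tr u v = recvCount tr u v + (c'.chan u v).length := by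
  induction h with
  | nil c => simp [sendCount, recvCount]
  | cons c c₁ c₂ e tr hs _ ih =>
    cases hs with
    | send a b m s' h1 h2 =>
      rw [sendCount_cons_send, recvCount_cons_send]
      by_cases hab : a = u ∧ b = v
      · obtain ⟨rfl, rfl⟩ := hab
        simp only [Function.update_self, List.length_append, List.length_singleton] at ih
        simp only [and_self, if_true]
        omega
      · have hch : Function.update c.chan a (Function.update (c.chan a) b (c.chan a b ++ [m])) u v =
            c.chan u v := by
          by_cases ha : u = a
          · subst ha
            have hb : v ≠ b := fun h => hab ⟨rfl, h.symm⟩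
            simp [hb]
          · simp [ha]
        simp only [hch] at ih
        rw [if_neg hab]
        omega
    | recv a b m q s' h1 h2 =>
      rw [sendCount_cons_recv, recvCount_cons_recv]
      by_cases hab : a = u ∧ b = v
      · obtain ⟨rfl, rfl⟩ := hab
        simp only [Function.update_self] at ih
        simp only [h1, and_self, if_true, List.length_cons]
        omega
      · have hch : Function.update c.chan a (Function.update (c.chan a) b q) u v =
            c.chan u v := by
          by_cases ha : u = a
          · subst ha
            have hb : v ≠ b := fun h => hab ⟨rfl, h.symm⟩
            simp [hb]
          · simp [ha]
        simp only [hch] at ih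
        rw [if_neg hab]
        omega

end Runs

/-! ### The simulated run -/

/-- `Send-Message` returns. -/
def Exchange.Returns {Sc : Scheme} {n R : ℕ} (X : Exchange Sc n R) : Prop :=
  X.ReturnsEarly ∨ X.ReturnsFinally

section Simulation

variable {n : ℕ} {G : SimpleGraph (Fin n)} {S : Fin n → Type*} {P : Protocol G S}
  (Sc : Scheme) (adv : Adversary n) (ω : Coins n) (Rv : P.Resolver)

/-- What is added to the transcript of user `v` in round `R + 1`. -/
def Global.newEvents (g : Global P) (R : ℕ) (v : Fin n) : List (Event n) :=
  ((g.received Sc adv ω R v).map fun p => .recv p.1 v p.2) ++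
    ((g.react Sc adv ω Rv R v).1.map fun p => .send v p.1 p.2)

/-- The part of the asynchronous run that corresponds to round `R + 1`. -/
def Global.roundTrace (g : Global P) (R : ℕ) : List (Event n) :=
  (List.finRange n).flatMap (g.newEvents Sc adv ω Rv R)

/-- No failure event happens in round `R + 1`. -/
def Global.SafeRound (g : Global P) (R : ℕ) : Prop :=
  ∀ u v, ¬ (g.exch Sc adv ω R u v).Failure ω (u, v)

/-- The messages in transit from `u` to `v`: those scheduled that have not been recorded. -/
def Global.pending (g : Global P) (u v : Fin n) : List Bit :=
  if g.par u v = g.parHat u v then (g.queue u v).tail else g.queue u v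

/-- Relation between the state of `π'` after a round and the configuration reached by the
simulated run. -/
structure Global.Inv (g : Global P) (cfg : Config S) : Prop where
  st_eq : ∀ u, cfg.st u = g.st u
  settled : ∀ u, Settled Rv u (g.st u)
  adj : ∀ u v, g.queue u v ≠ [] → G.Adj u v
  -- Only for receivers who still listen: messages to a terminated user leave the queue without
  -- being received in the simulated run.
  chan_eq : ∀ u v, g.st v ∉ P.term v → cfg.chan u v = g.pending u v
  -- Equal parities mean that the head was recorded but its acknowledgement spoiled; such a head
  -- must exist.
  unacked : ∀ u v, g.st v ∉ P.term v → g.par u v = g.parHat u v → g.queue u v ≠ []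
  queue_le : ∀ u v, (g.queue u v).length ≤ sendCount (g.hist u) u v

variable {Sc adv ω Rv} {D : ℕ} {g : Global P} {R : ℕ} {u v : Fin n} {cfg : Config S}

theorem exch_of_nil (hD : Sc.Fits n D) (hX : g.SafeRound Sc adv ω R) (h : g.queue u v = []) :
    (g.exch Sc adv ω R u v).accepted = none ∧ ¬ (g.exch Sc adv ω R u v).Returns ∧
    ¬ (g.exch Sc adv ω R u v).ReturnsFinally ∧
    ((g.exch Sc adv ω R u v).bitsSent = 0 ∨
      Sc.wordLen n (R + 1) ≤ D * roundFlips Sc adv R (u, v)) := by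
  have hX := hX u v
  unfold Global.exch at hX ⊢
  rw [h] at hX ⊢
  obtain ⟨h1, h2, h3, h4⟩ := exchange_idle hD hX
  exact ⟨h1, not_or.2 ⟨h2, h3⟩, h3, h4⟩

theorem exch_of_not_listening (hD : Sc.Fits n D) (hX : g.SafeRound Sc adv ω R) {m : Bit}
    {q : List Bit} (h : g.queue u v = m :: q) (hb : ¬ (G.Adj u v ∧ g.st v ∉ P.term v)) :
    (g.exch Sc adv ω R u v).accepted = none ∧ ¬ (g.exch Sc adv ω R u v).ReturnsFinally ∧
    ((g.exch Sc adv ω R u v).Returns ∨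
      Sc.wordLen n (R + 1) ≤ D * roundFlips Sc adv R (u, v)) := by
  have hX := hX u v
  unfold Global.exch at hX ⊢
  rw [h] at hX ⊢
  obtain ⟨h1, h2, h3⟩ := exchange_unanswered hD hb hX
  exact ⟨h1, h2, h3.imp_left .inl⟩

theorem exch_of_listening (hD : Sc.Fits n D) (hX : g.SafeRound Sc adv ω R) {m : Bit}
    {q : List Bit} (h : g.queue u v = m :: q) (hb : G.Adj u v ∧ g.st v ∉ P.term v) :
    ((g.exch Sc adv ω R u v).Returns ↔ (g.exch Sc adv ω R u v).ReturnsFinally) ∧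
    ((g.exch Sc adv ω R u v).accepted = none ∨
      (g.exch Sc adv ω R u v).accepted = some (m, g.par u v)) ∧
    ((g.exch Sc adv ω R u v).ReturnsFinally →
      (g.exch Sc adv ω R u v).accepted = some (m, g.par u v)) ∧
    ((g.exch Sc adv ω R u v).ReturnsFinally ∨
      Sc.wordLen n (R + 1) ≤ D * roundFlips Sc adv R (u, v)) := by
  have hX := hX u v
  unfold Global.exch at hX ⊢
  rw [h] at hX ⊢
  obtain ⟨h1, h2, h3, h4⟩ := exchange_answered hD hb hX
  exact ⟨⟨fun h => h.resolve_left h1, .inr⟩, h2, h3, h4⟩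

/-- Authenticity: what is recorded is the head of the sender's queue, and the differing parities
show that it is recorded for the first time. -/
theorem recorded_eq_some (hD : Sc.Fits n D) (hX : g.SafeRound Sc adv ω R) {m : Bit}
    (h : g.recorded Sc adv ω R u v = some m) :
    G.Adj u v ∧ g.st v ∉ P.term v ∧ g.par u v ≠ g.parHat u v ∧
      (g.exch Sc adv ω R u v).accepted = some (m, g.par u v) ∧ ∃ q, g.queue u v = m :: q := by
  unfold Global.recorded at h
  rcases hq : g.queue u v with _ | ⟨m', q⟩
  · rw [(exch_of_nil hD hX hq).1] at h
    cases h
  · by_cases hb : G.Adj u v ∧ g.st v ∉ P.term v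
    · rcases (exch_of_listening hD hX hq hb).2.1 with ha | ha
      · rw [ha] at h
        cases h
      · rw [ha] at h ⊢
        simp only [Option.bind_some] at h
        split_ifs at h with hp
        cases h
        exact ⟨hb.1, hb.2, hp, rfl, q, rfl⟩
    · rw [(exch_of_not_listening hD hX hq hb).1] at h
      cases h

theorem map_fst_filterMap {α β : Type*} (f : α → Option β) (l : List α) :
    (l.filterMap fun a => (f a).map fun b => (a, b)).map Prod.fst =
      l.filter fun a => (f a).isSome := by
  induction l with
  | nil => rfl
  | cons a l ih =>
    rcases h : f a with _ | b <;> simp [h, ih]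

theorem received_fst : (g.received Sc adv ω R v).map Prod.fst =
    (List.finRange n).filter fun u => (g.recorded Sc adv ω R u v).isSome :=
  map_fst_filterMap _ _

theorem mem_received {p : Fin n × Bit} :
    p ∈ g.received Sc adv ω R v ↔ g.recorded Sc adv ω R p.1 v = some p.2 := by
  obtain ⟨u, m⟩ := p
  unfold Global.received
  simp only [List.mem_filterMap, List.mem_finRange, true_and, Option.map_eq_some_iff,
    Prod.mk.injEq]
  constructor
  · rintro ⟨a, b, h, rfl, rfl⟩
    exact h
  · intro h
    exact ⟨u, m, h, rfl, rfl⟩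

theorem received_eq_nil_of_term (hD : Sc.Fits n D) (hX : g.SafeRound Sc adv ω R)
    (h : g.st v ∈ P.term v) : g.received Sc adv ω R v = [] := by
  rw [List.eq_nil_iff_forall_not_mem]
  intro p hp
  exact (recorded_eq_some hD hX (mem_received.1 hp)).2.1 h

theorem react_of_received_nil (hs : Settled Rv v (g.st v))
    (h : g.received Sc adv ω R v = []) : g.react Sc adv ω Rv R v = ([], g.st v) := by
  rw [Global.react, h]
  exact drain_settled hs

/-- The configuration of the simulated run after the events of the users in `l` have been added in
round `R + 1`. -/
def afterConfig (Sc : Scheme) (adv : Adversary n) (ω : Coins n) (Rv : P.Resolver) (g : Global P)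
    (R : ℕ) (cfg : Config S) (l : List (Fin n)) : Config S where
  st a := if a ∈ l then (g.react Sc adv ω Rv R a).2 else cfg.st a
  chan a b := (if b ∈ l ∧ (g.recorded Sc adv ω R a b).isSome then (cfg.chan a b).tail
    else cfg.chan a b) ++ (if a ∈ l then toUser b (g.react Sc adv ω Rv R a).1 else [])

/-- Any order of the users works. Recorded messages were already at the heads of their queues when
the round began, and sends of users treated earlier only append at the ends. -/
theorem run_afterConfig (hP : P.Terminates) (hD : Sc.Fits n D) (hX : g.SafeRound Sc adv ω R)
    (hI : g.Inv Rv cfg) {tr : List (Event n)} (hr : P.Run P.initConfig tr cfg)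
    (l : List (Fin n)) (hl : l.Nodup) :
    P.Run cfg (l.flatMap (g.newEvents Sc adv ω Rv R)) (afterConfig Sc adv ω Rv g R cfg l) ∧
      ∀ v ∈ l, Settled Rv v (g.react Sc adv ω Rv R v).2 := by
  induction l using List.reverseRecOn with
  | nil =>
    refine ⟨?_, by simp⟩
    have : afterConfig Sc adv ω Rv g R cfg [] = cfg :=
      Config.ext' (fun u => by simp [afterConfig]) fun u v => by simp [afterConfig]
    rw [this]
    exact .nil _
  | append_singleton l v ih =>
    have hv : v ∉ l := by
      intro h
      have := (List.nodup_append.1 hl).2.2 v h v (by simp)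
      exact this rfl
    obtain ⟨ih, ihs⟩ := ih (List.nodup_append.1 hl).1
    set c₀ := afterConfig Sc adv ω Rv g R cfg l with hc₀
    have hst : c₀.st v = g.st v := by simp [hc₀, afterConfig, hv, hI.st_eq]
    have hhead : ∀ p ∈ g.received Sc adv ω R v, G.Adj p.1 v ∧ ∃ q, cfg.chan p.1 v = p.2 :: q := by
      intro p hp
      obtain ⟨h1, h2, h3, -, q, h4⟩ := recorded_eq_some hD hX (mem_received.1 hp)
      refine ⟨h1, q, ?_⟩
      rw [hI.chan_eq _ _ h2, Global.pending, if_neg h3, h4]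
    have hrecv := run_recvs (P := P) (Rv := Rv) v (g.received Sc adv ω R v) c₀
      (by rw [received_fst]; exact (List.nodup_finRange n).filter _) (by
        intro p hp
        obtain ⟨h1, q, h2⟩ := hhead p hp
        refine ⟨h1, q ++ (if p.1 ∈ l then toUser v (g.react Sc adv ω Rv R p.1).1 else []), ?_⟩
        simp only [hc₀, afterConfig, hv, false_and, if_false, h2, List.cons_append])
    set c₁ : Config S := ⟨Function.update c₀.st v ((g.received Sc adv ω R v).foldl
      (fun s p => Rv.next v s p.1 p.2) (c₀.st v)), fun a b =>
        if b = v ∧ a ∈ (g.received Sc adv ω R v).map Prod.fst then (c₀.chan a b).tail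
        else c₀.chan a b⟩ with hc₁
    have hst₁ : c₁.st v = (g.received Sc adv ω R v).foldl
        (fun s p => Rv.next v s p.1 p.2) (g.st v) := by
      simp [hc₁, hst]
    have hrun₁ := hr.append (ih.append hrecv)
    -- The state from which `v` starts sending is reached by an actual run, so `no_burst` applies to
    -- it.
    obtain ⟨⟨k, hk⟩, hset⟩ := drain_spec (exists_settled (Rv := Rv) hP hrun₁ v)
    rw [hst₁] at hk hset
    have hreact : g.react Sc adv ω Rv R v = burst Rv v k (c₁.st v) := by
      rw [hst₁]; exact hk
    have hsend := run_sends (Rv := Rv) v k c₁ (c₁.st v) rfl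
    rw [← hreact] at hsend
    refine ⟨?_, ?_⟩
    swap
    · intro a ha
      rcases List.mem_append.1 ha with ha | ha
      · exact ihs a ha
      · rw [List.mem_singleton.1 ha]
        exact hset
    rw [List.flatMap_append, List.flatMap_singleton]
    refine ih.append ?_
    refine hrecv.append ?_
    convert hsend using 1
    refine Config.ext' (fun a => ?_) fun a b => ?_
    · by_cases ha : a = v
      · subst ha
        simp [afterConfig]
      · simp [afterConfig, hc₁, hc₀, ha]
    · have hmem : ∀ a, (a ∈ (g.received Sc adv ω R v).map Prod.fst) ↔
          (g.recorded Sc adv ω R a v).isSome := by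
        intro a
        rw [received_fst]
        simp
      simp only [afterConfig, hc₁, hc₀, hmem, List.mem_append, List.mem_singleton]
      by_cases hb : b = v
      · subst hb
        by_cases hs : (g.recorded Sc adv ω R a b).isSome
        · obtain ⟨m, hm⟩ := Option.isSome_iff_exists.1 hs
          obtain ⟨-, q, hq⟩ := hhead (a, m) (mem_received.2 hm)
          simp only at hq
          by_cases ha : a = b
          · subst ha
            simp [hs, hv, hq]
          · simp [hs, hv, hq, ha]
        · by_cases ha : a = b
          · subst ha
            simp [hs, hv]
          · simp [hs, ha]
      · by_cases ha : a = v
        · subst ha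
          simp [hb, hv]
        · simp [hb, ha]

theorem sendCount_append (t t' : List (Event n)) (u v : Fin n) :
    sendCount (t ++ t') u v = sendCount t u v + sendCount t' u v :=
  List.countP_append

theorem recvCount_append (t t' : List (Event n)) (u v : Fin n) :
    recvCount (t ++ t') u v = recvCount t u v + recvCount t' u v :=
  List.countP_append

theorem sendCount_map_recv (l : List (Fin n × Bit)) (w u v : Fin n) :
    sendCount (l.map fun p => .recv p.1 w p.2) u v = 0 := by
  induction l with
  | nil => rfl
  | cons p l ih => rw [List.map_cons, sendCount_cons_recv, ih]

theorem sendCount_map_send (l : List (Fin n × Bit)) (u v : Fin n) :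
    sendCount (l.map fun p => .send u p.1 p.2) u v = (toUser v l).length := by
  induction l with
  | nil => rfl
  | cons p l ih =>
    rw [List.map_cons, sendCount_cons_send, ih, toUser_cons]
    by_cases h : p.1 = v <;> simp [h]

theorem round_hist (g : Global P) (R : ℕ) (v : Fin n) :
    (g.round Sc adv ω Rv R).hist v = g.hist v ++ g.newEvents Sc adv ω Rv R v :=
  List.append_assoc _ _ _

theorem sendCount_round_hist : sendCount ((g.round Sc adv ω Rv R).hist u) u v =
    sendCount (g.hist u) u v + (toUser v (g.react Sc adv ω Rv R u).1).length := by
  rw [round_hist, sendCount_append, Global.newEvents, sendCount_append, sendCount_map_recv,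
    sendCount_map_send, zero_add]

open Classical in
theorem round_queue : (g.round Sc adv ω Rv R).queue u v =
    (if (g.exch Sc adv ω R u v).Returns then (g.queue u v).tail else g.queue u v) ++
      toUser v (g.react Sc adv ω Rv R u).1 := by
  unfold Global.round
  exact congrArg (· ++ _) (if_congr Iff.rfl rfl rfl)

theorem mem_drain_adj {v : Fin n} {s : S v} {w : Fin n} {m : Bit}
    (h : (w, m) ∈ (drain Rv v s).1) : G.Adj v w := by
  have hb : ∀ k (s : S v), (w, m) ∈ (burst Rv v k s).1 → G.Adj v w := by
    intro k
    induction k with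
    | zero => intro s h; simp [burst] at h
    | succ k ih =>
      intro s h
      by_cases hs : Settled Rv v s
      · rw [burst_settled hs] at h; simp at h
      · obtain ⟨h1, w', m', s', hp⟩ := exists_pick hs
        rw [burst_of_pick h1 hp] at h
        rcases List.mem_cons.1 h with h | h
        · cases h
          exact P.send_adj _ _ _ _ _ (Rv.pick_some _ _ _ _ _ hp)
        · exact ih s' h
  unfold drain at h
  split_ifs at h with hd
  · exact hb _ _ h
  · simp at h

theorem mem_toUser {v : Fin n} {m : Bit} {l : List (Fin n × Bit)} :
    m ∈ toUser v l ↔ (v, m) ∈ l := by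
  induction l with
  | nil => simp [toUser_nil]
  | cons p l ih =>
    obtain ⟨w, m'⟩ := p
    rw [toUser_cons]
    by_cases h : w = v
    · subst h; simp [ih]
    · have h' : ¬ v = w := fun e => h e.symm
      simp [h, h', ih]

theorem adj_of_toUser_drain {v w : Fin n} {s : S v} (h : toUser w (drain Rv v s).1 ≠ []) :
    G.Adj v w := by
  obtain ⟨m, hm⟩ := List.exists_mem_of_ne_nil _ h
  exact mem_drain_adj (mem_toUser.1 hm)

theorem st_mem_term_round (hD : Sc.Fits n D) (hX : g.SafeRound Sc adv ω R)
    (hs : Settled Rv v (g.st v)) (h : g.st v ∈ P.term v) :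
    (g.round Sc adv ω Rv R).st v ∈ P.term v := by
  change (g.react Sc adv ω Rv R v).2 ∈ _
  rw [react_of_received_nil hs (received_eq_nil_of_term hD hX h)]
  exact h

theorem bit_add_one_ne (b : Bit) : b + 1 ≠ b := by revert b; decide

/-- The correctness of the alternating bit protocol. If nothing is accepted, nothing moves. If Bob
accepts and Alice returns, the head leaves the queue and the parities differ again. If only Bob
accepts, the parities become equal, so the head no longer counts as pending. -/
theorem inv_round (hP : P.Terminates) (hD : Sc.Fits n D) (hX : g.SafeRound Sc adv ω R)
    (hI : g.Inv Rv cfg) {tr : List (Event n)} (hr : P.Run P.initConfig tr cfg) :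
    ∃ cfg', P.Run cfg (g.roundTrace Sc adv ω Rv R) cfg' ∧
      (g.round Sc adv ω Rv R).Inv Rv cfg' := by
  classical
  obtain ⟨hrun, hset⟩ := run_afterConfig hP hD hX hI hr (List.finRange n) (List.nodup_finRange n)
  refine ⟨_, hrun, ?_, ?_, ?_, ?_, ?_, ?_⟩
  · intro u
    simp only [afterConfig, List.mem_finRange, if_true]
    rfl
  · exact fun u => hset u (List.mem_finRange u)
  · intro u v h
    rw [round_queue] at h
    by_contra hadj
    have h1 : g.queue u v = [] := by
      by_contra hq; exact hadj (hI.adj u v hq)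
    have h2 : toUser v (g.react Sc adv ω Rv R u).1 = [] := by
      by_contra hq; exact hadj (adj_of_toUser_drain hq)
    simp [h1, h2] at h
  · intro u v hv
    have hv0 : g.st v ∉ P.term v := fun h => hv (st_mem_term_round hD hX (hI.settled v) h)
    have hc := hI.chan_eq u v hv0
    simp only [afterConfig, List.mem_finRange, if_true, true_and]
    unfold Global.pending at hc ⊢
    rw [round_queue, hc]
    change _ = if (if (g.exch Sc adv ω R u v).ReturnsFinally then g.par u v + 1 else g.par u v) =
      (match (g.exch Sc adv ω R u v).accepted with
        | some p => p.2
        | none => g.parHat u v) then _ else _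
    rcases hq : g.queue u v with _ | ⟨m, q⟩
    · obtain ⟨h1, h2, h3, -⟩ := exch_of_nil hD hX hq
      have hpar : g.par u v ≠ g.parHat u v := fun h => hI.unacked u v hv0 h hq
      simp [Global.recorded, h1, h2, h3, hpar]
    · have hadj := hI.adj u v (by rw [hq]; simp)
      obtain ⟨h1, h2, h3, -⟩ := exch_of_listening hD hX hq ⟨hadj, hv0⟩
      rcases h2 with h2 | h2
      · have h4 : ¬ (g.exch Sc adv ω R u v).ReturnsFinally := by
          intro h; rw [h3 h] at h2; cases h2
        rw [if_neg (h1.not.2 h4)]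
        simp only [Global.recorded, h2, h4, Option.bind_none, Option.isSome_none,
          Bool.false_eq_true, if_false]
        split_ifs <;> simp
      -- The message is recorded exactly if the parities differed before. If they agreed, it is a
      -- repetition, and the head was not in transit any more.
      · simp only [Global.recorded, h2, Option.bind_some, h1]
        by_cases h4 : (g.exch Sc adv ω R u v).ReturnsFinally
        · by_cases h5 : g.par u v = g.parHat u v <;>
            simp [h4, h5]
        · by_cases h5 : g.par u v = g.parHat u v <;>
            simp [h4, h5]
  · intro u v hv hpar
    have hv0 : g.st v ∉ P.term v := fun h => hv (st_mem_term_round hD hX (hI.settled v) h)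
    rw [round_queue]
    change (if (g.exch Sc adv ω R u v).ReturnsFinally then g.par u v + 1 else g.par u v) =
      (match (g.exch Sc adv ω R u v).accepted with
        | some p => p.2
        | none => g.parHat u v) at hpar
    rcases hq : g.queue u v with _ | ⟨m, q⟩
    · obtain ⟨h1, h2, h3, -⟩ := exch_of_nil hD hX hq
      simp only [h1, h3, if_false] at hpar
      exact absurd hq (hI.unacked u v hv0 hpar)
    · have hadj := hI.adj u v (by rw [hq]; simp)
      obtain ⟨h1, h2, h3, -⟩ := exch_of_listening hD hX hq ⟨hadj, hv0⟩
      by_cases h4 : (g.exch Sc adv ω R u v).ReturnsFinally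
      · simp only [h3 h4, h4, if_true] at hpar
        exact absurd hpar (bit_add_one_ne _)
      · rw [if_neg (h1.not.2 h4)]
        simp
  · intro u v
    have := hI.queue_le u v
    rw [sendCount_round_hist, round_queue, List.length_append]
    split_ifs
    · rw [List.length_tail]; omega
    · omega

theorem sendCount_hist_start : sendCount ((Global.start Rv).hist u) u v =
    ((Global.start Rv).queue u v).length :=
  sendCount_map_send _ _ _

theorem inv_start (hP : P.Terminates) : ∃ cfg, P.Run P.initConfig
      ((List.finRange n).flatMap (Global.start Rv).hist) cfg ∧ (Global.start Rv).Inv Rv cfg := by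
  have hrun : ∀ l : List (Fin n), l.Nodup → P.Run P.initConfig
      (l.flatMap (Global.start Rv).hist)
      ⟨fun a => if a ∈ l then (Global.start Rv).st a else P.init a,
        fun a b => if a ∈ l then (Global.start Rv).queue a b else []⟩ ∧
      ∀ v ∈ l, Settled Rv v ((Global.start Rv).st v) := by
    intro l hl
    induction l using List.reverseRecOn with
    | nil => exact ⟨.nil _, by simp⟩
    | append_singleton l v ih =>
      have hv : v ∉ l := by
        intro h
        have := (List.nodup_append.1 hl).2.2 v h v (by simp)
        exact this rfl
      obtain ⟨ih, ihs⟩ := ih (List.nodup_append.1 hl).1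
      obtain ⟨⟨k, hk⟩, hset⟩ := drain_spec (exists_settled (Rv := Rv) hP ih v)
      simp only [hv, if_false] at hk hset
      have hsend := run_sends (Rv := Rv) v k _ _
        (show (⟨fun a => if a ∈ l then (Global.start Rv).st a else P.init a,
          fun a b => if a ∈ l then (Global.start Rv).queue a b else []⟩ : Config S).st v =
            P.init v by simp [hv])
      rw [← hk] at hsend
      refine ⟨?_, ?_⟩
      swap
      · intro a ha
        rcases List.mem_append.1 ha with ha | ha
        · exact ihs a ha
        · rw [List.mem_singleton.1 ha]
          exact hset
      rw [List.flatMap_append, List.flatMap_singleton]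
      refine ih.append ?_
      convert hsend using 1
      · rfl
      refine Config.ext' (fun a => ?_) fun a b => ?_
      · by_cases ha : a = v
        · subst ha
          simp [Global.start]
        · simp [ha]
      · by_cases ha : a = v
        · subst ha
          simp [hv, Global.start]
        · simp [ha]
  obtain ⟨hr, hset⟩ := hrun (List.finRange n) (List.nodup_finRange n)
  refine ⟨_, hr, ?_, ?_, ?_, ?_, ?_, ?_⟩
  · intro u; simp
  · exact fun u => hset u (List.mem_finRange u)
  · intro u v h
    exact adj_of_toUser_drain h
  · intro u v _
    simp [Global.pending, Global.start]
  · intro u v _ h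
    simp [Global.start] at h
  · intro u v
    rw [sendCount_hist_start]

end Simulation

/-! ### Progress on a channel in a round -/

section Progress

variable {n : ℕ} {G : SimpleGraph (Fin n)} {S : Fin n → Type*} {P : Protocol G S}
  {Sc : Scheme} {adv : Adversary n} {ω : Coins n} {Rv : P.Resolver} {D : ℕ} {g : Global P}
  {R : ℕ} {u v : Fin n} {cfg : Config S}

/-- Number of messages that the sender of a channel is done with. -/
def Global.popped (g : Global P) (u v : Fin n) : ℕ :=
  sendCount (g.hist u) u v - (g.queue u v).length

theorem popped_add (hI : g.Inv Rv cfg) (u v : Fin n) :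
    g.popped u v + (g.queue u v).length = sendCount (g.hist u) u v :=
  Nat.sub_add_cancel (hI.queue_le u v)

open Classical in
theorem popped_round (hD : Sc.Fits n D) (hX : g.SafeRound Sc adv ω R) (hI : g.Inv Rv cfg)
    (u v : Fin n) : (g.round Sc adv ω Rv R).popped u v =
      g.popped u v + if (g.exch Sc adv ω R u v).Returns then 1 else 0 := by
  have h := hI.queue_le u v
  unfold Global.popped
  rw [sendCount_round_hist, round_queue, List.length_append]
  split_ifs with hr
  · have hq : g.queue u v ≠ [] := fun hq => (exch_of_nil hD hX hq).2.1 hr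
    have := List.length_pos_of_ne_nil hq
    rw [List.length_tail]
    omega
  · omega

/-- The charging principle behind all cost bounds, for listening and terminated receivers alike. -/
theorem returns_or_flips (hD : Sc.Fits n D) (hX : g.SafeRound Sc adv ω R)
    (hq : g.queue u v ≠ []) : (g.exch Sc adv ω R u v).Returns ∨
      Sc.wordLen n (R + 1) ≤ D * roundFlips Sc adv R (u, v) := by
  obtain ⟨m, q, hq⟩ := List.exists_cons_of_ne_nil hq
  by_cases hb : G.Adj u v ∧ g.st v ∉ P.term v
  · obtain ⟨h1, -, -, h4⟩ := exch_of_listening hD hX hq hb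
    rwa [h1]
  · exact (exch_of_not_listening hD hX hq hb).2.2

open Classical in
-- The bits of an exchange are paid for by the message it completes or else by the flips that spoil
-- it. This includes an idle channel on which Bob is provoked to answer.
theorem bitsSent_le_of_safe (hD : Sc.Fits n D) (hX : g.SafeRound Sc adv ω R) (u v : Fin n) :
    (g.exch Sc adv ω R u v).bitsSent ≤
      4 * Sc.wordLen n (R + 1) * (if (g.exch Sc adv ω R u v).Returns then 1 else 0) +
        4 * D * roundFlips Sc adv R (u, v) := by
  have h4 := bitsSent_le (g.exch Sc adv ω R u v)
  by_cases hq : g.queue u v = []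
  · obtain ⟨-, -, -, h | h⟩ := exch_of_nil hD hX hq
    · omega
    · refine h4.trans (le_add_left ?_)
      rw [mul_assoc]
      exact Nat.mul_le_mul_left 4 h
  · rcases returns_or_flips hD hX hq with h | h
    · rw [if_pos h]; omega
    · refine h4.trans (le_add_left ?_)
      rw [mul_assoc]
      exact Nat.mul_le_mul_left 4 h

/-! ### Flips in an interval of rounds -/

/-- Number of flips in the first `R` rounds on channels in `C`. -/
def flipsOn (Sc : Scheme) (adv : Adversary n) (C : Finset (Channel n)) (R : ℕ) : ℕ :=
  (adv.flips.filter fun x => x.2 ∈ C ∧ x.1 < Sc.roundStart n R).card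

theorem roundStart_succ (R : ℕ) :
    Sc.roundStart n (R + 1) = Sc.roundStart n R + 4 * Sc.wordLen n (R + 1) := by
  unfold Scheme.roundStart
  rw [Finset.sum_range_succ]
  ring

theorem flipsOn_succ (C : Finset (Channel n)) (R : ℕ) :
    flipsOn Sc adv C (R + 1) = flipsOn Sc adv C R + ∑ c ∈ C, roundFlips Sc adv R c := by
  classical
  have h1 : ∑ c ∈ C, roundFlips Sc adv R c = (adv.flips.filter fun x => x.2 ∈ C ∧
      Sc.roundStart n R ≤ x.1 ∧ x.1 < Sc.roundStart n R + 4 * Sc.wordLen n (R + 1)).card := by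
    rw [Finset.card_eq_sum_card_fiberwise (f := Prod.snd) (t := C)]
    · refine Finset.sum_congr rfl fun c hc => ?_
      unfold roundFlips flipCount
      rw [Finset.filter_filter]
      congr 1
      refine Finset.filter_congr fun x _ => ?_
      constructor
      · rintro ⟨rfl, h⟩; exact ⟨⟨hc, h⟩, rfl⟩
      · rintro ⟨⟨_, h⟩, rfl⟩; exact ⟨rfl, h⟩
    · intro x hx
      exact (Finset.mem_filter.1 hx).2.1
  rw [h1]
  unfold flipsOn
  rw [roundStart_succ, ← Finset.card_union_of_disjoint, ← Finset.filter_or]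
  · congr 1
    refine Finset.filter_congr fun x _ => ?_
    constructor
    · rintro ⟨h1, h2⟩
      by_cases h : x.1 < Sc.roundStart n R
      · exact .inl ⟨h1, h⟩
      · exact .inr ⟨h1, by omega, h2⟩
    · rintro (⟨h1, h2⟩ | ⟨h1, -, h2⟩)
      · exact ⟨h1, by omega⟩
      · exact ⟨h1, h2⟩
  · rw [Finset.disjoint_filter]
    rintro x - ⟨-, h1⟩ ⟨-, h2, -⟩
    omega

theorem flipsOn_mono {C C' : Finset (Channel n)} (h : C ⊆ C') (R : ℕ) :
    flipsOn Sc adv C R ≤ flipsOn Sc adv C' R := by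
  refine Finset.card_le_card (Finset.monotone_filter_right _ ?_)
  rintro x - ⟨h1, h2⟩
  exact ⟨h h1, h2⟩

theorem flipsOn_le_card (C : Finset (Channel n)) (R : ℕ) :
    flipsOn Sc adv C R ≤ adv.flips.card := Finset.card_filter_le _ _

theorem add_roundFlips_le {C : Finset (Channel n)} {c : Channel n} (hc : c ∈ C) (R : ℕ) :
    flipsOn Sc adv C R + roundFlips Sc adv R c ≤ flipsOn Sc adv C (R + 1) := by
  rw [flipsOn_succ]
  have := Finset.single_le_sum (f := roundFlips Sc adv R) (fun _ _ => Nat.zero_le _) hc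
  omega

theorem le_roundStart (hD : Sc.Fits n D) (R : ℕ) : R < Sc.roundStart n R := by
  induction R with
  | zero => simp [Scheme.roundStart]
  | succ R ih =>
    rw [roundStart_succ]
    have := hD.wordLen_pos (R + 1) (by omega)
    omega

theorem exists_no_more_flips (hD : Sc.Fits n D) (adv : Adversary n) :
    ∃ F, ∀ R ≥ F, ∀ c, roundFlips Sc adv R c = 0 := by
  classical
  refine ⟨adv.flips.sup Prod.fst, fun R hR c => ?_⟩
  unfold roundFlips flipCount
  rw [Finset.card_eq_zero, Finset.filter_eq_empty_iff]
  rintro x hx ⟨-, h, -⟩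
  have h1 := Finset.le_sup (f := Prod.fst) hx
  have h2 := le_roundStart hD R
  omega

end Progress

/-! ### Transcripts and the simulated run -/

section Trace

variable {n : ℕ} {G : SimpleGraph (Fin n)} {S : Fin n → Type*} {P : Protocol G S}
  (Sc : Scheme) (adv : Adversary n) (ω : Coins n) (Rv : P.Resolver)

/-- The asynchronous run simulated by the first `R` rounds of `π'`. -/
def simTrace : ℕ → List (Event n)
  | 0 => (List.finRange n).flatMap (Global.start Rv).hist
  | R + 1 => simTrace R ++ (execution Sc adv ω Rv R).roundTrace Sc adv ω Rv R

variable {Sc adv ω Rv} {D : ℕ} {R : ℕ} {u v : Fin n}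

theorem safeRound_of_not_fails (h : ¬ Fails Sc adv ω Rv) (R : ℕ) :
    (execution Sc adv ω Rv R).SafeRound Sc adv ω R :=
  fun u v hf => h ⟨R, u, v, hf⟩

theorem actor_of_mem_newEvents {g : Global P} {e : Event n}
    (h : e ∈ g.newEvents Sc adv ω Rv R v) : e.actor = v := by
  unfold Global.newEvents at h
  rcases List.mem_append.1 h with h | h <;> obtain ⟨p, -, rfl⟩ := List.mem_map.1 h <;> rfl

theorem actor_of_mem_start_hist {e : Event n} (h : e ∈ (Global.start Rv).hist v) :
    e.actor = v := by
  obtain ⟨p, -, rfl⟩ := List.mem_map.1 h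
  rfl

theorem filter_flatMap_actor (f : Fin n → List (Event n)) (hf : ∀ v, ∀ e ∈ f v, e.actor = v)
    (u : Fin n) : ((List.finRange n).flatMap f).filter (fun e => e.actor = u) = f u := by
  have h : ∀ l : List (Fin n), l.Nodup → (l.flatMap f).filter (fun e => e.actor = u) =
      if u ∈ l then f u else [] := by
    intro l hl
    induction l with
    | nil => rfl
    | cons v l ih =>
      rw [List.nodup_cons] at hl
      rw [List.flatMap_cons, List.filter_append, ih hl.2]
      by_cases huv : v = u
      · subst huv
        rw [List.filter_eq_self.2 (by simpa using hf v)]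
        simp [hl.1]
      · rw [List.filter_eq_nil_iff.2 (by
          intro e he
          rw [hf v e he]
          simpa using huv)]
        have : u ≠ v := fun h => huv h.symm
        simp [this]
  rw [h _ (List.nodup_finRange n), if_pos (List.mem_finRange u)]

theorem hist_eq_filter (R : ℕ) (u : Fin n) : (execution Sc adv ω Rv R).hist u =
    (simTrace Sc adv ω Rv R).filter fun e => e.actor = u := by
  induction R with
  | zero =>
    exact (filter_flatMap_actor _ (fun v e => actor_of_mem_start_hist) u).symm
  | succ R ih =>
    rw [simTrace, List.filter_append, ← ih, Global.roundTrace,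
      filter_flatMap_actor _ (fun v e => actor_of_mem_newEvents) u]
    exact round_hist _ _ _

theorem actor_of_isSendOn {e : Event n} (h : e.IsSendOn u v) : e.actor = u := by
  cases e with
  | send a b m => exact h.1
  | recv a b m => exact h.elim

theorem sendCount_hist (R : ℕ) (u v : Fin n) :
    sendCount ((execution Sc adv ω Rv R).hist u) u v = sendCount (simTrace Sc adv ω Rv R) u v := by
  rw [hist_eq_filter]
  unfold sendCount
  rw [List.countP_filter]
  refine List.countP_congr fun e _ => ?_
  simp only [Bool.and_eq_true, decide_eq_true_eq]
  exact ⟨fun h => h.1, fun h => ⟨h, actor_of_isSendOn h⟩⟩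

open Classical in
theorem sum_sendCount_le (tr : List (Event n)) : ∑ u, ∑ v, sendCount tr u v ≤ totalBits tr := by
  induction tr with
  | nil => simp [sendCount]
  | cons e tr ih =>
    cases e with
    | send a b m =>
      have h : totalBits (.send a b m :: tr) = totalBits tr + 1 :=
        List.countP_cons_of_pos (decide_eq_true (p := Event.IsSend (.send a b m)) trivial)
      rw [h]
      simp only [sendCount_cons_send, Finset.sum_add_distrib]
      have : ∑ u, ∑ v, (if a = u ∧ b = v then 1 else 0) = 1 := by
        simp [ite_and]
      omega
    | recv a b m =>
      have h : totalBits (.recv a b m :: tr) = totalBits tr :=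
        List.countP_cons_of_neg fun h => of_decide_eq_true (p := Event.IsSend (.recv a b m)) h
      rw [h]
      simpa only [sendCount_cons_recv] using ih

/-- The configurations are chosen by recursion on rounds, so that consecutive ones are joined by the
trace of a round. They thus form one infinite run. -/
theorem exists_configs (hP : P.Terminates) (hD : Sc.Fits n D) (hF : ¬ Fails Sc adv ω Rv) :
    ∃ c : ℕ → Config S, ∀ R, P.Run P.initConfig (simTrace Sc adv ω Rv R) (c R) ∧
      (execution Sc adv ω Rv R).Inv Rv (c R) ∧
      P.Run (c R) ((execution Sc adv ω Rv R).roundTrace Sc adv ω Rv R) (c (R + 1)) := by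
  have hstep : ∀ (R : ℕ) (cfg : {cfg : Config S // P.Run P.initConfig (simTrace Sc adv ω Rv R) cfg ∧
      (execution Sc adv ω Rv R).Inv Rv cfg}),
      ∃ cfg' : {cfg : Config S // P.Run P.initConfig (simTrace Sc adv ω Rv (R + 1)) cfg ∧
        (execution Sc adv ω Rv (R + 1)).Inv Rv cfg},
        P.Run cfg.1 ((execution Sc adv ω Rv R).roundTrace Sc adv ω Rv R) cfg'.1 := by
    rintro R ⟨cfg, hr, hI⟩
    obtain ⟨cfg', h1, h2⟩ := inv_round hP hD (safeRound_of_not_fails hF R) hI hr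
    exact ⟨⟨cfg', hr.append h1, h2⟩, h1⟩
  choose f hf using hstep
  obtain ⟨c₀, h₀⟩ := inv_start (Rv := Rv) hP
  set c : ∀ R, {cfg : Config S // P.Run P.initConfig (simTrace Sc adv ω Rv R) cfg ∧
      (execution Sc adv ω Rv R).Inv Rv cfg} := fun R => Nat.rec ⟨c₀, h₀⟩ f R
  exact ⟨fun R => (c R).1, fun R => ⟨(c R).2.1, (c R).2.2, hf R (c R)⟩⟩

theorem not_sendEnabled {g : Global P} {cfg : Config S} (hI : g.Inv Rv cfg) (u : Fin n) :
    ¬ P.SendEnabled cfg u := by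
  rintro ⟨h1, w, m, s', h2⟩
  rw [hI.st_eq] at h1 h2
  rcases hI.settled u with h | h
  · exact h1 h
  · exact Rv.pick_none _ _ h _ _ _ h2

/-- If all queues were empty, nothing would be in transit to a listening user and nobody could send,
so by absence of deadlock everybody would have terminated. -/
theorem exists_queue_of_not_stopped (hP : P.Terminates) {g : Global P} {cfg : Config S}
    (hI : g.Inv Rv cfg) {tr : List (Event n)} (hr : P.Run P.initConfig tr cfg)
    (hs : ¬ g.Stopped) : ∃ u v, g.queue u v ≠ [] := by
  by_contra! hq
  refine hs fun u => ⟨?_, hq u⟩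
  rw [← hI.st_eq]
  refine hP.no_deadlock tr cfg hr (not_sendEnabled hI) (fun u v hv => ?_) u
  rw [hI.st_eq] at hv
  rw [hI.chan_eq u v hv, Global.pending, hq u v]
  simp

/-- Number of messages that have been dealt with in the first `R` rounds. -/
def totalPopped (g : Global P) : ℕ := ∑ u, ∑ v, g.popped u v

theorem totalPopped_le : totalPopped (execution Sc adv ω Rv R) ≤
    totalBits (simTrace Sc adv ω Rv R) := by
  refine le_trans (Finset.sum_le_sum fun u _ => Finset.sum_le_sum fun v _ => ?_)
    (sum_sendCount_le _)
  rw [← sendCount_hist]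
  exact Nat.sub_le _ _

theorem popped_le_round {g : Global P} {cfg : Config S} (hD : Sc.Fits n D)
    (hX : g.SafeRound Sc adv ω R) (hI : g.Inv Rv cfg) (u v : Fin n) :
    g.popped u v ≤ (g.round Sc adv ω Rv R).popped u v := by
  rw [popped_round hD hX hI]
  exact Nat.le_add_right _ _

/-- The number of completed messages plus the number of past flips grows in every round before the
users stop. -/
theorem rounds_le (hP : P.Terminates) (hD : Sc.Fits n D) (hF : ¬ Fails Sc adv ω Rv) (R : ℕ)
    (h : ∀ r < R, ¬ (execution Sc adv ω Rv r).Stopped) :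
    R ≤ totalPopped (execution Sc adv ω Rv R) + flipsOn Sc adv Finset.univ R := by
  obtain ⟨c, hc⟩ := exists_configs hP hD hF
  induction R with
  | zero => exact Nat.zero_le _
  | succ R ih =>
    have ih := ih fun r hr => h r (by omega)
    obtain ⟨hr, hI, -⟩ := hc R
    have hX := safeRound_of_not_fails hF R
    obtain ⟨u, v, hq⟩ := exists_queue_of_not_stopped hP hI hr (h R (by omega))
    have hmono := popped_le_round hD hX hI
    have hf := add_roundFlips_le (Sc := Sc) (adv := adv) (Finset.mem_univ (u, v)) R
    rw [execution]
    rcases returns_or_flips hD hX hq with h1 | h1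
    · have : totalPopped (execution Sc adv ω Rv R) <
          totalPopped ((execution Sc adv ω Rv R).round Sc adv ω Rv R) := by
        refine Finset.sum_lt_sum (fun a _ => Finset.sum_le_sum fun b _ => hmono a b)
          ⟨u, Finset.mem_univ _, Finset.sum_lt_sum (fun b _ => hmono u b)
            ⟨v, Finset.mem_univ _, ?_⟩⟩
        rw [popped_round hD hX hI, if_pos h1]
        omega
      omega
    · have : totalPopped (execution Sc adv ω Rv R) ≤
          totalPopped ((execution Sc adv ω Rv R).round Sc adv ω Rv R) :=
        Finset.sum_le_sum fun a _ => Finset.sum_le_sum fun b _ => hmono a b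
      have hw := hD.wordLen_pos (R + 1) (by omega)
      have : 0 < roundFlips Sc adv R (u, v) := by
        rcases Nat.eq_zero_or_pos (roundFlips Sc adv R (u, v)) with h0 | h0
        · rw [h0] at h1; omega
        · exact h0
      omega

theorem bits_le (hP : P.Terminates) (hD : Sc.Fits n D) (hF : ¬ Fails Sc adv ω Rv) (R W : ℕ)
    (hW : ∀ r < R, Sc.wordLen n (r + 1) ≤ W) :
    (execution Sc adv ω Rv R).bits ≤
      4 * W * totalPopped (execution Sc adv ω Rv R) + 4 * D * flipsOn Sc adv Finset.univ R := by
  classical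
  obtain ⟨c, hc⟩ := exists_configs hP hD hF
  induction R with
  | zero => exact Nat.zero_le _
  | succ R ih =>
    have ih := ih fun r hr => hW r (by omega)
    have hX := safeRound_of_not_fails hF R
    have h1 : ∑ u, ∑ v, ((execution Sc adv ω Rv R).exch Sc adv ω R u v).bitsSent ≤
        4 * W * (∑ u, ∑ v, if ((execution Sc adv ω Rv R).exch Sc adv ω R u v).Returns then 1
          else 0) + 4 * D * ∑ u, ∑ v, roundFlips Sc adv R (u, v) := by
      simp only [Finset.mul_sum, ← Finset.sum_add_distrib]
      refine Finset.sum_le_sum fun u _ => Finset.sum_le_sum fun v _ => ?_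
      refine (bitsSent_le_of_safe hD hX u v).trans (Nat.add_le_add_right ?_ _)
      exact Nat.mul_le_mul_right _ (Nat.mul_le_mul_left _ (hW R (by omega)))
    have h2 : totalPopped (execution Sc adv ω Rv (R + 1)) =
        totalPopped (execution Sc adv ω Rv R) + ∑ u, ∑ v,
          if ((execution Sc adv ω Rv R).exch Sc adv ω R u v).Returns then 1 else 0 := by
      simp only [totalPopped, execution, popped_round hD hX (hc R).2.1, Finset.sum_add_distrib]
    have h3 : flipsOn Sc adv Finset.univ (R + 1) =
        flipsOn Sc adv Finset.univ R + ∑ u, ∑ v, roundFlips Sc adv R (u, v) := by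
      rw [flipsOn_succ, Fintype.sum_prod_type]
    have h4 : (execution Sc adv ω Rv (R + 1)).bits = (execution Sc adv ω Rv R).bits +
      ∑ u, ∑ v, ((execution Sc adv ω Rv R).exch Sc adv ω R u v).bitsSent := rfl
    rw [h2, h3, h4, mul_add, mul_add]
    omega

end Trace

/-! ### Termination -/

section Termination

variable {n : ℕ} {G : SimpleGraph (Fin n)} {S : Fin n → Type*} {P : Protocol G S}
  {Sc : Scheme} {adv : Adversary n} {ω : Coins n} {Rv : P.Resolver} {D : ℕ} {R : ℕ} {u v : Fin n}

theorem roundTrace_of_recorded {g : Global P} {m : Bit}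
    (h : g.recorded Sc adv ω R u v = some m) :
    Event.recv u v m ∈ g.newEvents Sc adv ω Rv R v := by
  unfold Global.newEvents
  refine List.mem_append_left _ (List.mem_map.2 ⟨(u, m), mem_received.2 h, rfl⟩)

theorem mem_term_mono (hP : P.Terminates) (hD : Sc.Fits n D) (hF : ¬ Fails Sc adv ω Rv)
    {R R' : ℕ} (h : R ≤ R') (ht : (execution Sc adv ω Rv R).st v ∈ P.term v) :
    (execution Sc adv ω Rv R').st v ∈ P.term v := by
  obtain ⟨c, hc⟩ := exists_configs hP hD hF
  induction R', h using Nat.le_induction with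
  | base => exact ht
  | succ R' _ ih =>
    exact st_mem_term_round hD (safeRound_of_not_fails hF R') ((hc R').2.1.settled v) ih

/-- If no bits are flipped any more, a message in transit to a user who does not terminate is
recorded within two rounds. -/
theorem exists_recorded {c : ℕ → Config S} (hD : Sc.Fits n D) (hF : ¬ Fails Sc adv ω Rv)
    (hI : ∀ R, (execution Sc adv ω Rv R).Inv Rv (c R))
    (hfl : ∀ R' ≥ R, roundFlips Sc adv R' (u, v) = 0)
    (hst : ∀ R' ≥ R, (execution Sc adv ω Rv R').st v ∉ P.term v)
    (hch : ∀ R' ≥ R, (c R').chan u v ≠ []) :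
    ∃ R' ≥ R, ∃ m, (execution Sc adv ω Rv R').recorded Sc adv ω R' u v = some m := by
  classical
  have key : ∀ R' ≥ R, ∃ m,
      ((execution Sc adv ω Rv R').exch Sc adv ω R' u v).ReturnsFinally ∧
      ((execution Sc adv ω Rv R').exch Sc adv ω R' u v).accepted =
        some (m, (execution Sc adv ω Rv R').par u v) := by
    intro R' hR'
    have hq : (execution Sc adv ω Rv R').queue u v ≠ [] := by
      intro hq
      refine hch R' hR' ?_
      rw [(hI R').chan_eq u v (hst R' hR'), Global.pending, hq]
      simp
    obtain ⟨m, q, hq'⟩ := List.exists_cons_of_ne_nil hq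
    obtain ⟨-, -, h3, h4⟩ := exch_of_listening hD (safeRound_of_not_fails hF R') hq'
      ⟨(hI R').adj u v hq, hst R' hR'⟩
    rw [hfl R' hR'] at h4
    have hw := hD.wordLen_pos (R' + 1) (by omega)
    have h5 := h4.resolve_right (by omega)
    exact ⟨m, h5, h3 h5⟩
  -- From now on each round has acceptance and return. If nothing is ever recorded the parities
  -- always agree, but a return changes Alice's bit while Bob keeps the accepted one.
  by_contra! hno
  have hpar : ∀ R' ≥ R, (execution Sc adv ω Rv R').par u v =
      (execution Sc adv ω Rv R').parHat u v := by
    intro R' hR'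
    by_contra hne
    obtain ⟨m, -, h2⟩ := key R' hR'
    refine hno R' hR' m ?_
    simp [Global.recorded, h2, hne]
  obtain ⟨m, h1, h2⟩ := key R le_rfl
  have h3 := hpar (R + 1) (by omega)
  change (if ((execution Sc adv ω Rv R).exch Sc adv ω R u v).ReturnsFinally
      then (execution Sc adv ω Rv R).par u v + 1 else (execution Sc adv ω Rv R).par u v) =
    (match ((execution Sc adv ω Rv R).exch Sc adv ω R u v).accepted with
      | some p => p.2
      | none => (execution Sc adv ω Rv R).parHat u v) at h3
  simp only [h1, h2, if_true] at h3
  exact bit_add_one_ne _ h3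

/-- Otherwise the simulated run is infinite and fair, against the assumption on `π`. It is infinite
because a bounded number of messages and flips allows only boundedly many rounds. It is fair to
senders as all states are settled between rounds, and to receivers because after the last flip
messages get through. -/
theorem exists_stopped (hP : P.Terminates) (hD : Sc.Fits n D) (hF : ¬ Fails Sc adv ω Rv) :
    ∃ R, (execution Sc adv ω Rv R).Stopped := by
  by_contra! hns
  obtain ⟨c, hc⟩ := exists_configs hP hD hF
  obtain ⟨F, hFl⟩ := exists_no_more_flips hD adv
  -- Index `0` is the initial configuration, and index `i + 1` the one after `i` rounds; the first
  -- segment consists of the sends before round 1.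
  refine hP.no_infinite (fun | 0 => P.initConfig | i + 1 => c i)
    (fun | 0 => simTrace Sc adv ω Rv 0
         | i + 1 => (execution Sc adv ω Rv i).roundTrace Sc adv ω Rv i) ⟨rfl, ?_, ?_, ?_, ?_⟩
  · rintro (_ | i)
    · exact (hc 0).1
    · exact (hc i).2.2
  · intro i
    by_contra! hno
    have hconst : ∀ R ≥ i, simTrace Sc adv ω Rv R = simTrace Sc adv ω Rv i := by
      intro R hR
      induction R, hR using Nat.le_induction with
      | base => rfl
      | succ R hR ih =>
        have := hno (R + 1) (by omega)
        simp only at this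
        rw [simTrace, ih, this, List.append_nil]
    -- If no event occurs from `i` on, `N` exceeds the bound of `rounds_le` on the number of rounds.
    obtain ⟨N, hN⟩ : ∃ N, N = i + (totalBits (simTrace Sc adv ω Rv i) + adv.flips.card) + 1 :=
      ⟨_, rfl⟩
    have hR := rounds_le hP hD hF N fun r _ => hns r
    have h1 := totalPopped_le (Sc := Sc) (adv := adv) (ω := ω) (Rv := Rv) (R := N)
    rw [hconst N (by omega)] at h1
    have h2 := flipsOn_le_card (Sc := Sc) (adv := adv) Finset.univ N
    omega
  · intro i u
    exact ⟨i + 1, by omega, .inr (not_sendEnabled (hc i).2.1 u)⟩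
  · intro i u v
    by_contra! hno
    have hst : ∀ R ≥ i, (execution Sc adv ω Rv R).st v ∉ P.term v := by
      intro R hR ht
      obtain ⟨-, -, k, hk, hk'⟩ := hno (R + 1) (by omega)
      obtain ⟨k, rfl⟩ : ∃ k', k = k' + 1 := ⟨k - 1, by omega⟩
      refine hk' ?_
      simp only
      rw [(hc k).2.1.st_eq]
      exact mem_term_mono hP hD hF (by omega) ht
    obtain ⟨R', hR', m, hm⟩ := exists_recorded (R := max i F) (u := u) (v := v) hD hF
      (fun R => (hc R).2.1) (fun R' hR' => hFl R' (le_trans (le_max_right _ _) hR') _)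
      (fun R' hR' => hst R' (le_trans (le_max_left _ _) hR'))
      (fun R' hR' => (hno (R' + 1) (by have := le_trans (le_max_left i F) hR'; omega)).2.1)
    have hi : i ≤ R' := le_trans (le_max_left _ _) hR'
    refine (hno (R' + 1) (by omega)).1 (.recv u v m) ?_ ⟨rfl, rfl⟩
    simp only
    exact List.mem_flatMap.2 ⟨v, List.mem_finRange v, roundTrace_of_recorded hm⟩

end Termination

/-! ### Communication paths -/

section Paths

variable {n : ℕ} {G : SimpleGraph (Fin n)} {S : Fin n → Type*} {P : Protocol G S}
  {Sc : Scheme} {adv : Adversary n} {ω : Coins n} {Rv : P.Resolver} {D : ℕ} {R : ℕ} {u v : Fin n}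

theorem Follows.append {tr t : List (Event n)} {a b : MsgId n} (h : Follows tr a b) :
    Follows (tr ++ t) a b := by
  rcases h with h | ⟨h, t₁, t₂, rfl, h1, h2⟩
  · exact .inl h
  · exact .inr ⟨h, t₁, t₂ ++ t, by rw [List.append_assoc], h1, h2⟩

theorem IsCommPath.append {tr t : List (Event n)} {p : List (MsgId n)} (h : IsCommPath tr p) :
    IsCommPath (tr ++ t) p := by
  refine ⟨h.1.imp fun _ _ h => h.append, fun a ha => (h.2 a ha).trans_le ?_⟩
  rw [sendCount_append]
  exact Nat.le_add_right _ _

theorem IsCommPath.snoc {tr : List (Event n)} {p : List (MsgId n)} {a b : MsgId n}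
    (h : IsCommPath tr (p ++ [a])) (hab : Follows tr a b)
    (hb : b.2 < sendCount tr b.1.1 b.1.2) : IsCommPath tr (p ++ [a] ++ [b]) := by
  refine ⟨List.isChain_append.2 ⟨h.1, List.isChain_singleton _, ?_⟩, ?_⟩
  · intro x hx y hy
    simp at hx hy
    subst hx hy
    exact hab
  · intro x hx
    rcases List.mem_append.1 hx with hx | hx
    · exact h.2 x hx
    · rw [List.mem_singleton.1 hx]
      exact hb

/-- The channels used by a path. -/
def pathChannels (p : List (MsgId n)) : Finset (Channel n) := (p.map Prod.fst).toFinset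

theorem pathChannels_subset_append (p q : List (MsgId n)) :
    pathChannels p ⊆ pathChannels (p ++ q) := by
  intro c hc
  simp only [pathChannels, List.mem_toFinset, List.map_append, List.mem_append] at hc ⊢
  exact .inl hc

theorem mem_pathChannels_snoc (p : List (MsgId n)) (a : MsgId n) :
    a.1 ∈ pathChannels (p ++ [a]) := by
  simp [pathChannels]

theorem flipsOn_pathChannels_le (p : List (MsgId n)) (R : ℕ) :
    flipsOn Sc adv (pathChannels p) R ≤ flipsOnPath adv p := by
  unfold flipsOn flipsOnPath
  rw [← Set.ncard_coe_finset]
  refine Set.ncard_le_ncard ?_ (adv.flips.finite_toSet.subset fun x hx => hx.1)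
  intro x hx
  have hx := Finset.mem_filter.1 (Finset.mem_coe.1 hx)
  obtain ⟨a, ha, hax⟩ := List.mem_map.1 (List.mem_toFinset.1 hx.2.1)
  exact ⟨hx.1, a, ha, hax⟩

theorem elapsed_succ (R : ℕ) :
    elapsed Sc n (R + 1) = elapsed Sc n R + 4 * Sc.wordLen n (R + 1) := by
  have : 1 ≤ Sc.roundStart n R := Nat.le_add_right _ _
  unfold elapsed
  rw [roundStart_succ]
  omega

/-- When the parities differ, the whole queue is in transit. Then the next message to be received is
the one that Alice is sending, so both counters give its number. -/
theorem recvCount_of_par_ne {cfg : Config S}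
    (hr : P.Run P.initConfig (simTrace Sc adv ω Rv R) cfg)
    (hI : (execution Sc adv ω Rv R).Inv Rv cfg)
    (hv : (execution Sc adv ω Rv R).st v ∉ P.term v)
    (hne : (execution Sc adv ω Rv R).par u v ≠ (execution Sc adv ω Rv R).parHat u v) :
    recvCount (simTrace Sc adv ω Rv R) u v = (execution Sc adv ω Rv R).popped u v := by
  have h1 := run_counts hr u v
  have h2 := popped_add hI u v
  rw [hI.chan_eq u v hv, Global.pending, if_neg hne, ← sendCount_hist] at h1
  simp only [Protocol.initConfig, List.length_nil] at h1
  omega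

/-- A message that is scheduled in a round after which it is the first one of its queue follows a
message recorded in this round. -/
theorem follows_of_recorded {cfg : Config S} {w : Fin n} {m : Bit} (hD : Sc.Fits n D)
    (hF : ¬ Fails Sc adv ω Rv) (hr : P.Run P.initConfig (simTrace Sc adv ω Rv R) cfg)
    (hI : (execution Sc adv ω Rv R).Inv Rv cfg)
    (hm : (execution Sc adv ω Rv R).recorded Sc adv ω R w u = some m) :
    Follows (simTrace Sc adv ω Rv (R + 1)) ((w, u), (execution Sc adv ω Rv R).popped w u)
      ((u, v), sendCount (simTrace Sc adv ω Rv R) u v) := by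
  classical
  obtain ⟨-, h1, h2, -, -⟩ := recorded_eq_some hD (safeRound_of_not_fails hF R) hm
  obtain ⟨pre, post, hsplit⟩ := List.append_of_mem (List.mem_finRange u)
  have hnd := List.nodup_finRange n
  rw [hsplit] at hnd
  have hu : u ∉ pre := fun h => (List.nodup_append.1 hnd).2.2 u h u (by simp) rfl
  set g := execution Sc adv ω Rv R with hg
  -- The trace is cut between the receptions and the sends of `u` in this round. Users listed
  -- earlier send nothing on behalf of `u`, so no new message of `u` precedes the cut.
  refine .inr ⟨rfl, simTrace Sc adv ω Rv R ++ (pre.flatMap (g.newEvents Sc adv ω Rv R) ++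
      (g.received Sc adv ω R u).map fun p => .recv p.1 u p.2),
    ((g.react Sc adv ω Rv R u).1.map fun p => .send u p.1 p.2) ++
      post.flatMap (g.newEvents Sc adv ω Rv R), ?_, ?_, ?_⟩
  · rw [simTrace, Global.roundTrace, hsplit, List.flatMap_append, List.flatMap_cons]
    simp only [Global.newEvents, List.append_assoc, ← hg]
  · simp only
    rw [recvCount_append, recvCount_append, recvCount_of_par_ne hr hI h1 h2, ← hg]
    have : 0 < recvCount ((g.received Sc adv ω R u).map fun p => .recv p.1 u p.2) w u := by
      unfold recvCount
      rw [List.countP_pos_iff]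
      refine ⟨.recv w u m, List.mem_map.2 ⟨(w, m), mem_received.2 hm, rfl⟩, ?_⟩
      rw [decide_eq_true_eq]
      exact ⟨rfl, rfl⟩
    omega
  · simp only
    rw [sendCount_append, sendCount_append, sendCount_map_recv]
    have : sendCount (pre.flatMap (g.newEvents Sc adv ω Rv R)) u v = 0 := by
      unfold sendCount
      rw [List.countP_eq_zero]
      intro e he
      obtain ⟨a, ha, he⟩ := List.mem_flatMap.1 he
      rw [decide_eq_true_eq]
      intro hs
      rw [← actor_of_isSendOn hs, actor_of_mem_newEvents he] at hu
      exact hu ha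
    omega

/-- Critical path argument: for every pending head of a queue, some path ending in it accounts for
the time elapsed. The last message is not counted in `p.length`, since only its predecessors have
used a successful round. -/
theorem exists_path (hP : P.Terminates) (hD : Sc.Fits n D) (hF : ¬ Fails Sc adv ω Rv) (R W : ℕ)
    (hW : ∀ r < R, Sc.wordLen n (r + 1) ≤ W) (u v : Fin n)
    (hq : (execution Sc adv ω Rv R).queue u v ≠ []) :
    ∃ p : List (MsgId n),
      IsCommPath (simTrace Sc adv ω Rv R) (p ++ [((u, v), (execution Sc adv ω Rv R).popped u v)]) ∧
      elapsed Sc n R ≤ 4 * W * p.length + 4 * D * flipsOn Sc adv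
        (pathChannels (p ++ [((u, v), (execution Sc adv ω Rv R).popped u v)])) R := by
  obtain ⟨c, hc⟩ := exists_configs hP hD hF
  have hlt : ∀ R u v, (execution Sc adv ω Rv R).queue u v ≠ [] →
      (execution Sc adv ω Rv R).popped u v < sendCount (simTrace Sc adv ω Rv R) u v := by
    intro R u v hq
    have h1 := popped_add (hc R).2.1 u v
    have h2 := List.length_pos_of_ne_nil hq
    rw [← sendCount_hist]
    omega
  induction R generalizing u v with
  | zero =>
    refine ⟨[], ⟨List.isChain_singleton _, ?_⟩, ?_⟩
    · intro a ha
      rw [List.nil_append, List.mem_singleton] at ha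
      subst ha
      exact hlt 0 u v hq
    · simp [elapsed, Scheme.roundStart]
  | succ R ih =>
    have ih := ih fun r hr => hW r (by omega)
    have hX := safeRound_of_not_fails hF R
    obtain ⟨hr, hI, -⟩ := hc R
    have hwW := hW R (by omega)
    have hel := elapsed_succ (Sc := Sc) (n := n) R
    have hpop := popped_round (Rv := Rv) hD hX hI u v
    change (execution Sc adv ω Rv (R + 1)).popped u v = _ at hpop
    have extend : ∀ (a : MsgId n) (p : List (MsgId n)),
        IsCommPath (simTrace Sc adv ω Rv R) (p ++ [a]) →
        elapsed Sc n R ≤ 4 * W * p.length +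
          4 * D * flipsOn Sc adv (pathChannels (p ++ [a])) R →
        Follows (simTrace Sc adv ω Rv (R + 1)) a
          ((u, v), (execution Sc adv ω Rv (R + 1)).popped u v) →
        ∃ p : List (MsgId n), IsCommPath (simTrace Sc adv ω Rv (R + 1))
          (p ++ [((u, v), (execution Sc adv ω Rv (R + 1)).popped u v)]) ∧
          elapsed Sc n (R + 1) ≤ 4 * W * p.length + 4 * D * flipsOn Sc adv
            (pathChannels (p ++ [((u, v), (execution Sc adv ω Rv (R + 1)).popped u v)]))
            (R + 1) := by
      intro a p h1 h2 h3
      refine ⟨p ++ [a], h1.append.snoc h3 (hlt (R + 1) u v hq), ?_⟩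
      have h4 : flipsOn Sc adv (pathChannels (p ++ [a])) R ≤ flipsOn Sc adv (pathChannels
          (p ++ [a] ++ [((u, v), (execution Sc adv ω Rv (R + 1)).popped u v)])) (R + 1) := by
        refine (flipsOn_mono (pathChannels_subset_append _
        [((u, v), (execution Sc adv ω Rv (R + 1)).popped u v)]) R).trans ?_
        rw [flipsOn_succ]
        exact Nat.le_add_right _ _
      have h5 := Nat.mul_le_mul_left (4 * D) h4
      rw [hel, List.length_append, List.length_singleton, mul_add]
      omega
    -- The queue was empty: its first new message is a reaction to a message recorded by `u` in this
    -- round, which was the head of another queue.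
    by_cases hq0 : (execution Sc adv ω Rv R).queue u v = []
    · have hnr := (exch_of_nil hD hX hq0).2.1
      rw [if_neg hnr, add_zero] at hpop
      have hrec : (execution Sc adv ω Rv R).received Sc adv ω R u ≠ [] := by
        intro hrec
        refine hq ?_
        change ((execution Sc adv ω Rv R).round Sc adv ω Rv R).queue u v = []
        rw [round_queue, react_of_received_nil (hI.settled u) hrec, if_neg hnr, hq0]
        rfl
      obtain ⟨⟨w, m⟩, hwm⟩ := List.exists_mem_of_ne_nil _ hrec
      have hm := mem_received.1 hwm
      simp only at hm
      obtain ⟨-, -, -, -, q, hqw⟩ := recorded_eq_some hD hX hm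
      obtain ⟨p, hp1, hp2⟩ := ih w u (by rw [hqw]; simp)
      refine extend _ p hp1 hp2 ?_
      have h6 := popped_add hI u v
      rw [hq0, List.length_nil, add_zero, sendCount_hist] at h6
      rw [hpop, h6]
      exact follows_of_recorded hD hF hr hI hm
    · obtain ⟨p, hp1, hp2⟩ := ih u v hq0
      -- If the old head is done with, the new one is next on the same channel. Otherwise the head
      -- is unchanged and the flips on its channel pay for the round.
      by_cases hret : ((execution Sc adv ω Rv R).exch Sc adv ω R u v).Returns
      · rw [if_pos hret] at hpop
        exact extend _ p hp1 hp2 (.inl ⟨rfl, hpop⟩)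
      · rw [if_neg hret, add_zero] at hpop
        have hfl := (returns_or_flips hD hX hq0).resolve_left hret
        rw [hpop]
        refine ⟨p, hp1.append, ?_⟩
        have h4 := add_roundFlips_le (Sc := Sc) (adv := adv)
          (mem_pathChannels_snoc p ((u, v), (execution Sc adv ω Rv R).popped u v)) R
        have h5 := Nat.mul_le_mul_left (4 * D) h4
        rw [mul_add, mul_assoc 4 D (roundFlips _ _ _ _)] at h5
        simp only at h5
        rw [hel]
        omega

end Paths

/-! ### Costs -/

section Bounds

theorem wordLen_le_log {n : ℕ} {δ : ℝ} (hn : 2 ≤ n) (h0 : 0 < δ) (h1 : δ < 1) {R N : ℕ}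
    (hR : 1 ≤ R) (hRN : R ≤ N) :
    ((concreteScheme δ).wordLen n R : ℝ) ≤ 7000 * Real.log (n * N / δ) := by
  have hratio := two_lt_ratio hn hR h0 h1
  have hmono : (n * R / δ : ℝ) ≤ n * N / δ := by
    gcongr
  have hl2 := Real.log_two_gt_d9
  have hlog : Real.log 2 ≤ Real.log (n * R / δ) := Real.log_le_log (by norm_num) hratio.le
  have hlog' : Real.log (n * R / δ) ≤ Real.log (n * N / δ) :=
    Real.log_le_log (by linarith) hmono
  have hb : Real.logb 2 (n * R / δ) ≤ Real.log (n * R / δ) * 1.4427 := by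
    rw [Real.logb, div_eq_mul_inv]
    refine mul_le_mul_of_nonneg_left ?_ (by linarith)
    rw [inv_le_comm₀ (by linarith) (by norm_num)]
    norm_num
    linarith
  have hc : (logLen n R δ : ℝ) < Real.logb 2 (n * R / δ) + 1 :=
    Nat.ceil_lt_add_one (Real.logb_nonneg (by norm_num) (by linarith))
  rw [wordLen_concrete]
  push_cast
  -- Here `2400 (1.4427 + 1 / log 2) < 7000`: the rounding in the word length is absorbed by `log 2
  -- ≤ log (n R / δ)`.
  linarith

/-- Replacing `L` by `L + T` in the logarithm costs at most `T`. -/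
theorem mul_log_add_le {a : ℝ} (ha : 0 < a) {L T : ℕ} (hL : 1 ≤ L) :
    (L : ℝ) * Real.log (a * (L + T)) ≤ L * Real.log (a * L) + T := by
  have hL' : (1 : ℝ) ≤ L := by exact_mod_cast hL
  have hT : (0 : ℝ) ≤ T := T.cast_nonneg
  have h : Real.log (a * (L + T)) ≤ Real.log (a * L) + T / L := by
    have e : a * (L + T) = a * L * (1 + T / L) := by field_simp
    rw [e, Real.log_mul (by positivity) (by positivity)]
    have := Real.log_le_sub_one_of_pos (show (0 : ℝ) < 1 + T / L by positivity)
    linarith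
  calc (L : ℝ) * Real.log (a * (L + T)) ≤ L * (Real.log (a * L) + T / L) := by gcongr
    _ = _ := by field_simp

end Bounds

/-! ### Assembling the run and its cost bounds. -/

section Main

variable {n : ℕ} {G : SimpleGraph (Fin n)} {S : Fin n → Type*} {P : Protocol G S}
  {adv : Adversary n} {ω : Coins n} {Rv : P.Resolver} {δ : ℝ}

theorem wordLen_le_of_le {Sc : Scheme} {D : ℕ} (hD : Sc.Fits n D) {r R : ℕ} (hr : r < R) :
    Sc.wordLen n (r + 1) ≤ Sc.wordLen n R := by
  obtain ⟨R, rfl⟩ : ∃ R', R = R' + 1 := ⟨R - 1, by omega⟩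
  exact monotone_nat_of_le_succ (f := fun r => Sc.wordLen n (r + 1))
    (fun r => hD.wordLen_mono (r + 1) (by omega)) (by omega)

theorem simulates_of_stopped {Sc : Scheme} {R : ℕ} {cfg : Config S}
    (hr : P.Run P.initConfig (simTrace Sc adv ω Rv R) cfg)
    (hI : (execution Sc adv ω Rv R).Inv Rv cfg) (hs : (execution Sc adv ω Rv R).Stopped) :
    (execution Sc adv ω Rv R).Simulates (simTrace Sc adv ω Rv R) := by
  refine ⟨cfg, hr, fun u => ?_, fun u => ⟨(hI.st_eq u).symm, ?_⟩⟩
  · rw [hist_eq_filter]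
  · rw [hI.st_eq]
    exact (hs u).1

theorem exists_simulated_run (hn : 2 ≤ n) (h0 : 0 < δ) (h1 : δ < 1) (hP : P.Terminates)
    (hF : ¬ Fails (concreteScheme δ) adv ω Rv) :
    ∃ (R : ℕ) (tr : List (Event n)),
      (execution (concreteScheme δ) adv ω Rv R).Stopped ∧
      (execution (concreteScheme δ) adv ω Rv R).Simulates tr ∧
      ((execution (concreteScheme δ) adv ω Rv R).bits : ℝ) ≤
        60000 * (totalBits tr * Real.log (n * totalBits tr / δ) + adv.flips.card) ∧
      ∃ p : List (MsgId n), IsCommPath tr p ∧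
        (elapsed (concreteScheme δ) n R : ℝ) ≤
          60000 * (p.length * Real.log (n * (totalBits tr + adv.flips.card) / δ) +
            flipsOnPath adv p) := by
  classical
  have hD := fits_concrete hn h0 h1
  set Sc := concreteScheme δ with hSc
  have hn' : (2 : ℝ) ≤ n := by exact_mod_cast hn
  have hex := exists_stopped hP hD hF
  obtain ⟨c, hc⟩ := exists_configs hP hD hF
  -- The first round count at which all have stopped: minimality gives a pending message before
  -- every earlier round, so that `rounds_le` applies.
  obtain ⟨R, hfin, hmin⟩ : ∃ R, (execution Sc adv ω Rv R).Stopped ∧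
      ∀ r < R, ¬ (execution Sc adv ω Rv r).Stopped :=
    ⟨Nat.find hex, Nat.find_spec hex, fun r hr => Nat.find_min hex hr⟩
  refine ⟨R, simTrace Sc adv ω Rv R, hfin,
    simulates_of_stopped (hc R).1 (hc R).2.1 hfin, ?_⟩
  set L := totalBits (simTrace Sc adv ω Rv R) with hL
  set T := adv.flips.card with hT
  have hLT : 0 ≤ (L : ℝ) * Real.log (n * L / δ) := by
    rcases Nat.eq_zero_or_pos L with h | h
    · simp [h]
    · refine mul_nonneg (Nat.cast_nonneg _) (Real.log_nonneg ?_)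
      linarith [two_lt_ratio hn h h0 h1]
  -- If the users stop before the first round, no bits are sent and no time passes, so the empty
  -- path suffices.
  rcases R with _ | R
  · refine ⟨?_, [], ⟨List.isChain_nil, by simp⟩, ?_⟩
    · change ((0 : ℕ) : ℝ) ≤ _
      rw [Nat.cast_zero]
      positivity
    · rw [show elapsed Sc n 0 = 0 by simp [elapsed, Scheme.roundStart], Nat.cast_zero]
      simp
  have hW : ∀ r < R + 1, Sc.wordLen n (r + 1) ≤ Sc.wordLen n (R + 1) :=
    fun r hr => wordLen_le_of_le hD hr
  have hpop : totalPopped (execution Sc adv ω Rv (R + 1)) ≤ L := totalPopped_le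
  have hflips := flipsOn_le_card (Sc := Sc) (adv := adv) Finset.univ (R + 1)
  have hRLT : R + 1 ≤ L + T := (rounds_le hP hD hF (R + 1) hmin).trans (by omega)
  obtain ⟨u, v, hq⟩ := exists_queue_of_not_stopped hP (hc R).2.1 (hc R).1 (hmin R (by omega))
  -- The message pending before the last round shows that `L` is positive, which is needed to
  -- replace `L + T` by `L` in the logarithm.
  have hL1 : 1 ≤ L := by
    have h2 := popped_add (hc R).2.1 u v
    have h3 := List.length_pos_of_ne_nil hq
    rw [sendCount_hist] at h2
    have h4 : sendCount (simTrace Sc adv ω Rv R) u v ≤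
        sendCount (simTrace Sc adv ω Rv (R + 1)) u v := by
      rw [simTrace, sendCount_append]
      exact Nat.le_add_right _ _
    have h5 : sendCount (simTrace Sc adv ω Rv (R + 1)) u v ≤
        ∑ u, ∑ v, sendCount (simTrace Sc adv ω Rv (R + 1)) u v :=
      (Finset.single_le_sum (f := fun v => sendCount (simTrace Sc adv ω Rv (R + 1)) u v)
        (fun _ _ => Nat.zero_le _) (Finset.mem_univ v)).trans
        (Finset.single_le_sum (f := fun u => ∑ v, sendCount (simTrace Sc adv ω Rv (R + 1)) u v)
          (fun _ _ => Nat.zero_le _) (Finset.mem_univ u))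
    have h6 := sum_sendCount_le (simTrace Sc adv ω Rv (R + 1))
    omega
  have hw := wordLen_le_log hn h0 h1 (Nat.le_add_left 1 R) hRLT
  rw [← hSc] at hw
  push_cast at hw
  constructor
  · have hb : ((execution Sc adv ω Rv (R + 1)).bits : ℝ) ≤
        4 * Sc.wordLen n (R + 1) * L + 4 * 6400 * T := by
      have := bits_le hP hD hF (R + 1) _ hW
      have h2 : (execution Sc adv ω Rv (R + 1)).bits ≤
          4 * Sc.wordLen n (R + 1) * L + 4 * 6400 * T :=
        this.trans (Nat.add_le_add (Nat.mul_le_mul_left _ hpop) (Nat.mul_le_mul_left _ hflips))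
      exact_mod_cast h2
    have hlog := mul_log_add_le (a := n / δ) (by positivity) (T := T) hL1
    rw [show (n / δ * (L + T) : ℝ) = n * (L + T) / δ by ring,
      show (n / δ * L : ℝ) = n * L / δ by ring] at hlog
    have h3 : (Sc.wordLen n (R + 1) : ℝ) * L ≤ 7000 * (L * Real.log (n * (L + T) / δ)) := by
      have := mul_le_mul_of_nonneg_right hw (Nat.cast_nonneg (α := ℝ) L)
      linarith
    have hT0 : (0 : ℝ) ≤ T := Nat.cast_nonneg _
    -- The messages cost `28000 L log (n (L + T) / δ)`, that is at most `28000 (L log (n L / δ) +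
    -- T)`. With `25600 T` for wasted rounds the total stays below the constant `60000`.
    linarith
  -- The path ends in a message pending before the last round; counting this message pays for the
  -- last round.
  · obtain ⟨p, hp1, hp2⟩ := exists_path hP hD hF R (Sc.wordLen n (R + 1))
      (fun r hr => hW r (by omega)) u v hq
    set p' := p ++ [((u, v), (execution Sc adv ω Rv R).popped u v)] with hp'
    refine ⟨p', hp1.append, ?_⟩
    have h2 : elapsed Sc n (R + 1) ≤
        4 * Sc.wordLen n (R + 1) * p'.length + 4 * 6400 * flipsOnPath adv p' := by
      have h3 := flipsOn_pathChannels_le (Sc := Sc) (adv := adv) p' R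
      have h4 : p'.length = p.length + 1 := by simp [hp']
      rw [elapsed_succ, h4, mul_add]
      omega
    have h5 : (elapsed Sc n (R + 1) : ℝ) ≤
        4 * Sc.wordLen n (R + 1) * p'.length + 4 * 6400 * flipsOnPath adv p' := by
      exact_mod_cast h2
    have h6 := mul_le_mul_of_nonneg_right hw (Nat.cast_nonneg (α := ℝ) p'.length)
    have h7 : (0 : ℝ) ≤ flipsOnPath adv p' := Nat.cast_nonneg _
    have h8 : 0 ≤ (Sc.wordLen n (R + 1) : ℝ) * p'.length := by positivity
    linarith

end Main

end RobustSim

end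

open RobustSim in
theorem mainTheorem2 :
    ∃ (A : AMDCode) (E : LinearECC) (K : ℕ) (C : ℝ),
      ∀ (n : ℕ), 2 ≤ n →
      ∀ (G : SimpleGraph (Fin n)) (S : Fin n → Type*) (P : Protocol G S) (Rv : P.Resolver),
      P.Terminates →
      ∀ (δ : ℝ), 0 < δ → δ < 1 →
      ∀ (adv : Adversary n),
        coinMeasure n {ω | Fails ⟨A, E, K, δ⟩ adv ω Rv} ≤ ENNReal.ofReal δ ∧
        ∀ ω : Coins n, ¬ Fails ⟨A, E, K, δ⟩ adv ω Rv →
          ∃ (R : ℕ) (tr : List (Event n)),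
            (execution ⟨A, E, K, δ⟩ adv ω Rv R).Stopped ∧
            (execution ⟨A, E, K, δ⟩ adv ω Rv R).Simulates tr ∧
            ((execution ⟨A, E, K, δ⟩ adv ω Rv R).bits : ℝ) ≤
              C * (totalBits tr * Real.log (n * totalBits tr / δ) + adv.flips.card) ∧
            ∃ p : List (MsgId n), IsCommPath tr p ∧
              (elapsed ⟨A, E, K, δ⟩ n R : ℝ) ≤
                C * (p.length * Real.log (n * (totalBits tr + adv.flips.card) / δ) +
                  flipsOnPath adv p) := by
  refine ⟨cubicAMD, wozencraftECC, 2400, 60000, ?_⟩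
  intro n hn G S P Rv hP δ h0 h1 adv
  exact ⟨measure_fails_le hn h0 h1, fun ω hF => exists_simulated_run hn h0 h1 hP hF⟩
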